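/- Let $X=(X_t)_{t\ge 0}$ be a real Lévy process with càdlàg paths such that neither $X$ nor $-X$ has almost surely non-decreasing paths and $\mathbb{E}_0[|X_1|]<\infty$, where $\mathbb{P}_x$ denotes the law of $X$ started from $x$. Let $q>0$ and $\beta>1$. For $a>0$, the double barrier strategy $\pi^a$ consists of the cumulative dividends $L^{\pi^a}$ and the cumulative capital injections $R^{\pi^a}$, both $0$ before time $0$, obtained from $X$ as follows; the controlled process is $U^{\pi^a}=X-L^{\pi^a}+R^{\pi^a}$. Until the first time $X$ passes above $a$ or below $0$, nothing is done. From a time $T$ at which the controlled process has passed above $a$, being at the level $\eta\ge a$ before correction, until it next passes below $0$, one puts $L^{\pi^a}_t=L^{\pi^a}_{T-}+(\eta-a)+\sup_{s\in[T,t]}\big((X_s-X_T)\vee 0\big)$ and keeps $R^{\pi^a}$ constant. From a time $T$ at which the controlled process has passed below $0$, being at the level $\eta\le 0$ before correction, until it next passes above $a$, one puts $R^{\pi^a}_t=R^{\pi^a}_{T-}-\eta-\inf_{s\in[T,t]}\big((X_s-X_T)\wedge 0\big)$ and keeps $L^{\pi^a}$ constant. If $X$ has bounded variation paths, with drift $\delta$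 (that is, $X_t=X_0+\delta t+\sum_{0<s\le t}\Delta X_s$, $\Delta X_s=X_s-X_{s-}$), the strategy $\pi^0$ is given by $$L^{\pi^0}_t=X_0\vee 0+(\delta\vee 0)\,t+\sum_{0<s\le t}(\Delta X_s)\vee 0,\qquad R^{\pi^0}_t=(-X_0)\vee 0+((-\delta)\vee 0)\,t+\sum_{0<s\le t}(-\Delta X_s)\vee 0 .$$ Put $$v^L_{\pi^a}(x)=\mathbb{E}_x\Big[\int_{[0,\infty)}e^{-qt}\,dL^{\pi^a}_t\Big],\quad v^R_{\pi^a}(x)=\mathbb{E}_x\Big[\int_{[0,\infty)}e^{-qt}\,dR^{\pi^a}_t\Big],\quad v_{\pi^a}(x)=v^L_{\pi^a}(x)-\beta\, v^R_{\pi^a}(x).$$ For $a>0$ let $Y^a_t=X_t-\big((\sup_{s\in[0,t]}X_s-a)\vee 0\big)$, $\kappa_0^{a,-}=\inf\{t>0:Y^a_t<0\}$, $\underline{\nu}(a)=\mathbb{E}_a\big[e^{-q\kappa_0^{a,-}}\big]$ (with $e^{-q\cdot\infty}=0$), and $$a^*=\inf\{a>0:\beta\,\underline{\nu}(a)\le 1\}.$$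 **Lemma 4.1.** The set $\{a>0:\beta\,\underline{\nu}(a)\le 1\}$ is non-empty, so that $0\le a^*<\infty$, and $a^*>0$ if $X$ does not have bounded variation paths, so that $\pi^{a^*}$ is always defined. For all $a,x\in[0,\infty)$, where $a=0$ is allowed only if $X$ has bounded variation paths, the quantities $v^L_{\pi^a}(x)$ and $v^R_{\pi^a}(x)$ are finite and $$v_{\pi^{a^*}}(x)\ \ge\ v_{\pi^a}(x).$$ -/

import Mathlib

open MeasureTheory ProbabilityTheory Set Filter Topology
open scoped NNReal ENNReal

noncomputable section

namespace DoubleBarrier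

/-- A real Lévy process started at `0`: independent and stationary increments and, almost surely,
right-continuous paths with left limits. -/
structure IsLevyProcess {Ω : Type*} [MeasurableSpace Ω] (X : ℝ≥0 → Ω → ℝ) (P : Measure Ω) :
    Prop where
  measurable : ∀ t, Measurable (X t)
  start_zero : ∀ᵐ ω ∂P, X 0 ω = 0
  indep_increments : HasIndepIncrements X P
  stationary : ∀ s t, IdentDistrib (fun ω => X (s + t) ω - X s ω) (X t) P P
  cadlag : ∀ᵐ ω ∂P, ∀ t, ContinuousWithinAt (fun s => X s ω) (Ici t) t ∧
    ∃ l, Tendsto (fun s => X s ω) (𝓝[<] t) (𝓝 l)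

/-- The process has (locally) bounded variation paths. -/
def HasBVPaths {Ω : Type*} [MeasurableSpace Ω] (X : ℝ≥0 → Ω → ℝ) (P : Measure Ω) : Prop :=
  ∀ᵐ ω ∂P, LocallyBoundedVariationOn (fun t => X t ω) univ

/-- The path of `X` translated so that it starts at `x`; its law under `P` is that of `X`
under `ℙ_x`. -/
def shifted {Ω : Type*} (X : ℝ≥0 → Ω → ℝ) (x : ℝ) (ω : Ω) : ℝ≥0 → ℝ := fun t => x + X t ω

/-- The infimum of the times at which `p` holds, `∞` if there are none. -/
def firstTime (p : ℝ≥0 → Prop) : ℝ≥0∞ := ⨅ (t : ℝ≥0) (_ : p t), (t : ℝ≥0∞)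

/-- The largest value of `f` on `[s, t]`. -/
def runningSup (f : ℝ≥0 → ℝ) (s t : ℝ≥0) : ℝ := sSup (f '' Icc s t)

/-- `e^{-qT}`, which is `0` for `T = ∞`. -/
def discount (q : ℝ) (T : ℝ≥0∞) : ℝ := if T = ∞ then 0 else Real.exp (-q * T.toReal)

/-! ### The strategy at a barrier `a > 0` -/

/-- A stage of the strategy. If `top`, the process is reflected downwards at the upper barrier,
otherwise it is reflected upwards at `0`. The stage begins at the time `start` (the stage is void
if this is `∞`); `paid` and `injected` are the dividends and the capital accumulated just before
`start`, and `level` is the position at `start` before the correction made at that time. -/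
structure Stage where
  top : Bool
  start : ℝ≥0∞
  paid : ℝ
  injected : ℝ
  level : ℝ

/-- The accumulated dividends at time `t`, as long as the stage `S` lasts. -/
def Stage.dividends (w : ℝ≥0 → ℝ) (a : ℝ) (S : Stage) (t : ℝ≥0) : ℝ :=
  if S.top then
    S.paid + ((S.level - a) +
      runningSup (fun s => max (w s - w S.start.toNNReal) 0) S.start.toNNReal t)
  else S.paid

/-- The accumulated capital injections at time `t`, as long as the stage `S` lasts. -/
def Stage.injections (w : ℝ≥0 → ℝ) (S : Stage) (t : ℝ≥0) : ℝ :=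
  if S.top then S.injected
  else
    S.injected + (-S.level +
      runningSup (fun s => max (-(w s - w S.start.toNNReal)) 0) S.start.toNNReal t)

/-- The controlled process at time `t`, as long as the stage `S` lasts. -/
def Stage.surplus (w : ℝ≥0 → ℝ) (a : ℝ) (S : Stage) (t : ℝ≥0) : ℝ :=
  S.level + (w t - w S.start.toNNReal) - (S.dividends w a t - S.paid)
    + (S.injections w t - S.injected)

/-- The first stage: it begins when `w` first leaves `[0, a]`, before that nothing is done. -/
def firstStage (w : ℝ≥0 → ℝ) (a : ℝ) : Stage :=
  let T₀ := firstTime fun t => 0 < t ∧ w t < 0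
  let Tₐ := firstTime fun t => 0 < t ∧ a < w t
  if T₀ < Tₐ then ⟨false, T₀, 0, 0, w T₀.toNNReal⟩ else ⟨true, Tₐ, 0, 0, w Tₐ.toNNReal⟩

/-- The end of a stage: a top stage lasts until the controlled process passes below `0`, a bottom
stage until it passes above `a`. -/
def Stage.finish (w : ℝ≥0 → ℝ) (a : ℝ) (S : Stage) : ℝ≥0∞ :=
  firstTime fun t => S.start ≤ (t : ℝ≥0∞) ∧
    if S.top then S.surplus w a t < 0 else a < S.surplus w a t

/-- The stage that follows `S`. -/
def Stage.next (w : ℝ≥0 → ℝ) (a : ℝ) (S : Stage) : Stage :=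
  let T := S.finish w a
  ⟨!S.top, T, S.dividends w a T.toNNReal, S.injections w T.toNNReal, S.surplus w a T.toNNReal⟩

/-- The successive stages. -/
def stage (w : ℝ≥0 → ℝ) (a : ℝ) (n : ℕ) : Stage := (Stage.next w a)^[n] (firstStage w a)

/-- The index of the stage that is running at time `t`: the last one begun by then. -/
def stageIndex (w : ℝ≥0 → ℝ) (a : ℝ) (t : ℝ≥0) : ℕ := sSup {n | (stage w a n).start ≤ (t : ℝ≥0∞)}

/-- The accumulated dividends of the double barrier strategy at `a > 0`. -/
def dividendsPos (w : ℝ≥0 → ℝ) (a : ℝ) (t : ℝ≥0) : ℝ :=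
  if (t : ℝ≥0∞) < (stage w a 0).start then 0
  else (stage w a (stageIndex w a t)).dividends w a t

/-- The accumulated capital injections of the double barrier strategy at `a > 0`. -/
def injectionsPos (w : ℝ≥0 → ℝ) (a : ℝ) (t : ℝ≥0) : ℝ :=
  if (t : ℝ≥0∞) < (stage w a 0).start then 0
  else (stage w a (stageIndex w a t)).injections w t

/-! ### The strategy at the barrier `0`, for paths of bounded variation -/

/-- The jump `w t - w (t-)`; it is `0` at `t = 0`. -/
def jump (w : ℝ≥0 → ℝ) (t : ℝ≥0) : ℝ := w t - Function.leftLim w t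

/-- The drift `δ` of a Lévy process with bounded variation paths. The continuous part
`X_t - X_0 - ∑_{0 < s ≤ t} ΔX_s` of such a process is almost surely equal to `δ t` (with
`δ = γ - ∫_{|x| < 1} x Π(dx)` in terms of the characteristics), and `δ` is read off at `t = 1`. -/
def drift {Ω : Type*} [MeasurableSpace Ω] (X : ℝ≥0 → Ω → ℝ) (P : Measure Ω) : ℝ :=
  ∫ ω, (X 1 ω - X 0 ω - ∑' s : Ioc (0 : ℝ≥0) 1, jump (fun t => X t ω) s) ∂P

/-- The accumulated dividends of the double barrier strategy at `0`; `δ` is the drift. -/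
def dividendsZero (δ : ℝ) (w : ℝ≥0 → ℝ) (t : ℝ≥0) : ℝ :=
  max (w 0) 0 + max δ 0 * t + ∑' s : Ioc (0 : ℝ≥0) t, max (jump w s) 0

/-- The accumulated capital injections of the double barrier strategy at `0`. -/
def injectionsZero (δ : ℝ) (w : ℝ≥0 → ℝ) (t : ℝ≥0) : ℝ :=
  max (-w 0) 0 + max (-δ) 0 * t + ∑' s : Ioc (0 : ℝ≥0) t, max (-jump w s) 0

/-! ### Expected net present values -/

/-- The accumulated dividends of the double barrier strategy at `a ≥ 0`. -/
def dividends (δ a : ℝ) (w : ℝ≥0 → ℝ) (t : ℝ≥0) : ℝ :=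
  if a = 0 then dividendsZero δ w t else dividendsPos w a t

/-- The accumulated capital injections of the double barrier strategy at `a ≥ 0`. -/
def injections (δ a : ℝ) (w : ℝ≥0 → ℝ) (t : ℝ≥0) : ℝ :=
  if a = 0 then injectionsZero δ w t else injectionsPos w a t

/-- `F` extended by `0` to negative times, in accordance with `F (0-) = 0`. -/
def extendByZero (F : ℝ≥0 → ℝ) (t : ℝ) : ℝ := if t < 0 then 0 else F t.toNNReal

open scoped Classical in
/-- The Stieltjes integral `∫_{[0, ∞)} e^{-qt} dF_t` of a non-decreasing right-continuous `F ≥ 0`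
with `F (0-) = 0`, so that the mass `F 0` at time `0` is counted. -/
def npv (q : ℝ) (F : ℝ≥0 → ℝ) : ℝ≥0∞ :=
  if h : Monotone (extendByZero F) then
    ∫⁻ t in Ici (0 : ℝ), ENNReal.ofReal (Real.exp (-q * t)) ∂h.stieltjesFunction.measure
  else 0

section Values

variable {Ω : Type*} [MeasurableSpace Ω] (X : ℝ≥0 → Ω → ℝ) (P : Measure Ω)

/-- The expected net present value of the dividends of the double barrier strategy at `a`, when
the risk process starts from `x`. -/
def valueL (q a x : ℝ) : ℝ≥0∞ := ∫⁻ ω, npv q (dividends (drift X P) a (shifted X x ω)) ∂P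

/-- The expected net present value of the capital injections of the double barrier strategy. -/
def valueR (q a x : ℝ) : ℝ≥0∞ := ∫⁻ ω, npv q (injections (drift X P) a (shifted X x ω)) ∂P

/-- The expected net present value of the double barrier strategy at `a`, when a unit of injected
capital costs `β`. -/
def value (q β a x : ℝ) : ℝ := (valueL X P q a x).toReal - β * (valueR X P q a x).toReal

/-! ### The candidate barrier -/

/-- The path `w` reflected downwards at `a`. -/
def reflectedAt (a : ℝ) (w : ℝ≥0 → ℝ) (t : ℝ≥0) : ℝ := w t - max (runningSup w 0 t - a) 0

/-- The first time the reflected path passes below `0`. -/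
def kappa (a : ℝ) (w : ℝ≥0 → ℝ) : ℝ≥0∞ := firstTime fun t => 0 < t ∧ reflectedAt a w t < 0

/-- The Laplace transform at `q` of `kappa a` for the process started from `a`. -/
def nu (q a : ℝ) : ℝ := ∫ ω, discount q (kappa a (shifted X a ω)) ∂P

/-- The barriers over which the infimum that defines the candidate barrier is taken. -/
def barrierSet (q β : ℝ) : Set ℝ := {a | 0 < a ∧ β * nu X P q a ≤ 1}

/-- The candidate barrier `a*`. -/
def aStar (q β : ℝ) : ℝ := sInf (barrierSet X P q β)

end Values

end DoubleBarrier

end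

noncomputable section

namespace DoubleBarrier

/-! ### Càdlàg paths -/

/-- The path is right-continuous and has left limits. -/
def IsCadlag (w : ℝ≥0 → ℝ) : Prop :=
  ∀ t, ContinuousWithinAt w (Ici t) t ∧ ∃ l, Tendsto w (𝓝[<] t) (𝓝 l)

lemma IsCadlag.neg {w : ℝ≥0 → ℝ} (hw : IsCadlag w) : IsCadlag fun t => -w t := fun t =>
  ⟨(hw t).1.neg, by obtain ⟨l, hl⟩ := (hw t).2; exact ⟨-l, hl.neg⟩⟩

lemma IsCadlag.const_add {w : ℝ≥0 → ℝ} (hw : IsCadlag w) (x : ℝ) : IsCadlag fun t => x + w t :=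
  fun t => ⟨(hw t).1.const_add x, by obtain ⟨l, hl⟩ := (hw t).2; exact ⟨x + l, hl.const_add x⟩⟩

lemma IsCadlag.exists_right {w : ℝ≥0 → ℝ} (hw : IsCadlag w) (t : ℝ≥0) {ε : ℝ} (hε : 0 < ε) :
    ∃ u, t < u ∧ ∀ s, t ≤ s → s < u → |w s - w t| < ε := by
  have h := Metric.tendsto_nhdsWithin_nhds.1 (hw t).1 ε hε
  obtain ⟨δ, hδ, h⟩ := h
  refine ⟨t + ⟨δ, hδ.le⟩, lt_add_of_pos_right _ hδ, fun s hts hs => ?_⟩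
  have := h (x := s) hts (by
    rw [NNReal.dist_eq, abs_of_nonneg (sub_nonneg.2 (NNReal.coe_le_coe.2 hts))]
    have : (s : ℝ) < t + δ := by exact_mod_cast hs
    linarith)
  rwa [Real.dist_eq] at this

lemma IsCadlag.exists_left {w : ℝ≥0 → ℝ} (hw : IsCadlag w) {t : ℝ≥0} (ht : 0 < t) {ε : ℝ}
    (hε : 0 < ε) : ∃ u < t, ∀ r s, u < r → r < t → u < s → s < t → |w r - w s| < ε := by
  obtain ⟨l, hl⟩ := (hw t).2
  have h : ∀ᶠ s in 𝓝[<] t, |w s - l| < ε / 2 := by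
    filter_upwards [hl.eventually (Metric.ball_mem_nhds l (half_pos hε))] with s hs
    rwa [Real.dist_eq] at hs
  obtain ⟨u, hu, h⟩ := (mem_nhdsLT_iff_exists_Ioo_subset' ht).1 h
  refine ⟨u, hu, fun r s hr hr' hs hs' => ?_⟩
  have h1 : |w r - l| < ε / 2 := h ⟨hr, hr'⟩
  have h2 : |w s - l| < ε / 2 := h ⟨hs, hs'⟩
  rw [abs_lt] at *
  constructor <;> linarith

lemma IsCadlag.exists_bound {w : ℝ≥0 → ℝ} (hw : IsCadlag w) (s t : ℝ≥0) :
    ∃ C, ∀ u ∈ Icc s t, |w u| ≤ C := by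
  refine isCompact_Icc.induction_on (p := fun A => ∃ C, ∀ u ∈ A, |w u| ≤ C) ⟨0, by simp⟩
    (fun A B hAB ⟨C, hC⟩ => ⟨C, fun u hu => hC u (hAB hu)⟩)
    (fun A B ⟨C, hC⟩ ⟨D, hD⟩ => ⟨max C D, fun u hu => hu.elim
      (fun h => (hC u h).trans (le_max_left _ _)) fun h => (hD u h).trans (le_max_right _ _)⟩)
    fun u _ => ?_
  obtain ⟨l, hl⟩ := (hw u).2
  have h1 : {v | |w v| ≤ |w u| + |l| + 1} ∈ 𝓝[<] u := by
    filter_upwards [hl.abs.eventually (gt_mem_nhds (lt_add_one |l|))] with v hv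
    have := abs_nonneg (w u)
    change |w v| ≤ _; linarith
  have h2 : {v | |w v| ≤ |w u| + |l| + 1} ∈ 𝓝[≥] u := by
    filter_upwards [(hw u).1.abs.eventually (gt_mem_nhds (lt_add_one |w u|))] with v hv
    have := abs_nonneg l
    change |w v| ≤ _; linarith
  refine ⟨{v | |w v| ≤ |w u| + |l| + 1}, nhdsWithin_le_nhds ?_, _, fun v hv => hv⟩
  rw [← nhdsLT_sup_nhdsGE]
  exact mem_sup.2 ⟨h1, h2⟩

/-! ### First times and running suprema -/

lemma firstTime_lt_iff {p : ℝ≥0 → Prop} {T : ℝ≥0∞} :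
    firstTime p < T ↔ ∃ t : ℝ≥0, p t ∧ (t : ℝ≥0∞) < T := by
  simp [firstTime, iInf_lt_iff]

lemma firstTime_le {p : ℝ≥0 → Prop} {t : ℝ≥0} (h : p t) : firstTime p ≤ t := iInf₂_le t h

lemma le_firstTime_iff {p : ℝ≥0 → Prop} {T : ℝ≥0∞} :
    T ≤ firstTime p ↔ ∀ t : ℝ≥0, p t → T ≤ t := by
  simp [firstTime]

lemma not_of_lt_firstTime {p : ℝ≥0 → Prop} {t : ℝ≥0} (h : (t : ℝ≥0∞) < firstTime p) : ¬ p t :=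
  fun h' => (firstTime_le h').not_gt h

lemma firstTime_congr {p p' : ℝ≥0 → Prop} (h : ∀ t, p t ↔ p' t) : firstTime p = firstTime p' :=
  congrArg firstTime (funext fun t => propext (h t))

lemma IsCadlag.bddAbove_image {w : ℝ≥0 → ℝ} (hw : IsCadlag w) (c : ℝ) (s t : ℝ≥0) :
    BddAbove ((fun u => max (w u - c) 0) '' Icc s t) := by
  obtain ⟨C, hC⟩ := hw.exists_bound s t
  refine ⟨max (C - c) 0, ?_⟩
  rintro _ ⟨u, hu, rfl⟩
  have := (le_abs_self _).trans (hC u hu)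
  exact max_le_max (by linarith) le_rfl

lemma runningSup_posPart_le_iff {w : ℝ≥0 → ℝ} (hw : IsCadlag w) {T t : ℝ≥0} (h : T ≤ t) {c : ℝ} :
    runningSup (fun s => max (w s - w T) 0) T t ≤ c ↔ ∀ s ∈ Icc T t, w s - w T ≤ c := by
  rw [runningSup, csSup_le_iff (hw.bddAbove_image _ _ _) ((nonempty_Icc.2 h).image _)]
  simp only [mem_image, forall_exists_index, and_imp, forall_apply_eq_imp_iff₂, max_le_iff]
  refine ⟨fun H s hs => (H s hs).1, fun H s hs => ⟨H s hs, ?_⟩⟩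
  simpa using H T ⟨le_rfl, h⟩

/-! ### The end of a stage -/

/-- The first time at which the path has fallen by more than `a` from a level attained
since `T`. -/
def downTime (a : ℝ) (w : ℝ≥0 → ℝ) (T : ℝ≥0∞) : ℝ≥0∞ :=
  firstTime fun t => ∃ s : ℝ≥0, T ≤ s ∧ s ≤ t ∧ a < w s - w t

lemma le_downTime (a : ℝ) (w : ℝ≥0 → ℝ) (T : ℝ≥0∞) : T ≤ downTime a w T :=
  le_firstTime_iff.2 fun _ ⟨_, h, h', _⟩ => h.trans (ENNReal.coe_le_coe.2 h')

lemma downTime_top (a : ℝ) (w : ℝ≥0 → ℝ) : downTime a w ∞ = ∞ :=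
  top_le_iff.1 (le_downTime a w ∞)

lemma lt_downTime {a : ℝ} (ha : 0 < a) {w : ℝ≥0 → ℝ} (hw : IsCadlag w) (T : ℝ≥0) :
    (T : ℝ≥0∞) < downTime a w T := by
  obtain ⟨u, hu, h⟩ := hw.exists_right T (half_pos ha)
  refine (ENNReal.coe_lt_coe.2 hu).trans_le (le_firstTime_iff.2 ?_)
  rintro t ⟨s, hs, hst, hlt⟩
  by_contra! hlt'
  norm_cast at hs hlt'
  have h1 := abs_lt.1 (h s hs (hst.trans_lt hlt'))
  have h2 := abs_lt.1 (h t (hs.trans hst) hlt')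
  linarith

lemma exists_of_downTime_eq {a : ℝ} {w : ℝ≥0 → ℝ} (hw : IsCadlag w) {T : ℝ≥0∞} {D : ℝ≥0}
    (h : downTime a w T = D) {η : ℝ} (hη : 0 < η) (ha : 0 < a) :
    ∃ s : ℝ≥0, T ≤ s ∧ s ≤ D ∧ a - η < w s - w D := by
  obtain ⟨u, hu, h'⟩ := hw.exists_right D (lt_min (half_pos hη) (half_pos ha))
  have : downTime a w T < u := h ▸ ENNReal.coe_lt_coe.2 hu
  obtain ⟨t, ⟨s, hs, hst, hlt⟩, htu⟩ := firstTime_lt_iff.1 this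
  have hDt : D ≤ t := by
    rw [← ENNReal.coe_le_coe, ← h]; exact firstTime_le ⟨s, hs, hst, hlt⟩
  norm_cast at htu
  have h1 := abs_lt.1 ((h' t hDt htu).trans_le (min_le_left _ _))
  have h1' := abs_lt.1 ((h' t hDt htu).trans_le (min_le_right _ _))
  rcases le_total s D with hsD | hsD
  · exact ⟨s, hs, hsD, by linarith⟩
  · have h2 := abs_lt.1 ((h' s hsD (hst.trans_lt htu)).trans_le (min_le_left _ _))
    have h3 := abs_lt.1 ((h' s hsD (hst.trans_lt htu)).trans_le (min_le_right _ _))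
    linarith

/-! ### A single stage -/

section OneStage

variable {w : ℝ≥0 → ℝ} {a : ℝ} {S : Stage} {t : ℝ≥0} {c : ℝ}

lemma Stage.dividends_of_not_top (h : S.top = false) : S.dividends w a t = S.paid := by
  simp [Stage.dividends, h]

lemma Stage.injections_of_top (h : S.top = true) : S.injections w t = S.injected := by
  simp [Stage.injections, h]

lemma Stage.dividends_le_iff (hw : IsCadlag w) (h : S.top = true) (ht : S.start.toNNReal ≤ t) :
    S.dividends w a t ≤ c ↔
      ∀ s ∈ Icc S.start.toNNReal t, S.paid + (S.level - a) + (w s - w S.start.toNNReal) ≤ c := by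
  have := runningSup_posPart_le_iff hw ht (c := c - (S.paid + (S.level - a)))
  simp only [Stage.dividends, h, if_true]
  rw [← add_assoc, ← le_sub_iff_add_le', this]
  exact forall₂_congr fun s _ => le_sub_iff_add_le'

lemma Stage.injections_le_iff (hw : IsCadlag w) (h : S.top = false) (ht : S.start.toNNReal ≤ t) :
    S.injections w t ≤ c ↔
      ∀ s ∈ Icc S.start.toNNReal t, S.injected - S.level - (w s - w S.start.toNNReal) ≤ c := by
  have := runningSup_posPart_le_iff hw.neg ht (c := c - (S.injected - S.level))
  simp only [Stage.injections, h, Bool.false_eq_true, if_false]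
  have e : (fun s => max (-(w s - w S.start.toNNReal)) 0) =
      fun s => max (-w s - -w S.start.toNNReal) 0 := by
    ext s; congr 1; ring
  rw [e, ← add_assoc, ← sub_eq_add_neg, ← le_sub_iff_add_le', this]
  exact forall₂_congr fun s _ => by constructor <;> intro H <;> linarith

lemma Stage.dividends_mono (hw : IsCadlag w) {s : ℝ≥0} (hs : S.start.toNNReal ≤ s) (hst : s ≤ t) :
    S.dividends w a s ≤ S.dividends w a t := by
  cases h : S.top
  · rw [dividends_of_not_top h, dividends_of_not_top h]
  · rw [Stage.dividends_le_iff hw h hs]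
    exact fun u hu => (Stage.dividends_le_iff hw h (hs.trans hst)).1 le_rfl u
      ⟨hu.1, hu.2.trans hst⟩

lemma Stage.injections_mono (hw : IsCadlag w) {s : ℝ≥0} (hs : S.start.toNNReal ≤ s) (hst : s ≤ t) :
    S.injections w s ≤ S.injections w t := by
  cases h : S.top
  · rw [Stage.injections_le_iff hw h hs]
    exact fun u hu => (Stage.injections_le_iff hw h (hs.trans hst)).1 le_rfl u
      ⟨hu.1, hu.2.trans hst⟩
  · rw [injections_of_top h, injections_of_top h]

lemma Stage.surplus_le (hw : IsCadlag w) (h : S.top = true) (ht : S.start.toNNReal ≤ t) :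
    S.surplus w a t ≤ a := by
  have := (Stage.dividends_le_iff hw h ht).1 (le_refl (S.dividends w a t)) t ⟨ht, le_rfl⟩
  rw [Stage.surplus, injections_of_top h]
  linarith

lemma Stage.surplus_nonneg (hw : IsCadlag w) (h : S.top = false) (ht : S.start.toNNReal ≤ t) :
    0 ≤ S.surplus w a t := by
  have := (Stage.injections_le_iff hw h ht).1 (le_refl (S.injections w t)) t ⟨ht, le_rfl⟩
  rw [Stage.surplus, dividends_of_not_top h]
  linarith

lemma Stage.surplus_neg_iff (hw : IsCadlag w) (h : S.top = true) (ht : S.start.toNNReal ≤ t) :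
    S.surplus w a t < c ↔ ∃ s ∈ Icc S.start.toNNReal t, a - c < w s - w t := by
  have := (Stage.dividends_le_iff hw h ht (a := a)
    (c := S.level + (w t - w S.start.toNNReal) + S.paid - c)).not
  rw [not_le] at this
  rw [Stage.surplus, injections_of_top h]
  push Not at this
  refine Iff.trans ?_ (this.trans ?_)
  · constructor <;> intro H <;> linarith
  · exact exists_congr fun s => and_congr_right fun _ => by constructor <;> intro H <;> linarith

lemma Stage.lt_surplus_iff (hw : IsCadlag w) (h : S.top = false) (ht : S.start.toNNReal ≤ t) :
    c < S.surplus w a t ↔ ∃ s ∈ Icc S.start.toNNReal t, c < w t - w s := by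
  have := (Stage.injections_le_iff hw h ht
    (c := c - (S.level + (w t - w S.start.toNNReal)) + S.injected)).not
  rw [not_le] at this
  rw [Stage.surplus, dividends_of_not_top h]
  push Not at this
  refine Iff.trans ?_ (this.trans ?_)
  · constructor <;> intro H <;> linarith
  · exact exists_congr fun s => and_congr_right fun _ => by constructor <;> intro H <;> linarith

lemma toNNReal_le_of_le {T : ℝ≥0∞} (h : T ≤ t) : T.toNNReal ≤ t := by
  simpa using ENNReal.toNNReal_mono ENNReal.coe_ne_top h

lemma le_coe_iff_toNNReal_le {T : ℝ≥0∞} {s : ℝ≥0} (hT : T ≠ ∞) : T ≤ s ↔ T.toNNReal ≤ s := by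
  lift T to ℝ≥0 using hT
  simp

lemma Stage.finish_of_top (hw : IsCadlag w) (h : S.top = true) :
    S.finish w a = downTime a w S.start := by
  refine firstTime_congr fun t => ?_
  simp only [h, if_true]
  constructor
  · rintro ⟨h1, h2⟩
    obtain ⟨s, hs, hlt⟩ := (Stage.surplus_neg_iff hw h (toNNReal_le_of_le h1)).1 h2
    have hne : S.start ≠ ∞ := (h1.trans_lt ENNReal.coe_lt_top).ne
    exact ⟨s, (le_coe_iff_toNNReal_le hne).2 hs.1, hs.2, by linarith⟩
  · rintro ⟨s, hs, hst, hlt⟩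
    have h1 : S.start ≤ t := hs.trans (ENNReal.coe_le_coe.2 hst)
    exact ⟨h1, (Stage.surplus_neg_iff hw h (toNNReal_le_of_le h1)).2
      ⟨s, ⟨toNNReal_le_of_le hs, hst⟩, by linarith⟩⟩

lemma Stage.finish_of_not_top (hw : IsCadlag w) (h : S.top = false) :
    S.finish w a = downTime a (fun t => -w t) S.start := by
  refine firstTime_congr fun t => ?_
  simp only [h, Bool.false_eq_true, if_false]
  constructor
  · rintro ⟨h1, h2⟩
    obtain ⟨s, hs, hlt⟩ := (Stage.lt_surplus_iff hw h (toNNReal_le_of_le h1)).1 h2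
    have hne : S.start ≠ ∞ := (h1.trans_lt ENNReal.coe_lt_top).ne
    exact ⟨s, (le_coe_iff_toNNReal_le hne).2 hs.1, hs.2, by linarith⟩
  · rintro ⟨s, hs, hst, hlt⟩
    have h1 : S.start ≤ t := hs.trans (ENNReal.coe_le_coe.2 hst)
    exact ⟨h1, (Stage.lt_surplus_iff hw h (toNNReal_le_of_le h1)).2
      ⟨s, ⟨toNNReal_le_of_le hs, hst⟩, by linarith⟩⟩

lemma Stage.start_le_finish : S.start ≤ S.finish w a :=
  le_firstTime_iff.2 fun _ h => h.1

lemma Stage.start_lt_finish (hw : IsCadlag w) (ha : 0 < a) (hS : S.start ≠ ∞) :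
    S.start < S.finish w a := by
  lift S.start to ℝ≥0 using hS with T hT
  cases h : S.top
  · rw [Stage.finish_of_not_top hw h, ← hT]; exact lt_downTime ha hw.neg T
  · rw [Stage.finish_of_top hw h, ← hT]; exact lt_downTime ha hw T

/-- At the end of a top stage the surplus is at most `0`. -/
lemma Stage.surplus_finish_nonpos (hw : IsCadlag w) (ha : 0 < a) (h : S.top = true)
    (hf : S.finish w a ≠ ∞) : S.surplus w a (S.finish w a).toNNReal ≤ 0 := by
  by_contra! hlt
  have hle := Stage.start_le_finish (S := S) (w := w) (a := a)
  have hs : S.start ≠ ∞ := (hle.trans_lt hf.lt_top).ne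
  have e := Stage.finish_of_top (a := a) hw h
  rw [← ENNReal.coe_toNNReal hf] at e hle
  obtain ⟨s, h1, h2, h3⟩ := exists_of_downTime_eq hw e.symm hlt ha
  exact ((Stage.surplus_neg_iff hw h (toNNReal_le_of_le hle)).2
    ⟨s, ⟨toNNReal_le_of_le h1, h2⟩, h3⟩).false

/-- At the end of a bottom stage the surplus is at least `a`. -/
lemma Stage.le_surplus_finish (hw : IsCadlag w) (ha : 0 < a) (h : S.top = false)
    (hf : S.finish w a ≠ ∞) : a ≤ S.surplus w a (S.finish w a).toNNReal := by
  by_contra! hlt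
  have hle := Stage.start_le_finish (S := S) (w := w) (a := a)
  have hs : S.start ≠ ∞ := (hle.trans_lt hf.lt_top).ne
  have e := Stage.finish_of_not_top (a := a) hw h
  rw [← ENNReal.coe_toNNReal hf] at e hle
  obtain ⟨s, h1, h2, h3⟩ := exists_of_downTime_eq hw.neg e.symm (sub_pos.2 hlt) ha
  exact ((Stage.lt_surplus_iff hw h (toNNReal_le_of_le hle)).2
    ⟨s, ⟨toNNReal_le_of_le h1, h2⟩, by linarith⟩).false

end OneStage

/-! ### The sequence of stages -/

section Stages

variable {w : ℝ≥0 → ℝ} {a : ℝ}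

lemma IsCadlag.firstTime_neg {f : ℝ≥0 → ℝ} (hf : IsCadlag f) {T : ℝ≥0∞} (hT : T ≠ ∞)
    (h : T = firstTime fun t => 0 < t ∧ f t < 0) : f T.toNNReal ≤ 0 := by
  lift T to ℝ≥0 using hT
  by_contra! hlt
  obtain ⟨u, hu, h'⟩ := hf.exists_right T hlt
  have : firstTime (fun t => 0 < t ∧ f t < 0) < u := h ▸ ENNReal.coe_lt_coe.2 hu
  obtain ⟨t, ht, htu⟩ := firstTime_lt_iff.1 this
  have hTt : T ≤ t := by
    rw [← ENNReal.coe_le_coe, h]; exact firstTime_le ht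
  have := abs_lt.1 (h' t hTt (by exact_mod_cast htu))
  simp only [ENNReal.toNNReal_coe] at *
  linarith [ht.2]

lemma IsCadlag.nonneg_of_lt_firstTime {f : ℝ≥0 → ℝ} (hf : IsCadlag f) {t : ℝ≥0}
    (h : (t : ℝ≥0∞) < firstTime fun t => 0 < t ∧ f t < 0) : 0 ≤ f t := by
  by_contra! hlt
  obtain ⟨u, hu, h'⟩ := hf.exists_right t (neg_pos.2 hlt)
  obtain ⟨s, hs, hsu⟩ := exists_between (lt_min (ENNReal.coe_lt_coe.2 hu) h)
  lift s to ℝ≥0 using (hsu.trans_le (min_le_left _ _)).ne_top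
  norm_cast at hs
  have := abs_lt.1 (h' s hs.le (by exact_mod_cast hsu.trans_le (min_le_left _ _)))
  exact not_of_lt_firstTime (hsu.trans_le (min_le_right _ _)) ⟨hs.pos, by linarith⟩

lemma firstStage_paid : (firstStage w a).paid = 0 := by
  simp only [firstStage]; split_ifs <;> rfl

lemma firstStage_injected : (firstStage w a).injected = 0 := by
  simp only [firstStage]; split_ifs <;> rfl

lemma firstStage_level : (firstStage w a).level = w (firstStage w a).start.toNNReal := by
  simp only [firstStage]; split_ifs <;> rfl

lemma firstStage_of_top (h : (firstStage w a).top = true) :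
    (firstStage w a).start = (firstTime fun t => 0 < t ∧ a < w t) ∧
      (firstTime fun t => 0 < t ∧ a < w t) ≤ firstTime fun t => 0 < t ∧ w t < 0 := by
  simp only [firstStage] at *
  split_ifs at h ⊢ with h'
  exact ⟨rfl, not_lt.1 h'⟩

lemma firstStage_of_not_top (h : (firstStage w a).top = false) :
    (firstStage w a).start = (firstTime fun t => 0 < t ∧ w t < 0) ∧
      (firstTime fun t => 0 < t ∧ w t < 0) < firstTime fun t => 0 < t ∧ a < w t := by
  simp only [firstStage] at *
  split_ifs at h ⊢ with h'
  exact ⟨rfl, h'⟩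

lemma firstTime_gt_eq : (firstTime fun t => 0 < t ∧ a < w t) =
    firstTime fun t => 0 < t ∧ a + -w t < 0 :=
  firstTime_congr fun t => and_congr_right fun _ => by constructor <;> intro <;> linarith

lemma firstStage_le_level (hw : IsCadlag w) (h : (firstStage w a).top = true)
    (hs : (firstStage w a).start ≠ ∞) : a ≤ (firstStage w a).level := by
  have := (hw.neg.const_add a).firstTime_neg hs ((firstStage_of_top h).1.trans firstTime_gt_eq)
  rw [firstStage_level]; linarith

lemma firstStage_level_nonpos (hw : IsCadlag w) (h : (firstStage w a).top = false)
    (hs : (firstStage w a).start ≠ ∞) : (firstStage w a).level ≤ 0 := by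
  have := hw.firstTime_neg hs (firstStage_of_not_top h).1
  rwa [firstStage_level]

lemma mem_Icc_of_lt_firstStage (hw : IsCadlag w) {t : ℝ≥0}
    (ht : (t : ℝ≥0∞) < (firstStage w a).start) : w t ∈ Icc 0 a := by
  have h1 : (t : ℝ≥0∞) < firstTime fun t => 0 < t ∧ w t < 0 := by
    cases h : (firstStage w a).top
    · exact ht.trans_eq (firstStage_of_not_top h).1
    · exact (ht.trans_eq (firstStage_of_top h).1).trans_le (firstStage_of_top h).2
  have h2 : (t : ℝ≥0∞) < firstTime fun t => 0 < t ∧ a < w t := by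
    cases h : (firstStage w a).top
    · exact (ht.trans_eq (firstStage_of_not_top h).1).trans (firstStage_of_not_top h).2
    · exact ht.trans_eq (firstStage_of_top h).1
  rw [firstTime_gt_eq] at h2
  have := (hw.neg.const_add a).nonneg_of_lt_firstTime h2
  exact ⟨hw.nonneg_of_lt_firstTime h1, by linarith⟩

lemma stage_zero : stage w a 0 = firstStage w a := rfl

lemma stage_succ (n : ℕ) : stage w a (n + 1) = (stage w a n).next w a :=
  Function.iterate_succ_apply' _ _ _

lemma stage_succ_start (n : ℕ) : (stage w a (n + 1)).start = (stage w a n).finish w a := by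
  rw [stage_succ]; rfl

lemma stage_succ_top (n : ℕ) : (stage w a (n + 1)).top = !(stage w a n).top := by
  rw [stage_succ]; rfl

lemma stage_succ_paid (n : ℕ) : (stage w a (n + 1)).paid =
    (stage w a n).dividends w a (stage w a (n + 1)).start.toNNReal := by
  rw [stage_succ]; rfl

lemma stage_succ_injected (n : ℕ) : (stage w a (n + 1)).injected =
    (stage w a n).injections w (stage w a (n + 1)).start.toNNReal := by
  rw [stage_succ]; rfl

lemma stage_succ_level (n : ℕ) : (stage w a (n + 1)).level =
    (stage w a n).surplus w a (stage w a (n + 1)).start.toNNReal := by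
  rw [stage_succ]; rfl

lemma stage_start_le_succ (n : ℕ) : (stage w a n).start ≤ (stage w a (n + 1)).start := by
  rw [stage_succ_start]; exact Stage.start_le_finish

lemma stage_start_mono : Monotone fun n => (stage w a n).start :=
  monotone_nat_of_le_succ stage_start_le_succ

lemma stage_start_lt_succ (hw : IsCadlag w) (ha : 0 < a) {n : ℕ} (h : (stage w a n).start ≠ ∞) :
    (stage w a n).start < (stage w a (n + 1)).start := by
  rw [stage_succ_start]; exact Stage.start_lt_finish hw ha h

lemma stage_le_level (hw : IsCadlag w) (ha : 0 < a) {n : ℕ} (h : (stage w a n).top = true)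
    (hs : (stage w a n).start ≠ ∞) : a ≤ (stage w a n).level := by
  cases n with
  | zero => exact firstStage_le_level hw h hs
  | succ n =>
    rw [stage_succ_top, Bool.not_eq_true'] at h
    rw [stage_succ_start] at hs
    rw [stage_succ_level, stage_succ_start]
    exact Stage.le_surplus_finish hw ha h hs

lemma stage_level_nonpos (hw : IsCadlag w) (ha : 0 < a) {n : ℕ} (h : (stage w a n).top = false)
    (hs : (stage w a n).start ≠ ∞) : (stage w a n).level ≤ 0 := by
  cases n with
  | zero => exact firstStage_level_nonpos hw h hs
  | succ n =>
    rw [stage_succ_top, Bool.not_eq_false'] at h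
    rw [stage_succ_start] at hs
    rw [stage_succ_level, stage_succ_start]
    exact Stage.surplus_finish_nonpos hw ha h hs

lemma stage_level (n : ℕ) : (stage w a n).level =
    w (stage w a n).start.toNNReal - (stage w a n).paid + (stage w a n).injected := by
  induction n with
  | zero => rw [stage_zero, firstStage_paid, firstStage_injected, firstStage_level]; ring
  | succ n ih => rw [stage_succ_level, stage_succ_paid, stage_succ_injected, Stage.surplus, ih]; ring

lemma stage_surplus (n : ℕ) (t : ℝ≥0) : (stage w a n).surplus w a t =
    w t - (stage w a n).dividends w a t + (stage w a n).injections w t := by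
  rw [Stage.surplus, stage_level]; ring

lemma exists_lt_stage_start (hw : IsCadlag w) (ha : 0 < a) (t : ℝ≥0) :
    ∃ n, (t : ℝ≥0∞) < (stage w a n).start := by
  by_contra! h
  have hfin : ∀ n, (stage w a n).start ≠ ∞ := fun n => ((h n).trans_lt ENNReal.coe_lt_top).ne
  choose T hT using fun n => Option.ne_none_iff_exists.1 (hfin n)
  change ∀ n, (T n : ℝ≥0∞) = _ at hT
  have hlt : ∀ n, T n < T (n + 1) := fun n => by
    rw [← ENNReal.coe_lt_coe, hT, hT]; exact stage_start_lt_succ hw ha (hfin n)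
  have hbdd : BddAbove (range T) := by
    refine ⟨t, ?_⟩
    rintro _ ⟨n, rfl⟩
    rw [← ENNReal.coe_le_coe, hT]; exact h n
  set M := ⨆ n, T n
  have hM : ∀ n, T n < M := fun n => (hlt n).trans_le (le_ciSup hbdd _)
  obtain ⟨u, hu, hosc⟩ := hw.exists_left (zero_le.trans_lt (hM 0)) ha
  obtain ⟨n, hn⟩ := exists_lt_of_lt_ciSup hu
  have hcross : ∃ r s, T n ≤ s ∧ s ≤ r ∧ r < M ∧ a < |w s - w r| := by
    have h1 : (stage w a n).finish w a < M := by
      rw [← stage_succ_start, ← hT]; exact ENNReal.coe_lt_coe.2 (hM _)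
    cases htop : (stage w a n).top
    · rw [Stage.finish_of_not_top hw htop, ← hT] at h1
      obtain ⟨r, ⟨s, h2, h3, h4⟩, h5⟩ := firstTime_lt_iff.1 h1
      exact ⟨r, s, by exact_mod_cast h2, h3, by exact_mod_cast h5,
        lt_of_lt_of_le (by linarith) (neg_abs_le (w s - w r) |> neg_le.1)⟩
    · rw [Stage.finish_of_top hw htop, ← hT] at h1
      obtain ⟨r, ⟨s, h2, h3, h4⟩, h5⟩ := firstTime_lt_iff.1 h1
      exact ⟨r, s, by exact_mod_cast h2, h3, by exact_mod_cast h5, h4.trans_le (le_abs_self _)⟩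
  obtain ⟨r, s, h1, h2, h3, h4⟩ := hcross
  exact absurd (hosc s r (hn.trans_le h1) (h2.trans_lt h3) (hn.trans_le (h1.trans h2)) h3)
    h4.not_gt

lemma exists_stage (hw : IsCadlag w) (ha : 0 < a) {t : ℝ≥0} (ht : (stage w a 0).start ≤ t) :
    ∃ n, (stage w a n).start ≤ t ∧ (t : ℝ≥0∞) < (stage w a (n + 1)).start := by
  classical
  have h := exists_lt_stage_start hw ha t
  obtain ⟨n, hn⟩ : ∃ n, Nat.find h = n + 1 :=
    Nat.exists_eq_succ_of_ne_zero fun h0 => ht.not_gt (h0 ▸ Nat.find_spec h)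
  exact ⟨n, not_lt.1 (Nat.find_min h (by lia)), hn ▸ Nat.find_spec h⟩

lemma stageIndex_eq {n : ℕ} {t : ℝ≥0} (h1 : (stage w a n).start ≤ t)
    (h2 : (t : ℝ≥0∞) < (stage w a (n + 1)).start) : stageIndex w a t = n := by
  have : {k | (stage w a k).start ≤ (t : ℝ≥0∞)} = Iic n := by
    ext k
    refine ⟨fun hk => ?_, fun hk => (stage_start_mono hk).trans h1⟩
    by_contra hnk
    rw [mem_Iic, not_le] at hnk
    exact (h2.trans_le (stage_start_mono (Nat.succ_le_of_lt hnk))).not_ge hk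
  rw [stageIndex, this, csSup_Iic]

lemma dividendsPos_of_lt {t : ℝ≥0} (h : (t : ℝ≥0∞) < (stage w a 0).start) :
    dividendsPos w a t = 0 := if_pos h

lemma injectionsPos_of_lt {t : ℝ≥0} (h : (t : ℝ≥0∞) < (stage w a 0).start) :
    injectionsPos w a t = 0 := if_pos h

lemma dividendsPos_eq {n : ℕ} {t : ℝ≥0} (h1 : (stage w a n).start ≤ t)
    (h2 : (t : ℝ≥0∞) < (stage w a (n + 1)).start) :
    dividendsPos w a t = (stage w a n).dividends w a t := by
  rw [dividendsPos, if_neg ((stage_start_mono n.zero_le).trans h1).not_gt, stageIndex_eq h1 h2]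

lemma injectionsPos_eq {n : ℕ} {t : ℝ≥0} (h1 : (stage w a n).start ≤ t)
    (h2 : (t : ℝ≥0∞) < (stage w a (n + 1)).start) :
    injectionsPos w a t = (stage w a n).injections w t := by
  rw [injectionsPos, if_neg ((stage_start_mono n.zero_le).trans h1).not_gt, stageIndex_eq h1 h2]

/-! ### Admissible strategies and the comparison with the double barrier strategy -/

/-- Non-decreasing dividends and injections that keep the controlled process in `[0, b]`. -/
structure IsAdmissible (w L R : ℝ≥0 → ℝ) (b : ℝ) : Prop where
  monoL : Monotone L
  monoR : Monotone R
  nonnegL : ∀ t, 0 ≤ L t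
  nonnegR : ∀ t, 0 ≤ R t
  nonneg : ∀ t, 0 ≤ w t - L t + R t
  le : ∀ t, w t - L t + R t ≤ b

lemma stage_dividends_start_mono (hw : IsCadlag w) (ha : 0 < a) {n m : ℕ} (hnm : n ≤ m) {s t : ℝ≥0}
    (hst : s ≤ t) (hs : (stage w a n).start ≤ s) (hs' : (s : ℝ≥0∞) < (stage w a (n + 1)).start)
    (ht : (stage w a m).start ≤ t) :
    (stage w a n).dividends w a s ≤ (stage w a m).dividends w a t ∧
      (stage w a n).injections w s ≤ (stage w a m).injections w t := by
  induction m, hnm using Nat.le_induction generalizing t with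
  | base =>
    exact ⟨Stage.dividends_mono hw (toNNReal_le_of_le hs) hst,
      Stage.injections_mono hw (toNNReal_le_of_le hs) hst⟩
  | succ m hnm ih =>
    have hfin : (stage w a (m + 1)).start ≠ ∞ := (ht.trans_lt ENNReal.coe_lt_top).ne
    have hle := toNNReal_le_of_le ht
    have hsT : s ≤ (stage w a (m + 1)).start.toNNReal := by
      rw [← ENNReal.coe_le_coe, ENNReal.coe_toNNReal hfin]
      exact hs'.le.trans (stage_start_mono (by lia : n + 1 ≤ m + 1))
    have := ih hsT (by rw [ENNReal.coe_toNNReal hfin]; exact stage_start_le_succ m)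
    rw [← stage_succ_paid, ← stage_succ_injected] at this
    refine ⟨this.1.trans ?_, this.2.trans ?_⟩
    · cases htop : (stage w a (m + 1)).top
      · rw [Stage.dividends_of_not_top htop]
      · have h1 := (Stage.dividends_le_iff (a := a) hw htop hle).1 le_rfl _ ⟨le_rfl, hle⟩
        have h2 := stage_le_level hw ha htop hfin
        linarith
    · cases htop : (stage w a (m + 1)).top
      · have h1 := (Stage.injections_le_iff hw htop hle).1 le_rfl _ ⟨le_rfl, hle⟩
        have h2 := stage_level_nonpos hw ha htop hfin
        linarith
      · rw [Stage.injections_of_top htop]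

lemma stage_dividends_nonneg (hw : IsCadlag w) (ha : 0 < a) {n : ℕ} {t : ℝ≥0}
    (ht : (stage w a n).start ≤ t) :
    0 ≤ (stage w a n).dividends w a t ∧ 0 ≤ (stage w a n).injections w t := by
  have h0 : (stage w a 0).start ≤ t := (stage_start_mono n.zero_le).trans ht
  have hfin : (stage w a 0).start ≠ ∞ := (h0.trans_lt ENNReal.coe_lt_top).ne
  have h1 : 0 ≤ (stage w a 0).dividends w a (stage w a 0).start.toNNReal ∧
      0 ≤ (stage w a 0).injections w (stage w a 0).start.toNNReal := by
    cases htop : (stage w a 0).top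
    · have h1 := (Stage.injections_le_iff hw htop le_rfl).1 le_rfl _ ⟨le_rfl, le_rfl⟩
      have h2 := stage_level_nonpos hw ha htop hfin
      rw [Stage.dividends_of_not_top htop, stage_zero, firstStage_paid]
      rw [stage_zero, firstStage_injected] at h1
      rw [stage_zero] at h2
      exact ⟨le_rfl, by linarith⟩
    · have h1 := (Stage.dividends_le_iff (a := a) hw htop le_rfl).1 le_rfl _ ⟨le_rfl, le_rfl⟩
      have h2 := stage_le_level hw ha htop hfin
      rw [Stage.injections_of_top htop, stage_zero, firstStage_injected]
      rw [stage_zero, firstStage_paid] at h1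
      rw [stage_zero] at h2
      exact ⟨by linarith, le_rfl⟩
  have h2 := stage_dividends_start_mono hw ha n.zero_le (toNNReal_le_of_le h0)
    (ENNReal.coe_toNNReal hfin).ge
    (by rw [ENNReal.coe_toNNReal hfin]; exact stage_start_lt_succ hw ha hfin) ht
  exact ⟨h1.1.trans h2.1, h1.2.trans h2.2⟩

lemma pos_mono (hw : IsCadlag w) (ha : 0 < a) {s t : ℝ≥0} (hst : s ≤ t) :
    dividendsPos w a s ≤ dividendsPos w a t ∧ injectionsPos w a s ≤ injectionsPos w a t := by
  by_cases hs : (s : ℝ≥0∞) < (stage w a 0).start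
  · rw [dividendsPos_of_lt hs, injectionsPos_of_lt hs]
    by_cases ht : (t : ℝ≥0∞) < (stage w a 0).start
    · rw [dividendsPos_of_lt ht, injectionsPos_of_lt ht]; exact ⟨le_rfl, le_rfl⟩
    · obtain ⟨m, hm, hm'⟩ := exists_stage hw ha (not_lt.1 ht)
      rw [dividendsPos_eq hm hm', injectionsPos_eq hm hm']
      exact stage_dividends_nonneg hw ha hm
  · obtain ⟨n, hn, hn'⟩ := exists_stage hw ha (not_lt.1 hs)
    obtain ⟨m, hm, hm'⟩ := exists_stage hw ha ((not_lt.1 hs).trans (ENNReal.coe_le_coe.2 hst))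
    rw [dividendsPos_eq hm hm', injectionsPos_eq hm hm', dividendsPos_eq hn hn',
      injectionsPos_eq hn hn']
    refine stage_dividends_start_mono hw ha ?_ hst hn hn' hm
    by_contra! h
    exact (hm'.trans_le (stage_start_mono (Nat.succ_le_of_lt h))).not_ge
      (hn.trans (ENNReal.coe_le_coe.2 hst))

lemma isAdmissible_pos (hw : IsCadlag w) (ha : 0 < a) :
    IsAdmissible w (dividendsPos w a) (injectionsPos w a) a := by
  have key : ∀ t, 0 ≤ dividendsPos w a t ∧ 0 ≤ injectionsPos w a t ∧
      w t - dividendsPos w a t + injectionsPos w a t ∈ Icc 0 a := fun t => by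
    by_cases ht : (t : ℝ≥0∞) < (stage w a 0).start
    · rw [dividendsPos_of_lt ht, injectionsPos_of_lt ht, sub_zero, add_zero]
      exact ⟨le_rfl, le_rfl, mem_Icc_of_lt_firstStage hw ht⟩
    obtain ⟨n, hn, hn'⟩ := exists_stage hw ha (not_lt.1 ht)
    rw [dividendsPos_eq hn hn', injectionsPos_eq hn hn', ← stage_surplus]
    have h0 := stage_dividends_nonneg hw ha hn
    refine ⟨h0.1, h0.2, ?_⟩
    rw [stage_succ_start] at hn'
    have h := not_of_lt_firstTime hn'
    cases htop : (stage w a n).top <;> simp only [htop, hn, true_and, not_lt, if_true,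
      Bool.false_eq_true, if_false] at h
    · exact ⟨Stage.surplus_nonneg hw htop (toNNReal_le_of_le hn), h⟩
    · exact ⟨h, Stage.surplus_le hw htop (toNNReal_le_of_le hn)⟩
  exact ⟨fun s t h => (pos_mono hw ha h).1, fun s t h => (pos_mono hw ha h).2,
    fun t => (key t).1, fun t => (key t).2.1, fun t => (key t).2.2.1, fun t => (key t).2.2.2⟩

variable (w a) in
/-- The number of top stages up to the stage `n`. -/
def topCount (n : ℕ) : ℕ := ∑ k ∈ Finset.range (n + 1), if (stage w a k).top then 1 else 0

variable (w a) in
/-- The number of bottom stages up to the stage `n`, without the first stage. -/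
def bottomCount (n : ℕ) : ℕ := ∑ k ∈ Finset.range n, if (stage w a (k + 1)).top then 0 else 1

lemma stage_le_of_isAdmissible (hw : IsCadlag w) {L R : ℝ≥0 → ℝ} {b : ℝ}
    (hLR : IsAdmissible w L R b) (n : ℕ) (t : ℝ≥0) (h : (stage w a n).start ≤ t)
    (ht : (t : ℝ≥0∞) ≤ (stage w a (n + 1)).start) :
    (stage w a n).dividends w a t ≤ L t + topCount w a n * (b - a) ∧
      (stage w a n).injections w t ≤ R t + bottomCount w a n * (b - a) := by
  induction n generalizing t with
  | zero =>
    have hT := toNNReal_le_of_le h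
    have hc : topCount w a 0 = if (stage w a 0).top then 1 else 0 :=
      Finset.sum_range_one _
    have hc' : bottomCount w a 0 = 0 := by simp [bottomCount]
    rw [hc, hc', stage_zero] at *
    cases htop : (firstStage w a).top
    · rw [Stage.dividends_of_not_top htop, Stage.injections_le_iff hw htop hT, firstStage_paid,
        firstStage_injected, firstStage_level]
      refine ⟨by simpa using hLR.nonnegL t, fun s hs => ?_⟩
      have := hLR.nonneg s
      have := hLR.nonnegL s
      have := hLR.monoR hs.2
      simp; linarith
    · rw [Stage.injections_of_top htop, Stage.dividends_le_iff hw htop hT, firstStage_paid,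
        firstStage_injected, firstStage_level]
      refine ⟨fun s hs => ?_, by simpa using hLR.nonnegR t⟩
      have := hLR.le s
      have := hLR.nonnegR s
      have := hLR.monoL hs.2
      simp; linarith
  | succ n ih =>
    have hc : topCount w a (n + 1) = topCount w a n + if (stage w a (n + 1)).top then 1 else 0 :=
      Finset.sum_range_succ _ _
    have hc' : bottomCount w a (n + 1) =
        bottomCount w a n + if (stage w a (n + 1)).top then 0 else 1 := Finset.sum_range_succ _ _
    have hT := toNNReal_le_of_le h
    have hfin : (stage w a (n + 1)).start ≠ ∞ := (h.trans_lt ENNReal.coe_lt_top).ne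
    have hle := stage_start_le_succ (w := w) (a := a) n
    have hfin' : (stage w a n).start ≠ ∞ := (hle.trans_lt hfin.lt_top).ne
    have hle' : (stage w a n).start.toNNReal ≤ (stage w a (n + 1)).start.toNNReal :=
      ENNReal.toNNReal_mono hfin hle
    have hprev : ∀ s ∈ Icc (stage w a n).start.toNNReal (stage w a (n + 1)).start.toNNReal,
        (stage w a n).dividends w a s ≤ L s + topCount w a n * (b - a) ∧
        (stage w a n).injections w s ≤ R s + bottomCount w a n * (b - a) := fun s hs => by
      refine ih s ((le_coe_iff_toNNReal_le hfin').2 hs.1) ?_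
      rw [← ENNReal.coe_toNNReal hfin]; exact ENNReal.coe_le_coe.2 hs.2
    have hend := hprev _ ⟨hle', le_rfl⟩
    have hmL := hLR.monoL hT
    have hmR := hLR.monoR hT
    rw [hc, hc']
    have htop' := stage_succ_top (w := w) (a := a) n
    cases htop : (stage w a (n + 1)).top
    · rw [htop, eq_comm, Bool.not_eq_false'] at htop'
      rw [Stage.dividends_of_not_top htop, Stage.injections_le_iff hw htop hT, stage_succ_paid,
        stage_succ_injected, stage_succ_level, Stage.injections_of_top htop']
      refine ⟨by simp; linarith [hend.1], fun u hu => ?_⟩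
      rw [Stage.surplus, Stage.injections_of_top htop']
      suffices (stage w a n).dividends w a (stage w a (n + 1)).start.toNNReal ≤
          R t + bottomCount w a n * (b - a) + (b - a) - (stage w a n).injected
          + (stage w a n).level + (w u - w (stage w a n).start.toNNReal) + (stage w a n).paid by
        simp; linarith
      rw [Stage.dividends_le_iff hw htop' hle']
      intro s hs
      have h1 := hprev s hs
      rw [Stage.injections_of_top htop'] at h1
      have h2 := hLR.le s
      have h3 := hLR.nonneg u
      have h4 := hLR.monoR hu.2
      have h5 := hLR.monoL (hs.2.trans hu.1)
      linarith [h1.2]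
    · rw [htop, eq_comm, Bool.not_eq_true'] at htop'
      rw [Stage.injections_of_top htop, Stage.dividends_le_iff hw htop hT, stage_succ_paid,
        stage_succ_injected, stage_succ_level, Stage.dividends_of_not_top htop']
      refine ⟨fun u hu => ?_, by simp; linarith [hend.2]⟩
      rw [Stage.surplus, Stage.dividends_of_not_top htop']
      suffices (stage w a n).injections w (stage w a (n + 1)).start.toNNReal ≤
          L t + topCount w a n * (b - a) + (b - a) - (stage w a n).paid + a
          - (stage w a n).level - (w u - w (stage w a n).start.toNNReal)
          + (stage w a n).injected by
        simp; linarith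
      rw [Stage.injections_le_iff hw htop' hle']
      intro s hs
      have h1 := hprev s hs
      rw [Stage.dividends_of_not_top htop'] at h1
      have h2 := hLR.le u
      have h3 := hLR.nonneg s
      have h4 := hLR.monoL hu.2
      have h5 := hLR.monoR (hs.2.trans hu.1)
      linarith [h1.1]

end Stages

/-! ### The successive crossing times -/

section Crossing

variable {w : ℝ≥0 → ℝ} {a : ℝ}

/-- The time at which the first top stage begins, followed by the beginnings of the later stages;
the top stages begin at the even indices. -/
def crossTime (a : ℝ) (w : ℝ≥0 → ℝ) : ℕ → ℝ≥0∞
  | 0 => firstTime fun t => a < w t ∨ ∃ s ≤ t, a < w t - w s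
  | n + 1 => downTime a (if Even n then w else fun t => -w t) (crossTime a w n)

lemma crossTime_zero : crossTime a w 0 = firstTime fun t => a < w t ∨ ∃ s ≤ t, a < w t - w s := rfl

lemma crossTime_succ (n : ℕ) : crossTime a w (n + 1) =
    downTime a (if Even n then w else fun t => -w t) (crossTime a w n) := rfl

lemma crossTime_mono : Monotone (crossTime a w) :=
  monotone_nat_of_le_succ fun _ => le_downTime _ _ _

lemma start_eq_crossTime_zero_of_top (hw : IsCadlag w) (h : (firstStage w a).top = true) :
    (firstStage w a).start = crossTime a w 0 := by
  refine le_antisymm (le_firstTime_iff.2 fun t ht => ?_) ?_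
  · by_contra! hlt
    have h1 := mem_Icc_of_lt_firstStage hw hlt
    rcases ht with ht | ⟨s, hs, ht⟩
    · exact ht.not_ge h1.2
    · have h2 := mem_Icc_of_lt_firstStage hw ((ENNReal.coe_le_coe.2 hs).trans_lt hlt)
      linarith [h1.2, h2.1]
  · rw [(firstStage_of_top h).1]
    exact le_firstTime_iff.2 fun t ht => firstTime_le (Or.inl ht.2)

lemma finish_eq_crossTime_zero_of_not_top (hw : IsCadlag w)
    (h : (firstStage w a).top = false) : (firstStage w a).finish w a = crossTime a w 0 := by
  rw [Stage.finish_of_not_top hw h]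
  obtain ⟨h1, h2⟩ := firstStage_of_not_top h
  have hfin : (firstStage w a).start ≠ ∞ := by rw [h1]; exact (h2.trans_le le_top).ne
  refine le_antisymm (le_firstTime_iff.2 fun t ht => ?_) (le_firstTime_iff.2 ?_)
  · have key : a < w t → downTime a (fun t => -w t) (firstStage w a).start ≤ t := fun hlt => by
      have hTa : (firstTime fun t => 0 < t ∧ a < w t) ≤ t := by
        by_contra! hlt'
        rw [firstTime_gt_eq] at hlt'
        have := (hw.neg.const_add a).nonneg_of_lt_firstTime hlt'
        linarith
      have hst : (firstStage w a).start ≤ t := h1.trans_le (h2.le.trans hTa)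
      have hl := firstStage_level_nonpos hw h hfin
      rw [firstStage_level] at hl
      exact firstTime_le ⟨(firstStage w a).start.toNNReal, (ENNReal.coe_toNNReal hfin).ge,
        toNNReal_le_of_le hst, by linarith⟩
    rcases ht with ht | ⟨s, hs, ht⟩
    · exact key ht
    · by_cases hs' : (firstStage w a).start ≤ s
      · exact firstTime_le ⟨s, hs', hs, by linarith⟩
      · exact key (by linarith [(mem_Icc_of_lt_firstStage hw (not_le.1 hs')).1])
  · rintro t ⟨s, -, hst, hlt⟩
    exact firstTime_le (Or.inr ⟨s, hst, by linarith⟩)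

variable (w a) in
/-- The number of stages before the first top stage. -/
def stageOffset : ℕ := if (firstStage w a).top then 0 else 1

lemma stage_add_offset (hw : IsCadlag w) (n : ℕ) :
    (stage w a (n + stageOffset w a)).start = crossTime a w n ∧
      ((stage w a (n + stageOffset w a)).top = true ↔ Even n) := by
  induction n with
  | zero =>
    cases h : (firstStage w a).top
    · simp [stageOffset, h, stage_succ_start, stage_succ_top, stage_zero,
        finish_eq_crossTime_zero_of_not_top hw h]
    · simp [stageOffset, h, stage_zero, start_eq_crossTime_zero_of_top hw h]
  | succ n ih =>
    rw [show n + 1 + stageOffset w a = n + stageOffset w a + 1 by ring, stage_succ_start,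
      stage_succ_top, crossTime_succ, ← ih.1]
    cases h : (stage w a (n + stageOffset w a)).top
    · have hn : ¬ Even n := by rw [← ih.2, h]; simp
      rw [if_neg hn, Stage.finish_of_not_top hw h]
      simp [Nat.even_add_one, hn]
    · have hn : Even n := by rw [← ih.2, h]
      rw [if_pos hn, Stage.finish_of_top hw h]
      simp [Nat.even_add_one, hn]

lemma start_zero_le_crossTime (hw : IsCadlag w) (n : ℕ) :
    (stage w a 0).start ≤ crossTime a w n := by
  rw [← (stage_add_offset hw n).1]; exact stage_start_mono (Nat.zero_le _)

/-- The number of top stages begun by the time `t`. -/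
def numTop (a : ℝ) (w : ℝ≥0 → ℝ) (t : ℝ≥0) : ℕ := {j | crossTime a w (2 * j) ≤ t}.ncard

/-- The number of bottom stages that follow a top stage begun by the time `t`. -/
def numBottom (a : ℝ) (w : ℝ≥0 → ℝ) (t : ℝ≥0) : ℕ := {j | crossTime a w (2 * j + 1) ≤ t}.ncard

lemma crossTime_le_iff (hw : IsCadlag w) {n : ℕ} {t : ℝ≥0} (h1 : (stage w a n).start ≤ t)
    (h2 : (t : ℝ≥0∞) < (stage w a (n + 1)).start) (k : ℕ) :
    crossTime a w k ≤ t ↔ k + stageOffset w a ≤ n := by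
  rw [← (stage_add_offset hw k).1]
  refine ⟨fun h => ?_, fun h => (stage_start_mono h).trans h1⟩
  by_contra! hlt
  exact (h2.trans_le (stage_start_mono (Nat.succ_le_of_lt hlt))).not_ge h

lemma topCount_eq (hw : IsCadlag w) {n : ℕ} {t : ℝ≥0} (h1 : (stage w a n).start ≤ t)
    (h2 : (t : ℝ≥0∞) < (stage w a (n + 1)).start) : topCount w a n = numTop a w t := by
  have e := Set.ncard_image_of_injective (f := fun j => 2 * j + stageOffset w a)
    {j | crossTime a w (2 * j) ≤ t} (fun i j h => by simpa using h)
  rw [numTop, topCount, Finset.sum_boole, Nat.cast_id, ← Set.ncard_coe_finset, ← e]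
  congr 1
  ext k
  simp only [Finset.coe_filter, Finset.mem_range, mem_ofPred_eq, mem_image,
    crossTime_le_iff hw h1 h2]
  constructor
  · rintro ⟨hk, hk'⟩
    have hko : stageOffset w a ≤ k := by
      by_contra! hlt
      have : k = 0 := by simp only [stageOffset] at hlt; split_ifs at hlt <;> lia
      subst this
      simp only [stage_zero] at hk'
      simp [stageOffset, hk'] at hlt
    obtain ⟨m, rfl⟩ := Nat.exists_eq_add_of_le' hko
    obtain ⟨j, rfl⟩ := ((stage_add_offset hw m).2.1 hk').two_dvd
    exact ⟨j, by lia, rfl⟩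
  · rintro ⟨j, hj, rfl⟩
    exact ⟨by lia, (stage_add_offset hw _).2.2 (even_two_mul j)⟩

lemma bottomCount_eq (hw : IsCadlag w) {n : ℕ} {t : ℝ≥0} (h1 : (stage w a n).start ≤ t)
    (h2 : (t : ℝ≥0∞) < (stage w a (n + 1)).start) : bottomCount w a n = numBottom a w t := by
  have : bottomCount w a n = ∑ k ∈ Finset.range n, if ¬ (stage w a (k + 1)).top then 1 else 0 :=
    Finset.sum_congr rfl fun k _ => by split_ifs <;> simp_all
  have e := Set.ncard_image_of_injective (f := fun j => 2 * j + stageOffset w a)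
    {j | crossTime a w (2 * j + 1) ≤ t} (fun i j h => by simpa using h)
  rw [numBottom, this, Finset.sum_boole, Nat.cast_id, ← Set.ncard_coe_finset, ← e]
  congr 1
  ext k
  simp only [Finset.coe_filter, Finset.mem_range, mem_ofPred_eq, mem_image,
    crossTime_le_iff hw h1 h2]
  constructor
  · rintro ⟨hk, hk'⟩
    have hko : stageOffset w a ≤ k + 1 := by
      simp only [stageOffset]; split_ifs <;> lia
    obtain ⟨m, hm⟩ := Nat.exists_eq_add_of_le' hko
    rw [hm, (stage_add_offset hw m).2, Nat.not_even_iff_odd] at hk'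
    obtain ⟨j, rfl⟩ := hk'
    exact ⟨j, by lia, by lia⟩
  · rintro ⟨j, hj, rfl⟩
    refine ⟨by lia, ?_⟩
    rw [show 2 * j + stageOffset w a + 1 = 2 * j + 1 + stageOffset w a by ring,
      (stage_add_offset hw _).2]
    simp

lemma finite_crossTime_le (hw : IsCadlag w) (ha : 0 < a) (t : ℝ≥0) :
    {n | crossTime a w n ≤ t}.Finite := by
  obtain ⟨n, hn⟩ := exists_lt_stage_start hw ha t
  refine (finite_lt_nat n).subset fun k hk => ?_
  by_contra hnk
  simp only [mem_ofPred_eq, not_lt] at hnk hk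
  rw [← (stage_add_offset hw k).1] at hk
  exact (hn.trans_le (stage_start_mono (hnk.trans (Nat.le_add_right _ _)))).not_ge hk

lemma finite_top (hw : IsCadlag w) (ha : 0 < a) (t : ℝ≥0) :
    {j | crossTime a w (2 * j) ≤ t}.Finite :=
  (finite_crossTime_le hw ha t).preimage (f := fun j => 2 * j) fun i _ j _ h => by simpa using h

lemma finite_bottom (hw : IsCadlag w) (ha : 0 < a) (t : ℝ≥0) :
    {j | crossTime a w (2 * j + 1) ≤ t}.Finite :=
  (finite_crossTime_le hw ha t).preimage (f := fun j => 2 * j + 1) fun i _ j _ h => by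
    simpa using h

/-- The double barrier strategy at `a` compared with a strategy that keeps the controlled process
in `[0, b]`. -/
theorem pos_le_of_isAdmissible (hw : IsCadlag w) (ha : 0 < a) {L R : ℝ≥0 → ℝ} {b : ℝ}
    (hLR : IsAdmissible w L R b) (t : ℝ≥0) :
    dividendsPos w a t ≤ L t + numTop a w t * (b - a) ∧
      injectionsPos w a t ≤ R t + numBottom a w t * (b - a) := by
  by_cases ht : (t : ℝ≥0∞) < (stage w a 0).start
  · have h1 : ∀ n, ¬ crossTime a w n ≤ t := fun n =>
      (ht.trans_le (start_zero_le_crossTime hw n)).not_ge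
    rw [dividendsPos_of_lt ht, injectionsPos_of_lt ht]
    simpa [numTop, numBottom, h1] using ⟨hLR.nonnegL t, hLR.nonnegR t⟩
  · obtain ⟨n, hn, hn'⟩ := exists_stage hw ha (not_lt.1 ht)
    rw [dividendsPos_eq hn hn', injectionsPos_eq hn hn', ← topCount_eq hw hn hn',
      ← bottomCount_eq hw hn hn']
    exact stage_le_of_isAdmissible hw hLR n t hn hn'.le

end Crossing

/-! ### Discounting at the rate `q` as stopping at an exponential time -/

/-- The exponential distribution with parameter `q`, as a measure on the time axis. -/
def kill (q : ℝ) : Measure ℝ≥0 := (expMeasure q).map Real.toNNReal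

section Kill

variable {q : ℝ}

lemma expMeasure_absolutelyContinuous (q : ℝ) : expMeasure q ≪ volume :=
  withDensity_absolutelyContinuous _ _

lemma isProbabilityMeasure_kill (hq : 0 < q) : IsProbabilityMeasure (kill q) :=
  have := isProbabilityMeasure_expMeasure hq
  Measure.isProbabilityMeasure_map (by fun_prop)

lemma expMeasure_Ici (hq : 0 < q) {t : ℝ} (ht : 0 ≤ t) :
    expMeasure q (Ici t) = ENNReal.ofReal (Real.exp (-q * t)) := by
  have := isProbabilityMeasure_expMeasure hq
  have h1 : expMeasure q (Ici t) = expMeasure q (Ioi t) :=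
    measure_congr ((expMeasure_absolutelyContinuous q).ae_le Ioi_ae_eq_Ici.symm)
  have h2 := cdf_expMeasure_eq hq t
  rw [if_pos ht, cdf_eq_real] at h2
  rw [h1, ← compl_Iic, ← ofReal_measureReal, measureReal_compl measurableSet_Iic, h2]
  simp

lemma ae_nonneg_expMeasure (q : ℝ) : ∀ᵐ s ∂expMeasure q, 0 ≤ s := by
  rw [ae_iff]
  simp only [not_le]
  change expMeasure q (Iio 0) = 0
  rw [expMeasure, gammaMeasure, withDensity_apply _ measurableSet_Iio]
  exact lintegral_exponentialPDF_of_nonpos le_rfl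

lemma lintegral_kill {f : ℝ≥0 → ℝ≥0∞} (hf : Measurable f) :
    ∫⁻ s, f s ∂kill q = ∫⁻ s, f s.toNNReal ∂expMeasure q :=
  lintegral_map hf (by fun_prop)

lemma kill_Ici (hq : 0 < q) (t : ℝ≥0) :
    kill q (Ici t) = ENNReal.ofReal (Real.exp (-q * t)) := by
  rw [kill, Measure.map_apply (by fun_prop) measurableSet_Ici, ← expMeasure_Ici hq t.coe_nonneg]
  refine measure_congr ?_
  filter_upwards [ae_nonneg_expMeasure q] with s hs
  refine propext ?_
  change t ≤ s.toNNReal ↔ (t : ℝ) ≤ s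
  rw [← NNReal.coe_le_coe, Real.coe_toNNReal s hs]

lemma kill_ge (hq : 0 < q) (T : ℝ≥0∞) :
    kill q {s | T ≤ s} = ENNReal.ofReal (discount q T) := by
  by_cases hT : T = ∞
  · simp [hT, discount]
  · lift T to ℝ≥0 using hT
    simp only [ENNReal.coe_le_coe, discount, ENNReal.coe_ne_top, if_false, ENNReal.coe_toReal]
    exact kill_Ici hq T

lemma discount_nonneg (q : ℝ) (T : ℝ≥0∞) : 0 ≤ discount q T := by
  rw [discount]; split_ifs <;> positivity

lemma discount_anti (hq : 0 < q) {S T : ℝ≥0∞} (h : S ≤ T) : discount q T ≤ discount q S := by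
  by_cases hT : T = ∞
  · rw [hT, discount, if_pos rfl]; exact discount_nonneg q S
  · have hS : S ≠ ∞ := (h.trans_lt (Ne.lt_top hT)).ne
    rw [discount, discount, if_neg hT, if_neg hS]
    have := ENNReal.toReal_mono hT h
    exact Real.exp_le_exp.2 (by nlinarith)

lemma discount_le_one (hq : 0 < q) (T : ℝ≥0∞) : discount q T ≤ 1 := by
  have := discount_anti hq (zero_le : 0 ≤ T)
  simpa [discount] using this

lemma measurable_discount (q : ℝ) : Measurable (discount q) := by
  unfold discount
  exact Measurable.ite (measurableSet_singleton _) measurable_const (by fun_prop)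

variable {F : ℝ≥0 → ℝ}

lemma extendByZero_of_neg {t : ℝ} (h : t < 0) : extendByZero F t = 0 := if_pos h

lemma extendByZero_of_nonneg {t : ℝ} (h : 0 ≤ t) : extendByZero F t = F t.toNNReal :=
  if_neg h.not_gt

lemma monotone_extendByZero (hF : Monotone F) (h0 : ∀ t, 0 ≤ F t) :
    Monotone (extendByZero F) := fun s t hst => by
  rcases lt_or_ge s 0 with hs | hs
  · rw [extendByZero_of_neg hs]
    rcases lt_or_ge t 0 with ht | ht
    · rw [extendByZero_of_neg ht]
    · rw [extendByZero_of_nonneg ht]; exact h0 _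
  · rw [extendByZero_of_nonneg hs, extendByZero_of_nonneg (hs.trans hst)]
    exact hF (Real.toNNReal_mono hst)

/-- The net present value of a stream of payments is the expectation of what has been paid by an
independent exponential time. -/
theorem npv_eq (hq : 0 < q) (hF : Monotone F) (h0 : ∀ t, 0 ≤ F t) :
    npv q F = ∫⁻ s, ENNReal.ofReal (F s) ∂kill q := by
  have hm := monotone_extendByZero hF h0
  have := isProbabilityMeasure_expMeasure hq
  have hFm : Measurable fun s => ENNReal.ofReal (F s) := ENNReal.measurable_ofReal.comp hF.measurable
  rw [npv, dif_pos hm, lintegral_kill hFm]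
  set μ := hm.stieltjesFunction.measure
  have h1 : ∫⁻ t in Ici (0 : ℝ), ENNReal.ofReal (Real.exp (-q * t)) ∂μ =
      ∫⁻ t in Ici (0 : ℝ), ∫⁻ s, (Ici t).indicator 1 s ∂expMeasure q ∂μ :=
    setLIntegral_congr_fun measurableSet_Ici fun t ht => by
      rw [lintegral_indicator_one measurableSet_Ici, expMeasure_Ici hq ht]
  have hmeas : Measurable (Function.uncurry fun t s : ℝ => (Ici t).indicator (1 : ℝ → ℝ≥0∞) s) := by
    have : (Function.uncurry fun t s : ℝ => (Ici t).indicator (1 : ℝ → ℝ≥0∞) s) =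
        {p : ℝ × ℝ | p.1 ≤ p.2}.indicator 1 := by
      ext ⟨t, s⟩; simp [indicator]
    rw [this]
    exact measurable_one.indicator (measurableSet_le measurable_fst measurable_snd)
  rw [h1, lintegral_lintegral_swap hmeas.aemeasurable]
  have hcont : ∀ᵐ s ∂expMeasure q, ContinuousAt (extendByZero F) s :=
    (expMeasure_absolutelyContinuous q).ae_le (by
      have := hm.countable_not_continuousAt.measure_zero volume
      exact this)
  refine lintegral_congr_ae ?_
  filter_upwards [hcont, ae_nonneg_expMeasure q] with s hs hs0
  have h2 : ∫⁻ t in Ici (0 : ℝ), (Ici t).indicator (1 : ℝ → ℝ≥0∞) s ∂μ = μ (Icc 0 s) := by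
    have : ∀ t, (Ici t).indicator (1 : ℝ → ℝ≥0∞) s = (Iic s).indicator 1 t := fun t => by
      simp [indicator]
    simp_rw [this]
    rw [lintegral_indicator_one measurableSet_Iic, Measure.restrict_apply measurableSet_Iic,
      inter_comm, Ici_inter_Iic]
  have h3 : hm.stieltjesFunction s = F s.toNNReal := by
    rw [hm.stieltjesFunction_eq, ← extendByZero_of_nonneg (F := F) hs0]
    exact (hm.continuousWithinAt_Ioi_iff_rightLim_eq).1 hs.continuousWithinAt
  have h4 : Function.leftLim hm.stieltjesFunction 0 = 0 := by
    refine leftLim_eq_of_tendsto (tendsto_const_nhds.congr' ?_)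
    filter_upwards [self_mem_nhdsWithin] with t ht
    rw [hm.stieltjesFunction_eq]
    refine (rightLim_eq_of_tendsto (tendsto_const_nhds.congr' ?_)).symm
    filter_upwards [mem_nhdsWithin_of_mem_nhds (Iio_mem_nhds ht)] with u hu
    rw [extendByZero_of_neg hu]
  rw [h2, StieltjesFunction.measure_Icc, h3, h4, sub_zero]

end Kill

/-! ### Net present values along a path -/

section PathNpv

variable {w : ℝ≥0 → ℝ} {a q : ℝ}

/-- The sum of the discount factors at the beginnings of the top stages. -/
def discTop (q a : ℝ) (w : ℝ≥0 → ℝ) : ℝ≥0∞ :=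
  ∑' j, ENNReal.ofReal (discount q (crossTime a w (2 * j)))

/-- The sum of the discount factors at the beginnings of the bottom stages that follow a top
stage. -/
def discBottom (q a : ℝ) (w : ℝ≥0 → ℝ) : ℝ≥0∞ :=
  ∑' j, ENNReal.ofReal (discount q (crossTime a w (2 * j + 1)))

lemma ncard_eq_tsum {T : ℕ → ℝ≥0∞} {t : ℝ≥0} (h : {j | T j ≤ t}.Finite) :
    (({j | T j ≤ t}.ncard : ℕ) : ℝ≥0∞) = ∑' j, {s : ℝ≥0 | T j ≤ s}.indicator 1 t := by
  have h1 : ∀ j, {s : ℝ≥0 | T j ≤ s}.indicator (1 : ℝ≥0 → ℝ≥0∞) t =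
      {j | T j ≤ t}.indicator (fun _ => 1) j := fun j => by simp [indicator]
  simp_rw [h1]
  rw [← tsum_subtype, ENNReal.tsum_set_one, ← h.cast_ncard_eq]
  simp

lemma measurableSet_ge (T : ℝ≥0∞) : MeasurableSet {s : ℝ≥0 | T ≤ s} :=
  measurableSet_le measurable_const (by fun_prop)

lemma lintegral_tsum_kill (hq : 0 < q) (T : ℕ → ℝ≥0∞) :
    ∫⁻ t, ∑' j, {s : ℝ≥0 | T j ≤ s}.indicator 1 t ∂kill q =
      ∑' j, ENNReal.ofReal (discount q (T j)) := by
  rw [lintegral_tsum fun j => (measurable_one.indicator (measurableSet_ge _)).aemeasurable]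
  exact tsum_congr fun j => by rw [lintegral_indicator_one (measurableSet_ge _), kill_ge hq]

lemma measurable_tsum_indicator (T : ℕ → ℝ≥0∞) :
    Measurable fun t => ∑' j, {s : ℝ≥0 | T j ≤ s}.indicator (1 : ℝ≥0 → ℝ≥0∞) t :=
  Measurable.tsum fun _ => measurable_one.indicator (measurableSet_ge _)

lemma npv_le_add {F G : ℝ≥0 → ℝ} {T : ℕ → ℝ≥0∞} {c : ℝ} (hq : 0 < q) (hc : 0 ≤ c)
    (hF : Monotone F) (hG : Monotone G) (hF0 : ∀ t, 0 ≤ F t) (hG0 : ∀ t, 0 ≤ G t)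
    (hT : ∀ t : ℝ≥0, {j | T j ≤ t}.Finite)
    (h : ∀ t : ℝ≥0, F t ≤ G t + ({j | T j ≤ t}.ncard : ℕ) * c) :
    npv q F ≤ npv q G + ENNReal.ofReal c * ∑' j, ENNReal.ofReal (discount q (T j)) := by
  rw [npv_eq hq hF hF0, npv_eq hq hG hG0, ← lintegral_tsum_kill hq,
    ← lintegral_const_mul _ (measurable_tsum_indicator T),
    ← lintegral_add_right _ ((measurable_tsum_indicator T).const_mul _)]
  refine lintegral_mono fun t => ?_
  rw [← ncard_eq_tsum (hT t), mul_comm, ← ENNReal.ofReal_natCast,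
    ← ENNReal.ofReal_mul (Nat.cast_nonneg _),
    ← ENNReal.ofReal_add (hG0 t) (mul_nonneg (Nat.cast_nonneg _) hc)]
  exact ENNReal.ofReal_le_ofReal (h t)

lemma npv_add_le {F G : ℝ≥0 → ℝ} {T : ℕ → ℝ≥0∞} {c : ℝ} (hq : 0 < q) (hc : 0 ≤ c)
    (hF : Monotone F) (hG : Monotone G) (hF0 : ∀ t, 0 ≤ F t) (hG0 : ∀ t, 0 ≤ G t)
    (hT : ∀ t : ℝ≥0, {j | T j ≤ t}.Finite)
    (h : ∀ t : ℝ≥0, F t + ({j | T j ≤ t}.ncard : ℕ) * c ≤ G t) :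
    npv q F + ENNReal.ofReal c * ∑' j, ENNReal.ofReal (discount q (T j)) ≤ npv q G := by
  rw [npv_eq hq hF hF0, npv_eq hq hG hG0, ← lintegral_tsum_kill hq,
    ← lintegral_const_mul _ (measurable_tsum_indicator T),
    ← lintegral_add_right _ ((measurable_tsum_indicator T).const_mul _)]
  refine lintegral_mono fun t => ?_
  rw [← ncard_eq_tsum (hT t), mul_comm, ← ENNReal.ofReal_natCast,
    ← ENNReal.ofReal_mul (Nat.cast_nonneg _),
    ← ENNReal.ofReal_add (hF0 t) (mul_nonneg (Nat.cast_nonneg _) hc)]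
  exact ENNReal.ofReal_le_ofReal (h t)

/-- Comparison of the net present values of the strategy at `a` with a strategy that keeps the
controlled process in a larger interval `[0, b]`. -/
theorem npv_pos_le (hq : 0 < q) (hw : IsCadlag w) (ha : 0 < a) {L R : ℝ≥0 → ℝ} {b : ℝ}
    (hLR : IsAdmissible w L R b) (hab : a ≤ b) :
    npv q (dividendsPos w a) ≤ npv q L + ENNReal.ofReal (b - a) * discTop q a w ∧
      npv q (injectionsPos w a) ≤ npv q R + ENNReal.ofReal (b - a) * discBottom q a w := by
  have hA := isAdmissible_pos hw ha
  exact ⟨npv_le_add hq (sub_nonneg.2 hab) hA.monoL hLR.monoL hA.nonnegL hLR.nonnegL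
    (finite_top hw ha) fun t => (pos_le_of_isAdmissible hw ha hLR t).1,
    npv_le_add hq (sub_nonneg.2 hab) hA.monoR hLR.monoR hA.nonnegR hLR.nonnegR
    (finite_bottom hw ha) fun t => (pos_le_of_isAdmissible hw ha hLR t).2⟩

/-- Comparison of the net present values of the strategy at `a` with a strategy that keeps the
controlled process in a smaller interval `[0, b]`. -/
theorem npv_pos_add_le (hq : 0 < q) (hw : IsCadlag w) (ha : 0 < a) {L R : ℝ≥0 → ℝ} {b : ℝ}
    (hLR : IsAdmissible w L R b) (hba : b ≤ a) :
    npv q (dividendsPos w a) + ENNReal.ofReal (a - b) * discTop q a w ≤ npv q L ∧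
      npv q (injectionsPos w a) + ENNReal.ofReal (a - b) * discBottom q a w ≤ npv q R := by
  have hA := isAdmissible_pos hw ha
  exact ⟨npv_add_le hq (sub_nonneg.2 hba) hA.monoL hLR.monoL hA.nonnegL hLR.nonnegL
    (finite_top hw ha) fun t => by
      have := (pos_le_of_isAdmissible hw ha hLR t).1
      rw [numTop] at this; linarith,
    npv_add_le hq (sub_nonneg.2 hba) hA.monoR hLR.monoR hA.nonnegR hLR.nonnegR
    (finite_bottom hw ha) fun t => by
      have := (pos_le_of_isAdmissible hw ha hLR t).2
      rw [numBottom] at this; linarith⟩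

/-- The supremum of the absolute value of the path before the time `t`. -/
def supAbs (w : ℝ≥0 → ℝ) (t : ℝ≥0) : ℝ≥0∞ := ⨆ (s : ℝ≥0) (_ : s < t), ‖w s‖ₑ

lemma le_supAbs {s t : ℝ≥0} (h : s < t) : ‖w s‖ₑ ≤ supAbs w t :=
  le_iSup₂ (f := fun (s : ℝ≥0) (_ : s < t) => ‖w s‖ₑ) s h

lemma ofReal_le_of_crossTime_lt {t : ℝ≥0} (h : crossTime a w 0 < t) :
    ENNReal.ofReal a ≤ 2 * supAbs w t := by
  obtain ⟨s, hs, hst⟩ := firstTime_lt_iff.1 h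
  norm_cast at hst
  have h1 := le_supAbs (w := w) hst
  rcases hs with hs | ⟨u, hu, hs⟩
  · calc ENNReal.ofReal a ≤ ENNReal.ofReal ‖w s‖ :=
        ENNReal.ofReal_le_ofReal (hs.le.trans (le_abs_self _))
      _ = ‖w s‖ₑ := ofReal_norm _
      _ ≤ 1 * supAbs w t := by rwa [one_mul]
      _ ≤ _ := by gcongr; norm_num
  · calc ENNReal.ofReal a ≤ ENNReal.ofReal ‖w s - w u‖ :=
        ENNReal.ofReal_le_ofReal (hs.le.trans (le_abs_self _))
      _ = ‖w s - w u‖ₑ := ofReal_norm _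
      _ ≤ ‖w s‖ₑ + ‖w u‖ₑ := enorm_sub_le
      _ ≤ supAbs w t + supAbs w t := add_le_add h1 (le_supAbs (hu.trans_lt hst))
      _ = _ := (two_mul _).symm

lemma IsCadlag.supAbs_lt_top (hw : IsCadlag w) (t : ℝ≥0) : supAbs w t < ∞ := by
  obtain ⟨C, hC⟩ := hw.exists_bound 0 t
  refine (iSup₂_le fun s hs => ?_).trans_lt (ENNReal.ofReal_lt_top (r := C))
  rw [← ofReal_norm]
  exact ENNReal.ofReal_le_ofReal (hC s ⟨zero_le, hs.le⟩)

lemma dividendsPos_eq_zero (hw : IsCadlag w) (ha : 0 < a) {t : ℝ≥0} (h : t < crossTime a w 0) :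
    dividendsPos w a t = 0 := by
  by_cases ht : (t : ℝ≥0∞) < (stage w a 0).start
  · exact dividendsPos_of_lt ht
  obtain ⟨n, hn, hn'⟩ := exists_stage hw ha (not_lt.1 ht)
  have h1 := (crossTime_le_iff hw hn hn' 0).not.1 h.not_ge
  rw [dividendsPos_eq hn hn']
  unfold stageOffset at h1
  split_ifs at h1 with htop
  · lia
  · have : n = 0 := by lia
    subst this
    rw [Stage.dividends_of_not_top (by simpa [stage_zero] using htop), stage_zero, firstStage_paid]

lemma dividendsPos_le_tsum (hw : IsCadlag w) (ha : 0 < a) (t : ℝ≥0) :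
    ENNReal.ofReal (dividendsPos w a t) ≤ ∑' k : ℕ, (numTop (a + k) w t : ℝ≥0∞) := by
  have h1 : ∀ K : ℕ, dividendsPos w a t ≤
      dividendsPos w (a + K) t + ∑ k ∈ Finset.range K, (numTop (a + k) w t : ℝ) := fun K => by
    induction K with
    | zero => simp
    | succ K ih =>
      have h2 := (pos_le_of_isAdmissible hw (a := a + K) (by positivity)
        (isAdmissible_pos hw (a := a + (K + 1 : ℕ)) (by positivity)) t).1
      rw [Finset.sum_range_succ]
      push_cast at h2 ⊢
      rw [show a + (K + 1 : ℝ) - (a + K) = 1 by ring, mul_one] at h2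
      linarith
  have hfin := hw.supAbs_lt_top (t + 1)
  obtain ⟨K, hK⟩ := exists_nat_gt (2 * supAbs w (t + 1)).toReal
  have hcross : (t : ℝ≥0∞) < crossTime (a + K) w 0 := by
    by_contra! hle
    have : crossTime (a + K) w 0 < (t + 1 : ℝ≥0) :=
      hle.trans_lt (ENNReal.coe_lt_coe.2 (lt_add_one t))
    have h3 := ofReal_le_of_crossTime_lt this
    rw [ENNReal.ofReal_le_iff_le_toReal (ENNReal.mul_ne_top (by simp) hfin.ne)] at h3
    linarith
  have h2 := h1 K
  rw [dividendsPos_eq_zero hw (by positivity) hcross, zero_add] at h2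
  calc ENNReal.ofReal (dividendsPos w a t)
      ≤ ENNReal.ofReal (∑ k ∈ Finset.range K, (numTop (a + k) w t : ℝ)) :=
        ENNReal.ofReal_le_ofReal h2
    _ = ∑ k ∈ Finset.range K, (numTop (a + k) w t : ℝ≥0∞) := by
        rw [ENNReal.ofReal_sum_of_nonneg fun _ _ => Nat.cast_nonneg _]
        simp
    _ ≤ _ := ENNReal.sum_le_tsum _

lemma lintegral_numTop (hq : 0 < q) (hw : IsCadlag w) (ha : 0 < a) :
    ∫⁻ t, (numTop a w t : ℝ≥0∞) ∂kill q = discTop q a w := by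
  rw [discTop, ← lintegral_tsum_kill hq]
  exact lintegral_congr fun t => ncard_eq_tsum (finite_top hw ha t)

lemma measurable_numTop (hw : IsCadlag w) (ha : 0 < a) :
    Measurable fun t => (numTop a w t : ℝ≥0∞) := by
  have : (fun t => (numTop a w t : ℝ≥0∞)) =
      fun t => ∑' j, {s : ℝ≥0 | crossTime a w (2 * j) ≤ s}.indicator 1 t :=
    funext fun t => ncard_eq_tsum (finite_top hw ha t)
  rw [this]
  exact measurable_tsum_indicator _

lemma npv_dividendsPos_le_tsum (hq : 0 < q) (hw : IsCadlag w) (ha : 0 < a) :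
    npv q (dividendsPos w a) ≤ ∑' k : ℕ, discTop q (a + k) w := by
  have hA := isAdmissible_pos hw ha
  rw [npv_eq hq hA.monoL hA.nonnegL]
  calc ∫⁻ t, ENNReal.ofReal (dividendsPos w a t) ∂kill q
      ≤ ∫⁻ t, ∑' k : ℕ, (numTop (a + k) w t : ℝ≥0∞) ∂kill q :=
        lintegral_mono (dividendsPos_le_tsum hw ha)
    _ = _ := by
        rw [lintegral_tsum fun k => (measurable_numTop hw (by positivity)).aemeasurable]
        exact tsum_congr fun k => lintegral_numTop hq hw (by positivity)

lemma discount_le_tsum (hq : 0 < q) (T : ℝ≥0∞) : ENNReal.ofReal (discount q T) ≤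
    ∑' m : ℕ, ENNReal.ofReal (Real.exp (-q * m)) * (Iio ((m : ℝ≥0∞) + 1)).indicator 1 T := by
  by_cases hT : T = ∞
  · simp [hT, discount]
  lift T to ℝ≥0 using hT
  refine le_trans ?_ (ENNReal.le_tsum ⌊T⌋₊)
  have h1 : (T : ℝ≥0∞) ∈ Iio ((⌊T⌋₊ : ℝ≥0∞) + 1) := by
    have := Nat.lt_floor_add_one T
    rw [mem_Iio]; exact_mod_cast this
  rw [indicator_of_mem h1, Pi.one_apply, mul_one, discount, if_neg ENNReal.coe_ne_top]
  refine ENNReal.ofReal_le_ofReal (Real.exp_le_exp.2 ?_)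
  have : ((⌊T⌋₊ : ℝ≥0) : ℝ) ≤ T := NNReal.coe_le_coe.2 (Nat.floor_le zero_le)
  simp only [ENNReal.coe_toReal]
  push_cast at this
  nlinarith

lemma tsum_discount_crossTime_le (hq : 0 < q) (ha : 0 < a) :
    ∑' k : ℕ, ENNReal.ofReal (discount q (crossTime (a + k) w 0)) ≤
      ∑' m : ℕ, ENNReal.ofReal (Real.exp (-q * m)) * (2 * supAbs w (m + 1) + 1) := by
  refine (ENNReal.tsum_le_tsum fun k => discount_le_tsum hq _).trans ?_
  rw [ENNReal.tsum_comm]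
  refine ENNReal.tsum_le_tsum fun m => ?_
  rw [ENNReal.tsum_mul_left]
  gcongr
  by_cases hM : supAbs w (m + 1) = ∞
  · rw [hM]; simp
  set M := 2 * supAbs w (m + 1) with hMdef
  have hMtop : M ≠ ∞ := ENNReal.mul_ne_top (by simp) hM
  have h1 : ∀ k : ℕ, (Iio ((m : ℝ≥0∞) + 1)).indicator (1 : ℝ≥0∞ → ℝ≥0∞) (crossTime (a + k) w 0) ≤
      (Finset.range (⌊M.toReal⌋₊ + 1) : Set ℕ).indicator 1 k := fun k => by
    by_cases hk : crossTime (a + k) w 0 ∈ Iio ((m : ℝ≥0∞) + 1)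
    · have h2 := ofReal_le_of_crossTime_lt (t := m + 1) (by simpa using hk)
      rw [ENNReal.ofReal_le_iff_le_toReal hMtop] at h2
      have h3 : k ∈ (Finset.range (⌊M.toReal⌋₊ + 1) : Set ℕ) := by
        simp only [Finset.coe_range, mem_Iio, Nat.lt_succ_iff]
        exact Nat.le_floor (by linarith)
      rw [indicator_of_mem h3, indicator_of_mem hk]; rfl
    · rw [indicator_of_notMem hk]; exact zero_le
  calc _ ≤ ∑' k : ℕ, (Finset.range (⌊M.toReal⌋₊ + 1) : Set ℕ).indicator 1 k :=
        ENNReal.tsum_le_tsum h1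
    _ = ((⌊M.toReal⌋₊ : ℕ) : ℝ≥0∞) + 1 := by
        rw [← tsum_subtype]; simp
    _ ≤ M + 1 := by
        gcongr
        rw [← ENNReal.ofReal_natCast]
        exact ENNReal.ofReal_le_of_le_toReal (Nat.floor_le ENNReal.toReal_nonneg)

end PathNpv

/-! ### Lévy processes all of whose paths are càdlàg -/

/-- A Lévy process all of whose paths start at `0` and are càdlàg. -/
structure IsRegularLevy {Ω : Type*} [MeasurableSpace Ω] (X : ℝ≥0 → Ω → ℝ) (P : Measure Ω) :
    Prop where
  measurable : ∀ t, Measurable (X t)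
  zero : ∀ ω, X 0 ω = 0
  cadlag : ∀ ω, IsCadlag fun t => X t ω
  indep : HasIndepIncrements X P
  stationary : ∀ s t, IdentDistrib (fun ω => X (s + t) ω - X s ω) (X t) P P

lemma exists_enumeration (I : Finset ℝ≥0) :
    ∃ τ : ℕ → ℝ≥0, Monotone τ ∧ τ 0 = 0 ∧ ∀ i ∈ I, ∃ m, τ m = i := by
  obtain ⟨n, hn⟩ : ∃ n, (insert 0 I).card = n + 1 :=
    Nat.exists_eq_succ_of_ne_zero (Finset.card_pos.2 (Finset.insert_nonempty _ _)).ne'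
  have hmono : Monotone fun k : ℕ =>
      (insert 0 I).orderEmbOfFin hn ⟨min k n, by lia⟩ := fun k l hkl =>
    (OrderEmbedding.monotone _) (by simp only [Fin.mk_le_mk]; lia)
  have hmem : ∀ i ∈ insert 0 I, ∃ m : ℕ,
      (insert 0 I).orderEmbOfFin hn ⟨min m n, by lia⟩ = i := fun i hi => by
    rw [← Finset.mem_coe, ← Finset.range_orderEmbOfFin _ hn] at hi
    obtain ⟨m, rfl⟩ := hi
    exact ⟨m, by congr 1; ext; simp; lia⟩
  refine ⟨_, hmono, ?_, fun i hi => hmem i (Finset.mem_insert_of_mem hi)⟩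
  obtain ⟨m, hm⟩ := hmem 0 (Finset.mem_insert_self _ _)
  exact le_antisymm ((hmono (Nat.zero_le m)).trans_eq hm) zero_le

section Past

variable {Ω : Type*} {X : ℝ≥0 → Ω → ℝ}

variable (X) in
/-- The σ-algebra generated by the process up to the time `t`. -/
@[reducible] def past (t : ℝ≥0) : MeasurableSpace Ω :=
  MeasurableSpace.comap (fun ω (s : Iic t) => X s ω) inferInstance

lemma measurable_past {s t : ℝ≥0} (h : s ≤ t) : Measurable[past X t] (X s) :=
  (measurable_pi_apply (⟨s, h⟩ : Iic t)).comp (comap_measurable fun ω (s : Iic t) => X s ω)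

lemma past_mono {s t : ℝ≥0} (h : s ≤ t) : past X s ≤ past X t := by
  refine measurable_iff_comap_le.1 ?_
  exact @measurable_pi_lambda Ω _ _ (past X t) _ _ fun r => measurable_past (r.2.trans h)

end Past

section Levy

variable {Ω : Type*} [mΩ : MeasurableSpace Ω] {X : ℝ≥0 → Ω → ℝ} {P : Measure Ω}

lemma IsRegularLevy.measurable_sub (hX : IsRegularLevy X P) (s t : ℝ≥0) :
    Measurable fun ω => X t ω - X s ω := (hX.measurable t).sub (hX.measurable s)

lemma IsRegularLevy.shift (hX : IsRegularLevy X P) (u : ℝ≥0) :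
    IsRegularLevy (fun t ω => X (u + t) ω - X u ω) P where
  measurable t := (hX.measurable _).sub (hX.measurable _)
  zero ω := by simp
  cadlag ω t := by
    have hmap : Tendsto (fun s => u + s) (𝓝 t) (𝓝 (u + t)) :=
      (continuous_const.add continuous_id).tendsto t
    constructor
    · refine ContinuousWithinAt.sub ?_ continuousWithinAt_const
      refine ((hX.cadlag ω (u + t)).1).comp (t := Ici (u + t))
        (continuous_const.add continuous_id).continuousWithinAt fun s hs => ?_
      exact add_le_add_right hs u
    · obtain ⟨l, hl⟩ := (hX.cadlag ω (u + t)).2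
      refine ⟨l - X u ω, (hl.comp ?_).sub_const _⟩
      exact tendsto_nhdsWithin_iff.2 ⟨hmap.mono_left nhdsWithin_le_nhds,
        eventually_nhdsWithin_of_forall fun s hs => by simpa using hs⟩
  indep n t ht := by
    have := hX.indep n (fun i => u + t i) fun i j hij => add_le_add_right (ht hij) u
    simpa using this
  stationary s t := by
    have h1 := hX.stationary (u + s) t
    have h2 := (hX.stationary u t).symm
    simpa [add_assoc] using h1.trans h2

lemma IsRegularLevy.eq_sum (hX : IsRegularLevy X P) {τ : ℕ → ℝ≥0} (h0 : τ 0 = 0) (m : ℕ) (ω : Ω) :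
    X (τ m) ω = ∑ k ∈ Finset.range m, (X (τ (k + 1)) ω - X (τ k) ω) := by
  rw [Finset.sum_range_sub (fun k => X (τ k) ω), h0, hX.zero, sub_zero]

lemma IsRegularLevy.isProbabilityMeasure (hX : IsRegularLevy X P) : IsProbabilityMeasure P :=
  (hX.indep 0 (fun _ => 0) fun _ _ _ => le_rfl).isProbabilityMeasure

lemma IsRegularLevy.map_shift (hX : IsRegularLevy X P) (u : ℝ≥0) :
    P.map (fun ω t => X (u + t) ω - X u ω) = P.map (fun ω t => X t ω) := by
  have := hX.isProbabilityMeasure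
  have hX' := hX.shift u
  rw [map_eq_iff_forall_finset_map_restrict_eq
    (measurable_pi_lambda _ hX'.measurable).aemeasurable
    (measurable_pi_lambda _ hX.measurable).aemeasurable]
  intro I
  obtain ⟨τ, hτ, h0, hI⟩ := exists_enumeration I
  choose! m hm using hI
  have key : ∀ {Z : ℝ≥0 → Ω → ℝ}, IsRegularLevy Z P →
      P.map (fun ω => I.restrict (Z · ω)) =
        (P.map fun ω k => Z (τ (k + 1)) ω - Z (τ k) ω).map
          fun (d : ℕ → ℝ) (i : I) => ∑ k ∈ Finset.range (m i), d k := fun {Z} hZ => by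
    have hm' : Measurable fun ω (k : ℕ) => Z (τ (k + 1)) ω - Z (τ k) ω :=
      measurable_pi_lambda _ fun k => hZ.measurable_sub _ _
    rw [Measure.map_map (by fun_prop) hm']
    congr 1
    ext ω i
    simp only [Finset.restrict, Function.comp]
    rw [← hZ.eq_sum h0, hm i i.2]
  rw [key hX', key hX]
  congr 1
  have e := (hX'.indep.nat hτ).map_fun_eq_infinitePi_map fun k => hX'.measurable_sub _ _
  have e' := (hX.indep.nat hτ).map_fun_eq_infinitePi_map fun k => hX.measurable_sub _ _
  rw [e, e']
  congr 1
  ext1 k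
  have hle : τ k + (τ (k + 1) - τ k) = τ (k + 1) := add_tsub_cancel_of_le (hτ (Nat.le_succ k))
  have h1 := (hX'.stationary (τ k) (τ (k + 1) - τ k)).trans (hX.stationary u _)
  have h2 := hX.stationary (τ k) (τ (k + 1) - τ k)
  rw [hle] at h1 h2
  exact (h1.trans h2.symm).map_eq

lemma IsRegularLevy.past_le (hX : IsRegularLevy X P) (t : ℝ≥0) : past X t ≤ mΩ :=
  measurable_iff_comap_le.1 (measurable_pi_lambda _ fun _ => hX.measurable _)

lemma IsRegularLevy.indepFun_past (hX : IsRegularLevy X P) (t : ℝ≥0) :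
    IndepFun (fun ω (s : Iic t) => X s ω) (fun ω r => X (t + r) ω - X t ω) P := by
  have := hX.isProbabilityMeasure
  refine IndepFun.process_indepFun_process (X := fun (s : Iic t) ω => X s ω)
    (fun s => hX.measurable _) (fun r => hX.measurable_sub _ _) fun I J => ?_
  classical
  obtain ⟨τ, hτ, h0, hI⟩ := exists_enumeration
    (insert t (I.image (fun s : Iic t => (s : ℝ≥0)) ∪ J.image fun r => t + r))
  choose! m hm using hI
  have hmI : ∀ s ∈ I, τ (min (m s) (m t)) = s := fun s hs => by
    rw [hτ.map_min, hm s (by simp; right; left; exact ⟨s.2, hs⟩), hm t (by simp), min_eq_left s.2]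
  have hmJ : ∀ r ∈ J, τ (max (m (t + r)) (m t)) = t + r := fun r hr => by
    rw [hτ.map_max, hm (t + r) (by simp [hr]), hm t (by simp), max_eq_left le_self_add]
  have hmt : τ (m t) = t := hm t (by simp)
  set M := ∑ r ∈ J, max (m (t + r)) (m t)
  have hind := (hX.indep.nat hτ).indepFun_finset (Finset.range (m t)) (Finset.Ico (m t) M)
    (by rw [Finset.range_eq_Ico]; exact Finset.Ico_disjoint_Ico_consecutive _ _ _)
    fun k => hX.measurable_sub _ _
  have h1 : (fun ω (i : I) => X (i : Iic t) ω) =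
      (fun (d : Finset.range (m t) → ℝ) (i : I) => ∑ k : Finset.range (m t),
        if (k : ℕ) < min (m (i : Iic t)) (m t) then d k else 0) ∘
      fun ω (k : Finset.range (m t)) => X (τ (k + 1)) ω - X (τ k) ω := by
    ext ω i
    simp only [Function.comp]
    have e := hX.eq_sum h0 (min (m (i : Iic t)) (m t)) ω
    rw [hmI i i.2] at e
    rw [e, Finset.sum_coe_sort (Finset.range (m t)) fun k =>
      if k < min (m (i : Iic t)) (m t) then X (τ (k + 1)) ω - X (τ k) ω else 0,
      ← Finset.sum_filter]
    congr 1
    ext k; simp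
  have h2 : (fun ω (r : J) => X (t + r) ω - X t ω) =
      (fun (d : Finset.Ico (m t) M → ℝ) (r : J) => ∑ k : Finset.Ico (m t) M,
        if (k : ℕ) < max (m (t + r)) (m t) then d k else 0) ∘
      fun ω (k : Finset.Ico (m t) M) => X (τ (k + 1)) ω - X (τ k) ω := by
    ext ω r
    simp only [Function.comp]
    rw [Finset.sum_coe_sort (Finset.Ico (m t) M) fun k =>
      if k < max (m (t + r)) (m t) then X (τ (k + 1)) ω - X (τ k) ω else 0,
      ← Finset.sum_filter]
    have e1 := hX.eq_sum h0 (max (m (t + r)) (m t)) ω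
    have e2 := hX.eq_sum h0 (m t) ω
    rw [hmJ r r.2] at e1
    rw [hmt] at e2
    have hM : max (m (t + r)) (m t) ≤ M :=
      Finset.single_le_sum (f := fun r => max (m (t + r)) (m t)) (fun _ _ => Nat.zero_le _) r.2
    have : (Finset.Ico (m t) M).filter (· < max (m (t + r)) (m t)) =
        Finset.Ico (m t) (max (m (t + r)) (m t)) := by
      ext k; simp only [Finset.mem_filter, Finset.mem_Ico]; lia
    rw [this, Finset.sum_Ico_eq_sub _ (le_max_right _ _), ← e1, ← e2]
  rw [h1, h2]
  refine hind.comp (measurable_pi_lambda _ fun i => Finset.measurable_sum _ fun k _ => ?_)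
    (measurable_pi_lambda _ fun i => Finset.measurable_sum _ fun k _ => ?_)
  · split_ifs <;> fun_prop
  · split_ifs <;> fun_prop

end Levy

/-! ### The strong Markov property -/

section StrongMarkov

variable {Ω : Type*} [mΩ : MeasurableSpace Ω] {X : ℝ≥0 → Ω → ℝ} {P : Measure Ω}

/-- A random time `T` such that `{T < t}` belongs to the past of `t` for all `t`. -/
def IsOptional (X : ℝ≥0 → Ω → ℝ) (T : Ω → ℝ≥0∞) : Prop :=
  ∀ t : ℝ≥0, MeasurableSet[past X t] {ω | T ω < t}

lemma IsOptional.measurable (hX : IsRegularLevy X P) {T : Ω → ℝ≥0∞} (hT : IsOptional X T) :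
    Measurable T := by
  have h : ∀ t : ℝ≥0, MeasurableSet {ω | T ω < t} := fun t => hX.past_le t _ (hT t)
  refine measurable_of_Iio fun x => ?_
  by_cases hx : x = ∞
  · have : T ⁻¹' Iio x = ⋃ n : ℕ, {ω | T ω < ((n : ℝ≥0) : ℝ≥0∞)} := by
      ext ω
      simp only [hx, mem_preimage, mem_Iio, mem_iUnion, mem_ofPred_eq]
      refine ⟨fun h => ?_, fun ⟨n, hn⟩ => hn.trans_le le_top⟩
      obtain ⟨n, hn⟩ := ENNReal.exists_nat_gt h.ne
      exact ⟨n, by simpa using hn⟩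
    rw [this]
    exact MeasurableSet.iUnion fun n => h n
  · lift x to ℝ≥0 using hx
    exact h x

lemma tendsto_floor_div (T : ℝ≥0) :
    Tendsto (fun n : ℕ => ((⌊(n + 1) * T⌋₊ + 1 : ℕ) : ℝ≥0) / (n + 1)) atTop (𝓝[≥] T) := by
  have hle : ∀ n : ℕ, T ≤ ((⌊(n + 1) * T⌋₊ + 1 : ℕ) : ℝ≥0) / (n + 1) := fun n => by
    rw [le_div_iff₀ (by positivity), mul_comm]
    exact_mod_cast (Nat.lt_floor_add_one ((n + 1) * T)).le
  refine tendsto_nhdsWithin_iff.2 ⟨?_, Eventually.of_forall hle⟩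
  have h1 : Tendsto (fun n : ℕ => T + 1 / ((n : ℝ≥0) + 1)) atTop (𝓝 (T + 0)) :=
    tendsto_const_nhds.add tendsto_one_div_add_atTop_nhds_zero_nat
  rw [add_zero] at h1
  refine tendsto_of_tendsto_of_tendsto_of_le_of_le tendsto_const_nhds h1 hle fun n => ?_
  simp only
  rw [div_le_iff₀ (by positivity), add_mul T, one_div, inv_mul_cancel₀ (by positivity), mul_comm T]
  push_cast
  gcongr
  exact Nat.floor_le zero_le

/-- The increments after the time `t`, at rational times. -/
def future (X : ℝ≥0 → Ω → ℝ) (t : ℝ≥0) (ω : Ω) (r : ℚ≥0) : ℝ := X (t + r) ω - X t ω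

/-- The path at rational times. -/
def ratPath (X : ℝ≥0 → Ω → ℝ) (ω : Ω) (r : ℚ≥0) : ℝ := X r ω

lemma IsRegularLevy.measurable_future (hX : IsRegularLevy X P) (t : ℝ≥0) :
    Measurable (future X t) :=
  measurable_pi_lambda _ fun _ => hX.measurable_sub _ _

lemma IsRegularLevy.measurable_ratPath (hX : IsRegularLevy X P) : Measurable (ratPath X) :=
  measurable_pi_lambda _ fun _ => hX.measurable _

lemma IsRegularLevy.lintegral_future (hX : IsRegularLevy X P) (t : ℝ≥0)
    {G : (ℚ≥0 → ℝ) → ℝ≥0∞} (hG : Measurable G) :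
    ∫⁻ ω, G (future X t ω) ∂P = ∫⁻ ω, G (ratPath X ω) ∂P := by
  have h1 : Measurable fun (w : ℝ≥0 → ℝ) => G fun r : ℚ≥0 => w r :=
    hG.comp (measurable_pi_lambda _ fun r => measurable_pi_apply _)
  have e1 := lintegral_map (μ := P) h1 (measurable_pi_lambda (fun ω s => X (t + s) ω - X t ω)
    fun s => hX.measurable_sub _ _)
  have e2 := lintegral_map (μ := P) h1 (measurable_pi_lambda (fun ω s => X s ω) hX.measurable)
  rw [hX.map_shift] at e1
  exact e1.symm.trans e2

lemma IsRegularLevy.lintegral_mul_future (hX : IsRegularLevy X P) (t : ℝ≥0)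
    {G : (ℚ≥0 → ℝ) → ℝ≥0∞} (hG : Measurable G) {Y : Ω → ℝ≥0∞} (hY : Measurable[past X t] Y) :
    ∫⁻ ω, Y ω * G (future X t ω) ∂P = (∫⁻ ω, Y ω ∂P) * ∫⁻ ω, G (ratPath X ω) ∂P := by
  rw [← hX.lintegral_future t hG]
  have hind := (IndepFun_iff_Indep _ _ _).1 (hX.indepFun_past t)
  refine lintegral_mul_eq_lintegral_mul_lintegral_of_independent_measurableSpace
    (hX.past_le t) ?_ hind hY ?_
  · exact measurable_iff_comap_le.1 (measurable_pi_lambda _ fun _ => hX.measurable_sub _ _)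
  · refine hG.comp (@measurable_pi_lambda Ω _ _ (_) _ _ fun r => ?_)
    exact (measurable_pi_apply (X := fun _ : ℝ≥0 => ℝ) (r : ℝ≥0)).comp
      (comap_measurable fun ω s => X (t + s) ω - X t ω)

/-- The approximation of the random time `T` from the right by multiples of `1 / (n + 1)`. -/
def approxTime (T : Ω → ℝ≥0∞) (n : ℕ) (ω : Ω) : ℝ≥0 :=
  ((⌊(n + 1) * (T ω).toNNReal⌋₊ + 1 : ℕ) : ℝ≥0) / (n + 1)

lemma IsRegularLevy.measurable_future_approxTime (hX : IsRegularLevy X P) {T : Ω → ℝ≥0∞}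
    (hT : Measurable T) (n : ℕ) : Measurable fun ω => future X (approxTime T n ω) ω := by
  have h1 : Measurable fun p : ℕ × Ω => future X (((p.1 + 1 : ℕ) : ℝ≥0) / (n + 1)) p.2 :=
    measurable_from_prod_countable_right fun k =>
      hX.measurable_future (((k + 1 : ℕ) : ℝ≥0) / (n + 1))
  have h2 : Measurable fun ω => (⌊(n + 1) * (T ω).toNNReal⌋₊, ω) :=
    (Nat.measurable_floor.comp (hT.ennreal_toNNReal.const_mul _)).prodMk measurable_id
  have h3 : (fun ω => future X (approxTime T n ω) ω) =
      (fun p : ℕ × Ω => future X (((p.1 + 1 : ℕ) : ℝ≥0) / (n + 1)) p.2) ∘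
        fun ω => (⌊(n + 1) * (T ω).toNNReal⌋₊, ω) := rfl
  rw [h3]
  exact h1.comp h2

lemma IsRegularLevy.tendsto_future_approxTime (hX : IsRegularLevy X P) (T : Ω → ℝ≥0∞) (ω : Ω) :
    Tendsto (fun n => future X (approxTime T n ω) ω) atTop
      (𝓝 (future X (T ω).toNNReal ω)) := by
  refine tendsto_pi_nhds.2 fun r => ?_
  have h1 := tendsto_floor_div (T ω).toNNReal
  refine Tendsto.sub ?_ ((hX.cadlag ω _).1.tendsto.comp h1)
  refine (hX.cadlag ω _).1.tendsto.comp (tendsto_nhdsWithin_iff.2 ⟨?_, ?_⟩)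
  · exact (h1.mono_right nhdsWithin_le_nhds).add tendsto_const_nhds
  · filter_upwards [h1.eventually self_mem_nhdsWithin] with n hn
    exact add_le_add_left hn _

lemma IsRegularLevy.measurable_future_comp (hX : IsRegularLevy X P) {T : Ω → ℝ≥0∞}
    (hT : Measurable T) : Measurable fun ω => future X (T ω).toNNReal ω :=
  measurable_of_tendsto_metrizable (hX.measurable_future_approxTime hT)
    (tendsto_pi_nhds.2 (hX.tendsto_future_approxTime T))

lemma IsRegularLevy.lintegral_approxTime (hX : IsRegularLevy X P) {T : Ω → ℝ≥0∞}
    (hT : IsOptional X T) {Y : Ω → ℝ≥0∞}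
    (hY : ∀ t : ℝ≥0, Measurable[past X t] ({ω | T ω < t}.indicator Y))
    {G : (ℚ≥0 → ℝ) → ℝ≥0∞} (hG : Measurable G) (n : ℕ) :
    ∫⁻ ω in {ω | T ω < ∞}, Y ω * G (future X (approxTime T n ω) ω) ∂P =
      (∫⁻ ω in {ω | T ω < ∞}, Y ω ∂P) * ∫⁻ ω, G (ratPath X ω) ∂P := by
  have hTm := hT.measurable hX
  set A : ℕ → Set Ω := fun k => {ω | T ω < (((k + 1 : ℕ) : ℝ≥0) / (n + 1) : ℝ≥0)} \
    {ω | T ω < ((k : ℝ≥0) / (n + 1) : ℝ≥0)} with hA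
  have hAiff : ∀ k ω, ω ∈ A k ↔ T ω < ∞ ∧ ⌊(n + 1) * (T ω).toNNReal⌋₊ = k := fun k ω => by
    by_cases hω : T ω = ∞
    · simp [hA, hω]
    · have hlt := Ne.lt_top hω
      simp only [hA, Set.mem_sdiff, mem_ofPred_eq, hlt, true_and, not_lt]
      rw [Nat.floor_eq_iff zero_le, ← ENNReal.coe_toNNReal hω, ENNReal.coe_lt_coe,
        ENNReal.coe_le_coe, ENNReal.toNNReal_coe, lt_div_iff₀ (by positivity),
        div_le_iff₀ (by positivity), mul_comm, and_comm]
      push_cast; rfl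
  have hAm : ∀ k, MeasurableSet (A k) := fun k =>
    (measurableSet_lt hTm measurable_const).diff (measurableSet_lt hTm measurable_const)
  have hAU : {ω | T ω < ∞} = ⋃ k, A k := by
    ext ω; simp [hAiff]
  have hAd : Pairwise (Function.onFun Disjoint A) := fun i j hij =>
    Set.disjoint_left.2 fun ω hi hj => hij (((hAiff i ω).1 hi).2.symm.trans ((hAiff j ω).1 hj).2)
  rw [hAU, lintegral_iUnion hAm hAd, lintegral_iUnion hAm hAd, ← ENNReal.tsum_mul_right]
  refine tsum_congr fun k => ?_
  set t : ℝ≥0 := ((k + 1 : ℕ) : ℝ≥0) / (n + 1) with ht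
  have hYA : Measurable[past X t] ((A k).indicator Y) := by
    have : (A k).indicator Y =
        {ω | T ω < ((k : ℝ≥0) / (n + 1) : ℝ≥0)}ᶜ.indicator ({ω | T ω < t}.indicator Y) := by
      rw [indicator_indicator]
      change (({ω | T ω < t} \ {ω | T ω < ((k : ℝ≥0) / (n + 1) : ℝ≥0)}) : Set Ω).indicator Y = _
      rw [sdiff_eq, inter_comm]
    rw [this]
    refine (hY t).indicator ?_
    refine (past_mono ?_ _ (hT _)).compl
    rw [ht]; gcongr; simp
  rw [← lintegral_indicator (hAm k), ← lintegral_indicator (hAm k),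
    ← hX.lintegral_mul_future t hG hYA]
  refine lintegral_congr fun ω => ?_
  by_cases hω : ω ∈ A k
  · rw [indicator_of_mem hω, indicator_of_mem hω, approxTime, ((hAiff k ω).1 hω).2]
  · rw [indicator_of_notMem hω, indicator_of_notMem hω, zero_mul]

/-- The strong Markov property. -/
theorem IsRegularLevy.strongMarkov (hX : IsRegularLevy X P) {T : Ω → ℝ≥0∞}
    (hT : IsOptional X T) {Y : Ω → ℝ≥0∞}
    (hY : ∀ t : ℝ≥0, Measurable[past X t] ({ω | T ω < t}.indicator Y)) (hYm : Measurable Y)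
    (hY1 : ∀ ω, Y ω ≤ 1) {G : (ℚ≥0 → ℝ) → ℝ≥0∞} (hG : Measurable G) :
    ∫⁻ ω in {ω | T ω < ∞}, Y ω * G (future X (T ω).toNNReal ω) ∂P =
      (∫⁻ ω in {ω | T ω < ∞}, Y ω ∂P) * ∫⁻ ω, G (ratPath X ω) ∂P := by
  have := hX.isProbabilityMeasure
  have hTm := hT.measurable hX
  set ρ := (P.restrict {ω | T ω < ∞}).withDensity Y
  have hYfin : ∫⁻ ω in {ω | T ω < ∞}, Y ω ∂P ≠ ∞ :=
    ((lintegral_mono hY1).trans_lt (by simp [measure_lt_top])).ne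
  have : IsFiniteMeasure ρ := isFiniteMeasure_withDensity hYfin
  have hφ := hX.measurable_future_comp hTm
  have hψ := hX.measurable_ratPath
  set c := ∫⁻ ω in {ω | T ω < ∞}, Y ω ∂P
  have hconv : ∀ {Z : Ω → ℚ≥0 → ℝ} {F : (ℚ≥0 → ℝ) → ℝ≥0∞}, Measurable Z → Measurable F →
      ∫⁻ w, F w ∂(ρ.map Z) = ∫⁻ ω in {ω | T ω < ∞}, Y ω * F (Z ω) ∂P := fun {Z F} hZ hF => by
    rw [lintegral_map hF hZ]
    exact lintegral_withDensity_eq_lintegral_mul _ hYm (hF.comp hZ)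
  have : IsFiniteMeasure (c • P.map (ratPath X)) :=
    Measure.smul_finite _ hYfin
  have key : ρ.map (fun ω => future X (T ω).toNNReal ω) = c • P.map (ratPath X) := by
    refine ext_of_forall_lintegral_eq_of_IsFiniteMeasure fun f => ?_
    have hf : Measurable fun w => (f w : ℝ≥0∞) := f.continuous.measurable.coe_nnreal_ennreal
    rw [hconv hφ hf, lintegral_smul_measure, lintegral_map hf hψ, smul_eq_mul]
    have hlim : Tendsto (fun n => ∫⁻ ω in {ω | T ω < ∞},
        Y ω * (f (future X (approxTime T n ω) ω) : ℝ≥0∞) ∂P) atTop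
        (𝓝 (∫⁻ ω in {ω | T ω < ∞}, Y ω * (f (future X (T ω).toNNReal ω) : ℝ≥0∞) ∂P)) := by
      obtain ⟨C, hC⟩ : ∃ C : ℝ≥0, ∀ w, f w ≤ C := ⟨nndist f 0, BoundedContinuousFunction.NNReal.upper_bound f⟩
      refine tendsto_lintegral_of_dominated_convergence (fun ω => Y ω * C)
        (fun n => hYm.mul (hf.comp (hX.measurable_future_approxTime hTm n)))
        (fun n => Eventually.of_forall fun ω => ?_) ?_ (Eventually.of_forall fun ω => ?_)
      · simp only; gcongr; exact hC _
      · rw [lintegral_mul_const _ hYm]; exact ENNReal.mul_ne_top hYfin ENNReal.coe_ne_top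
      · refine ENNReal.Tendsto.const_mul ?_ (Or.inr ((hY1 ω).trans_lt (by simp)).ne)
        exact (ENNReal.continuous_coe.comp f.continuous).continuousAt.tendsto.comp
          (hX.tendsto_future_approxTime T ω)
    simp_rw [fun n => hX.lintegral_approxTime hT hY hf n] at hlim
    exact tendsto_nhds_unique hlim tendsto_const_nhds
  rw [← hconv hφ hG, key, lintegral_smul_measure, lintegral_map hG hψ, smul_eq_mul]

end StrongMarkov

/-! ### Crossing times of Lévy processes -/

section Rational

variable {w : ℝ≥0 → ℝ} {a : ℝ}

lemma exists_rat_between {s t : ℝ≥0} (h : s < t) : ∃ r : ℚ≥0, s < r ∧ (r : ℝ≥0) < t := by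
  obtain ⟨r, hr, hr'⟩ := exists_rat_btwn (NNReal.coe_lt_coe.2 h)
  have h0 : 0 ≤ r := by exact_mod_cast (s.coe_nonneg.trans_lt hr).le
  lift r to ℚ≥0 using h0
  exact ⟨r, by exact_mod_cast hr, by exact_mod_cast hr'⟩

lemma IsCadlag.exists_rat_sub (hw : IsCadlag w) (ha : 0 ≤ a) {s t u : ℝ≥0} (hst : s ≤ t)
    (htu : t < u) (h : a < w s - w t) :
    ∃ r r' : ℚ≥0, s < r ∧ r ≤ r' ∧ (r' : ℝ≥0) < u ∧ a < w r - w r' := by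
  have hlt : s < t := hst.lt_of_ne fun e => by subst e; linarith
  obtain ⟨v, hv, h1⟩ := hw.exists_right s (half_pos (sub_pos.2 h))
  obtain ⟨v', hv', h2⟩ := hw.exists_right t (half_pos (sub_pos.2 h))
  obtain ⟨r, hr, hr'⟩ := exists_rat_between (lt_min hv hlt)
  obtain ⟨r', hr2, hr2'⟩ := exists_rat_between (lt_min hv' htu)
  have e1 := abs_lt.1 (h1 r hr.le (hr'.trans_le (min_le_left _ _)))
  have e2 := abs_lt.1 (h2 r' hr2.le (hr2'.trans_le (min_le_left _ _)))
  refine ⟨r, r', hr, ?_, hr2'.trans_le (min_le_right _ _), by linarith⟩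
  have : (r : ℝ≥0) < r' := (hr'.trans_le (min_le_right _ _)).trans hr2
  exact_mod_cast this.le

lemma downTime_lt_iff_rat (hw : IsCadlag w) (ha : 0 ≤ a) {T : ℝ≥0∞} {t : ℝ≥0} :
    downTime a w T < t ↔
      ∃ r r' : ℚ≥0, T < (r : ℝ≥0) ∧ r ≤ r' ∧ (r' : ℝ≥0) < t ∧ a < w r - w r' := by
  constructor
  · intro h
    obtain ⟨u, ⟨s, hTs, hsu, hlt⟩, hut⟩ := firstTime_lt_iff.1 h
    obtain ⟨r, r', h1, h2, h3, h4⟩ := hw.exists_rat_sub ha hsu (by exact_mod_cast hut) hlt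
    exact ⟨r, r', hTs.trans_lt (by exact_mod_cast h1), h2, h3, h4⟩
  · rintro ⟨r, r', h1, h2, h3, h4⟩
    exact firstTime_lt_iff.2 ⟨r', ⟨r, h1.le, by exact_mod_cast h2, h4⟩, by exact_mod_cast h3⟩

/-- The first time at which a path given at the rational times has fallen by more than `a`. -/
def ratDownTime (a : ℝ) (y : ℚ≥0 → ℝ) : ℝ≥0∞ :=
  ⨅ (r : ℚ≥0) (r' : ℚ≥0) (_ : r ≤ r' ∧ a < y r - y r'), ((r' : ℝ≥0) : ℝ≥0∞)

lemma measurable_ratDownTime (a : ℝ) : Measurable (ratDownTime a) := by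
  refine Measurable.iInf fun r => Measurable.iInf fun r' => ?_
  have h : (fun y : ℚ≥0 → ℝ => ⨅ (_ : r ≤ r' ∧ a < y r - y r'), ((r' : ℝ≥0) : ℝ≥0∞)) =
      fun y => if r ≤ r' ∧ a < y r - y r' then ((r' : ℝ≥0) : ℝ≥0∞) else ∞ := by
    ext y; rw [iInf_eq_if]
  rw [h]
  refine Measurable.ite ?_ measurable_const measurable_const
  exact (MeasurableSet.const _).inter (measurableSet_lt measurable_const
    ((measurable_pi_apply r).sub (measurable_pi_apply r')))

lemma downTime_zero_eq (hw : IsCadlag w) (ha : 0 ≤ a) :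
    downTime a w 0 = ratDownTime a fun r => w r := by
  have key : ∀ t : ℝ≥0, downTime a w 0 < t ↔ ratDownTime a (fun r => w r) < t := fun t => by
    simp only [ratDownTime, iInf_lt_iff]
    constructor
    · intro h
      obtain ⟨r, r', -, h2, h3, h4⟩ := (downTime_lt_iff_rat hw ha).1 h
      exact ⟨r, r', ⟨h2, h4⟩, by exact_mod_cast h3⟩
    · rintro ⟨r, r', ⟨h1, h2⟩, h3⟩
      exact firstTime_lt_iff.2 ⟨r', ⟨r, zero_le, by exact_mod_cast h1, h2⟩, by exact_mod_cast h3⟩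
  refine le_antisymm (le_of_forall_gt fun c hc => ?_) (le_of_forall_gt fun c hc => ?_)
  · obtain ⟨t, h1, h2⟩ := ENNReal.lt_iff_exists_nnreal_btwn.1 hc
    exact ((key t).2 h1).trans h2
  · obtain ⟨t, h1, h2⟩ := ENNReal.lt_iff_exists_nnreal_btwn.1 hc
    exact ((key t).1 h1).trans h2

lemma downTime_coe (a : ℝ) (w : ℝ≥0 → ℝ) (T : ℝ≥0) :
    downTime a w T = T + downTime a (fun t => w (T + t) - w T) 0 := by
  have h1 : downTime a w T = ⨅ (u : ℝ≥0) (_ : ∃ s : ℝ≥0, (0 : ℝ≥0∞) ≤ s ∧ s ≤ u ∧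
      a < (w (T + s) - w T) - (w (T + u) - w T)), ((T + u : ℝ≥0) : ℝ≥0∞) := by
    refine le_antisymm (le_iInf₂ fun u ⟨s, _, hs, h⟩ => ?_) (le_firstTime_iff.2 ?_)
    · exact firstTime_le ⟨T + s, by exact_mod_cast le_self_add, by gcongr, by linarith⟩
    · rintro t ⟨s, hTs, hst, h⟩
      norm_cast at hTs
      obtain ⟨v, rfl⟩ := exists_add_of_le hTs
      obtain ⟨u, rfl⟩ := exists_add_of_le (hTs.trans hst)
      exact iInf₂_le_of_le u ⟨v, zero_le, by simpa using hst, by linarith⟩ le_rfl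
  rw [h1]
  simp only [downTime, firstTime, ENNReal.add_iInf, ENNReal.coe_add]

lemma discount_add (q : ℝ) (S T : ℝ≥0∞) : discount q (S + T) = discount q S * discount q T := by
  by_cases hS : S = ∞
  · simp [hS, discount]
  by_cases hT : T = ∞
  · simp [hT, discount]
  rw [discount, discount, discount, if_neg hS, if_neg hT, if_neg (ENNReal.add_ne_top.2 ⟨hS, hT⟩),
    ENNReal.toReal_add hS hT, ← Real.exp_add]
  ring_nf

lemma kappa_eq (hw : IsCadlag w) (h0 : w 0 = 0) (ha : 0 < a) :
    kappa a (fun t => a + w t) = downTime a w 0 := by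
  refine firstTime_congr fun t => ?_
  have hbdd : BddAbove ((fun t => a + w t) '' Icc 0 t) := by
    obtain ⟨C, hC⟩ := (hw.const_add a).exists_bound 0 t
    exact ⟨C, by rintro _ ⟨u, hu, rfl⟩; exact (le_abs_self _).trans (hC u hu)⟩
  have hne : ((fun t => a + w t) '' Icc 0 t).Nonempty := ⟨_, 0, ⟨le_rfl, zero_le⟩, rfl⟩
  have hge : a ≤ runningSup (fun t => a + w t) 0 t :=
    le_csSup hbdd ⟨0, ⟨le_rfl, zero_le⟩, by simp [h0]⟩
  rw [reflectedAt, max_eq_left (by linarith)]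
  constructor
  · rintro ⟨-, h⟩
    obtain ⟨_, ⟨s, hs, rfl⟩, hlt⟩ := exists_lt_of_lt_csSup hne
      (show a + w t + a < runningSup (fun t => a + w t) 0 t by linarith)
    exact ⟨s, zero_le, hs.2, by simp only at hlt; linarith⟩
  · rintro ⟨s, -, hst, hlt⟩
    have h2 : a + w s ≤ runningSup (fun t => a + w t) 0 t := le_csSup hbdd ⟨s, ⟨zero_le, hst⟩, rfl⟩
    refine ⟨(zero_le : 0 ≤ t).lt_of_ne fun e => ?_, by linarith⟩
    subst e
    have : s = 0 := le_antisymm hst zero_le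
    subst this
    linarith

end Rational

section SubSigma

variable {Ω : Type*} {m : MeasurableSpace Ω}

lemma measurableSet_const_lt {f : Ω → ℝ} (hf : Measurable f) (a : ℝ) :
    MeasurableSet {ω | a < f ω} := hf measurableSet_Ioi

lemma measurable_of_preimage_Iio {f : Ω → ℝ≥0∞} (h : ∀ c, MeasurableSet (f ⁻¹' Iio c)) :
    Measurable f := measurable_of_Iio h

lemma measurable_comp_indicator {f : Ω → ℝ≥0∞} (hf : Measurable f) {g : ℝ≥0∞ → ℝ≥0∞}
    (hg : Measurable g) {A : Set Ω} (hA : MeasurableSet A) :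
    Measurable (A.indicator fun ω => g (f ω)) := (hg.comp hf).indicator hA

lemma measurable_sub_real {f g : Ω → ℝ} (hf : Measurable f) (hg : Measurable g) :
    Measurable fun ω => f ω - g ω := hf.sub hg

lemma measurable_const_add_real {f : Ω → ℝ} (hf : Measurable f) (x : ℝ) :
    Measurable fun ω => x + f ω := hf.const_add x

end SubSigma

section ShiftedPath

variable {Ω : Type*} {X : ℝ≥0 → Ω → ℝ}

lemma measurable_past_shifted (x : ℝ) ⦃s t : ℝ≥0⦄ (h : s ≤ t) :
    Measurable[past X t] fun ω => shifted X x ω s :=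
  measurable_const_add_real (measurable_past h) x

lemma downTime_shifted (a x : ℝ) (ω : Ω) (T : ℝ≥0∞) :
    downTime a (shifted X x ω) T = downTime a (fun t => X t ω) T :=
  firstTime_congr fun t => exists_congr fun s => by simp [shifted]

end ShiftedPath

section Optional

variable {Ω : Type*} [mΩ : MeasurableSpace Ω] {X : ℝ≥0 → Ω → ℝ} {P : Measure Ω} {a x q : ℝ}

lemma IsOptional.downTime {T : Ω → ℝ≥0∞} (hT : IsOptional X T) (ha : 0 ≤ a) {Z : ℝ≥0 → Ω → ℝ}
    (hZ : ∀ ω, IsCadlag fun t => Z t ω)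
    (hZm : ∀ ⦃s t : ℝ≥0⦄, s ≤ t → Measurable[past X t] (Z s)) :
    IsOptional X fun ω => downTime a (fun t => Z t ω) (T ω) := fun t => by
  have : {ω | DoubleBarrier.downTime a (fun t => Z t ω) (T ω) < t} =
      ⋃ (r : ℚ≥0) (r' : ℚ≥0) (_ : r ≤ r' ∧ (r' : ℝ≥0) < t),
        {ω | T ω < (r : ℝ≥0)} ∩ {ω | a < Z r ω - Z r' ω} := by
    ext ω
    simp only [mem_ofPred_eq, downTime_lt_iff_rat (hZ ω) ha, mem_iUnion, mem_inter_iff,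
      exists_prop]
    exact exists_congr fun r => exists_congr fun r' => by tauto
  rw [this]
  refine @MeasurableSet.iUnion _ _ (past X t) _ _ fun r => @MeasurableSet.iUnion _ _ (past X t) _ _
    fun r' => @MeasurableSet.iUnion _ _ (past X t) _ _ fun h => ?_
  have h1 : (r : ℝ≥0) ≤ r' := by exact_mod_cast h.1
  refine @MeasurableSet.inter _ (past X t) _ _ (past_mono (h1.trans h.2.le) _ (hT _)) ?_
  exact measurableSet_const_lt
    (measurable_sub_real (hZm (h1.trans h.2.le)) (hZm h.2.le)) a

lemma isOptional_crossTime_zero (hX : IsRegularLevy X P) (ha : 0 ≤ a) (x : ℝ) :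
    IsOptional X fun ω => crossTime a (shifted X x ω) 0 := fun t => by
  have hc : ∀ ω, IsCadlag (shifted X x ω) := fun ω => (hX.cadlag ω).const_add x
  have : {ω | crossTime a (shifted X x ω) 0 < t} =
      (⋃ (r : ℚ≥0) (_ : (r : ℝ≥0) < t), {ω | a < shifted X x ω r}) ∪
      ⋃ (r : ℚ≥0) (r' : ℚ≥0) (_ : r ≤ r' ∧ (r' : ℝ≥0) < t),
        {ω | a < shifted X x ω r' - shifted X x ω r} := by
    ext ω
    simp only [mem_ofPred_eq, mem_iUnion, mem_union, exists_prop, crossTime_zero, firstTime_lt_iff]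
    constructor
    · rintro ⟨u, hu | ⟨s, hs, hu⟩, hut⟩
      · left
        obtain ⟨v, hv, h⟩ := (hc ω).exists_right u (sub_pos.2 hu)
        obtain ⟨r, hr, hr'⟩ := exists_rat_between (lt_min hv (by exact_mod_cast hut : u < t))
        have := abs_lt.1 (h r hr.le (hr'.trans_le (min_le_left _ _)))
        exact ⟨r, hr'.trans_le (min_le_right _ _), by linarith⟩
      · right
        obtain ⟨r, r', h1, h2, h3, h4⟩ := (hc ω).neg.exists_rat_sub ha hs
          (by exact_mod_cast hut : u < t) (by linarith)
        exact ⟨r, r', ⟨h2, h3⟩, by linarith⟩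
    · rintro (⟨r, hr, h⟩ | ⟨r, r', ⟨h1, h2⟩, h⟩)
      · exact ⟨r, Or.inl h, by exact_mod_cast hr⟩
      · exact ⟨r', Or.inr ⟨r, by exact_mod_cast h1, h⟩, by exact_mod_cast h2⟩
  rw [this]
  refine @MeasurableSet.union _ (past X t) _ _ ?_ ?_
  · refine @MeasurableSet.iUnion _ _ (past X t) _ _ fun r =>
      @MeasurableSet.iUnion _ _ (past X t) _ _ fun h => ?_
    exact measurableSet_const_lt (measurable_past_shifted x h.le) a
  · refine @MeasurableSet.iUnion _ _ (past X t) _ _ fun r =>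
      @MeasurableSet.iUnion _ _ (past X t) _ _ fun r' =>
      @MeasurableSet.iUnion _ _ (past X t) _ _ fun h => ?_
    have h1 : (r : ℝ≥0) ≤ r' := by exact_mod_cast h.1
    exact measurableSet_const_lt (measurable_sub_real
      (measurable_past_shifted x h.2.le) (measurable_past_shifted x (h1.trans h.2.le))) a

lemma isOptional_crossTime (hX : IsRegularLevy X P) (ha : 0 ≤ a) (x : ℝ) (n : ℕ) :
    IsOptional X fun ω => crossTime a (shifted X x ω) n := by
  have hc : ∀ ω, IsCadlag (shifted X x ω) := fun ω => (hX.cadlag ω).const_add x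
  induction n with
  | zero => exact isOptional_crossTime_zero hX ha x
  | succ n ih =>
    simp only [crossTime_succ]
    split_ifs
    · exact ih.downTime ha (Z := fun t ω => shifted X x ω t) hc (measurable_past_shifted x)
    · exact ih.downTime ha (Z := fun t ω => -shifted X x ω t) (fun ω => (hc ω).neg)
        fun s t h => @Measurable.neg _ _ _ _ _ (past X t) _ (measurable_past_shifted x h)

lemma IsOptional.measurable_indicator {T : Ω → ℝ≥0∞} (hT : IsOptional X T) {g : ℝ≥0∞ → ℝ≥0∞}
    (hg : Measurable g) (t : ℝ≥0) :
    Measurable[past X t] ({ω | T ω < t}.indicator fun ω => g (T ω)) := by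
  have h1 : Measurable[past X t] fun ω => min (T ω) t := by
    refine measurable_of_preimage_Iio fun c => ?_
    by_cases hc : (t : ℝ≥0∞) < c
    · have : (fun ω => min (T ω) t) ⁻¹' Iio c = univ := by
        ext ω; simp [hc]
      rw [this]; exact @MeasurableSet.univ _ (past X t)
    · have hct : c ≠ ∞ := ((not_lt.1 hc).trans_lt ENNReal.coe_lt_top).ne
      lift c to ℝ≥0 using hct
      have : (fun ω => min (T ω) t) ⁻¹' Iio (c : ℝ≥0∞) = {ω | T ω < c} := by
        ext ω
        simp only [mem_preimage, mem_Iio, min_lt_iff, hc, or_false, mem_ofPred_eq]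
      rw [this]
      exact past_mono (by exact_mod_cast not_lt.1 hc) _ (hT c)
  have h2 : ({ω | T ω < t}.indicator fun ω => g (T ω)) =
      {ω | T ω < t}.indicator fun ω => g (min (T ω) t) := by
    refine indicator_congr fun ω hω => ?_
    rw [min_eq_left (le_of_lt hω)]
  rw [h2]
  exact measurable_comp_indicator h1 hg (hT t)

/-- The Laplace transform `nu` as an extended non-negative number. -/
def nuE (X : ℝ≥0 → Ω → ℝ) (P : Measure Ω) (q a : ℝ) : ℝ≥0∞ :=
  ∫⁻ ω, ENNReal.ofReal (discount q (downTime a (fun t => X t ω) 0)) ∂P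

/-- The expected discount factor at the `n`-th crossing time for the process started at `x`. -/
def crossDisc (X : ℝ≥0 → Ω → ℝ) (P : Measure Ω) (q a x : ℝ) (n : ℕ) : ℝ≥0∞ :=
  ∫⁻ ω, ENNReal.ofReal (discount q (crossTime a (shifted X x ω) n)) ∂P

lemma measurable_ofReal_discount (q : ℝ) : Measurable fun T => ENNReal.ofReal (discount q T) :=
  ENNReal.measurable_ofReal.comp (measurable_discount q)

lemma measurable_discount_crossTime (hX : IsRegularLevy X P) (ha : 0 ≤ a) (q x : ℝ) (n : ℕ) :
    Measurable fun ω => ENNReal.ofReal (discount q (crossTime a (shifted X x ω) n)) :=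
  (measurable_ofReal_discount q).comp ((isOptional_crossTime hX ha x n).measurable hX)

lemma lintegral_discount_downTime (hX : IsRegularLevy X P) (hq : 0 < q) (ha : 0 ≤ a)
    {T : Ω → ℝ≥0∞} (hT : IsOptional X T) :
    ∫⁻ ω, ENNReal.ofReal (discount q (downTime a (fun t => X t ω) (T ω))) ∂P =
      (∫⁻ ω, ENNReal.ofReal (discount q (T ω)) ∂P) * nuE X P q a := by
  set Y : Ω → ℝ≥0∞ := fun ω => ENNReal.ofReal (discount q (T ω)) with hYdef
  set G : (ℚ≥0 → ℝ) → ℝ≥0∞ := fun y => ENNReal.ofReal (discount q (ratDownTime a y)) with hGdef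
  have hTm := hT.measurable hX
  have hYm : Measurable Y := (measurable_ofReal_discount q).comp hTm
  have hGm : Measurable G := (measurable_ofReal_discount q).comp (measurable_ratDownTime a)
  have hfull : ∀ F : Ω → ℝ≥0∞, (∀ ω, T ω = ∞ → F ω = 0) →
      ∫⁻ ω in {ω | T ω < ∞}, F ω ∂P = ∫⁻ ω, F ω ∂P := fun F hF => by
    rw [← lintegral_indicator (measurableSet_lt hTm measurable_const)]
    refine lintegral_congr fun ω => ?_
    by_cases h : T ω = ∞
    · rw [indicator_apply, hF ω h, ite_self]
    · rw [indicator_of_mem]; exact Ne.lt_top h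
  have hsm := hX.strongMarkov hT (Y := Y) (hT.measurable_indicator (measurable_ofReal_discount q))
    hYm (fun ω => by
      rw [hYdef, ← ENNReal.ofReal_one]; exact ENNReal.ofReal_le_ofReal (discount_le_one hq _)) hGm
  have hY0 : ∀ ω, T ω = ∞ → Y ω = 0 := fun ω h => by simp [hYdef, h, discount]
  rw [hfull _ fun ω h => by rw [hY0 ω h, zero_mul], hfull _ hY0] at hsm
  have hnu : nuE X P q a = ∫⁻ ω, G (ratPath X ω) ∂P :=
    lintegral_congr fun ω => by rw [downTime_zero_eq (hX.cadlag ω) ha]; rfl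
  rw [hnu, ← hsm]
  refine lintegral_congr fun ω => ?_
  by_cases h : T ω = ∞
  · rw [hY0 ω h, h, downTime_top]; simp [discount]
  · have e := downTime_zero_eq ((hX.shift (T ω).toNNReal).cadlag ω) ha
    rw [hYdef, hGdef, ← ENNReal.ofReal_mul (discount_nonneg _ _), ← ENNReal.coe_toNNReal h,
      downTime_coe, discount_add, e]
    simp only [ENNReal.toNNReal_coe]
    rfl

lemma crossDisc_bottom (hX : IsRegularLevy X P) (hq : 0 < q) (ha : 0 ≤ a) (x : ℝ) (j : ℕ) :
    crossDisc X P q a x (2 * j + 1) = crossDisc X P q a x (2 * j) * nuE X P q a := by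
  rw [crossDisc, crossDisc, ← lintegral_discount_downTime hX hq ha (isOptional_crossTime hX ha x _)]
  refine lintegral_congr fun ω => ?_
  rw [crossTime_succ, if_pos (even_two_mul j), downTime_shifted]

lemma crossDisc_anti (hq : 0 < q) (a x : ℝ) : Antitone (crossDisc X P q a x) := fun _ _ h =>
  lintegral_mono fun _ => ENNReal.ofReal_le_ofReal (discount_anti hq (crossTime_mono h))

lemma lintegral_discTop (hX : IsRegularLevy X P) (ha : 0 ≤ a) (q x : ℝ) :
    ∫⁻ ω, discTop q a (shifted X x ω) ∂P = ∑' j, crossDisc X P q a x (2 * j) :=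
  lintegral_tsum fun _ => (measurable_discount_crossTime hX ha q x _).aemeasurable

lemma lintegral_discBottom (hX : IsRegularLevy X P) (hq : 0 < q) (ha : 0 ≤ a) (x : ℝ) :
    ∫⁻ ω, discBottom q a (shifted X x ω) ∂P =
      (∫⁻ ω, discTop q a (shifted X x ω) ∂P) * nuE X P q a := by
  rw [lintegral_discTop hX ha, ← ENNReal.tsum_mul_right]
  simp_rw [← crossDisc_bottom hX hq ha]
  exact lintegral_tsum fun _ => (measurable_discount_crossTime hX ha q x _).aemeasurable

lemma measurable_discTop (hX : IsRegularLevy X P) (ha : 0 ≤ a) (q x : ℝ) :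
    Measurable fun ω => discTop q a (shifted X x ω) :=
  Measurable.tsum fun _ => measurable_discount_crossTime hX ha q x _

lemma measurable_discBottom (hX : IsRegularLevy X P) (ha : 0 ≤ a) (q x : ℝ) :
    Measurable fun ω => discBottom q a (shifted X x ω) :=
  Measurable.tsum fun _ => measurable_discount_crossTime hX ha q x _

lemma lintegral_discTop_le (hX : IsRegularLevy X P) (hq : 0 < q) (ha : 0 ≤ a) (x : ℝ) :
    ∫⁻ ω, discTop q a (shifted X x ω) ∂P ≤ crossDisc X P q a x 0 * (1 - nuE X P q a)⁻¹ := by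
  rw [lintegral_discTop hX ha, ← ENNReal.tsum_geometric, ← ENNReal.tsum_mul_left]
  refine ENNReal.tsum_le_tsum fun j => ?_
  induction j with
  | zero => simp
  | succ j ih =>
    calc crossDisc X P q a x (2 * (j + 1)) ≤ crossDisc X P q a x (2 * j + 1) :=
          crossDisc_anti hq a x (by lia)
      _ = crossDisc X P q a x (2 * j) * nuE X P q a := crossDisc_bottom hX hq ha x j
      _ ≤ crossDisc X P q a x 0 * nuE X P q a ^ j * nuE X P q a := by gcongr
      _ = _ := by rw [pow_succ, mul_assoc]

lemma measurable_downTime_zero (hX : IsRegularLevy X P) (ha : 0 ≤ a) :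
    Measurable fun ω => downTime a (fun t => X t ω) 0 := by
  simp_rw [fun ω => downTime_zero_eq (hX.cadlag ω) ha]
  exact (measurable_ratDownTime a).comp hX.measurable_ratPath

lemma discount_lt_one (hq : 0 < q) {T : ℝ≥0∞} (hT : 0 < T) : discount q T < 1 := by
  rw [discount]
  split_ifs with h
  · exact one_pos
  · have := ENNReal.toReal_pos hT.ne' h
    rw [Real.exp_lt_one_iff]
    nlinarith

lemma nuE_lt_one (hX : IsRegularLevy X P) (hq : 0 < q) (ha : 0 < a) : nuE X P q a < 1 := by
  have := hX.isProbabilityMeasure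
  have hlt : ∀ ω, ENNReal.ofReal (discount q (downTime a (fun t => X t ω) 0)) < 1 := fun ω => by
    rw [← ENNReal.ofReal_one]
    refine (ENNReal.ofReal_lt_ofReal_iff one_pos).2 (discount_lt_one hq ?_)
    exact_mod_cast lt_downTime ha (hX.cadlag ω) 0
  calc nuE X P q a < ∫⁻ _, 1 ∂P := by
        refine lintegral_strict_mono (IsProbabilityMeasure.ne_zero P) aemeasurable_const ?_
          (Eventually.of_forall hlt)
        exact ((lintegral_mono fun ω => (hlt ω).le).trans_lt (by simp)).ne
    _ = 1 := by simp

lemma nuE_anti (hq : 0 < q) : Antitone (nuE X P q) := fun _ _ hab =>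
  lintegral_mono fun _ => ENNReal.ofReal_le_ofReal (discount_anti hq (le_firstTime_iff.2
    fun _ ⟨s, h1, h2, h3⟩ => firstTime_le ⟨s, h1, h2, hab.trans_lt h3⟩))

lemma nu_eq (hX : IsRegularLevy X P) (ha : 0 < a) : nu X P q a = (nuE X P q a).toReal := by
  rw [nu, integral_eq_lintegral_of_nonneg_ae (Eventually.of_forall fun _ => discount_nonneg _ _)]
  · congr 1
    refine lintegral_congr fun ω => ?_
    rw [← kappa_eq (hX.cadlag ω) (hX.zero ω) ha]
    rfl
  · refine Measurable.aestronglyMeasurable ?_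
    have : (fun ω => discount q (kappa a (shifted X a ω))) =
        fun ω => discount q (downTime a (fun t => X t ω) 0) := by
      ext ω
      rw [← kappa_eq (hX.cadlag ω) (hX.zero ω) ha]
      rfl
    rw [this]
    exact (measurable_discount q).comp (measurable_downTime_zero hX ha.le)

end Optional

/-! ### Maximal inequality and finiteness of the values at positive barriers -/

section RationalSup

variable {w : ℝ≥0 → ℝ}

lemma IsCadlag.exists_rat_mem (hw : IsCadlag w) {U : Set ℝ} (hU : IsOpen U) {s u : ℝ≥0}
    (h : w s ∈ U) (hsu : s < u) : ∃ r : ℚ≥0, s < r ∧ (r : ℝ≥0) < u ∧ w r ∈ U := by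
  obtain ⟨ε, hε, hεU⟩ := Metric.isOpen_iff.1 hU _ h
  obtain ⟨v, hv, h1⟩ := hw.exists_right s hε
  obtain ⟨r, hr, hr'⟩ := exists_rat_between (lt_min hv hsu)
  exact ⟨r, hr, hr'.trans_le (min_le_right _ _),
    hεU (by simpa [Real.dist_eq] using h1 r hr.le (hr'.trans_le (min_le_left _ _)))⟩

/-- The supremum of the absolute values over the rational times before `t`. -/
def ratSupAbs (t : ℝ≥0) (y : ℚ≥0 → ℝ) : ℝ≥0∞ := ⨆ (r : ℚ≥0) (_ : (r : ℝ≥0) < t), ‖y r‖ₑ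

lemma measurable_ratSupAbs (t : ℝ≥0) : Measurable (ratSupAbs t) :=
  Measurable.iSup fun r => Measurable.iSup fun _ => (measurable_pi_apply r).enorm

lemma supAbs_eq (hw : IsCadlag w) (t : ℝ≥0) : supAbs w t = ratSupAbs t fun r => w r := by
  refine le_antisymm (iSup₂_le fun s hs => le_of_forall_lt fun c hc => ?_)
    (iSup₂_le fun r hr => le_supAbs hr)
  obtain ⟨r, -, hr, h⟩ := hw.exists_rat_mem (U := {z | c < ‖z‖ₑ})
    (isOpen_lt continuous_const continuous_enorm) hc hs
  exact lt_of_lt_of_le h (le_iSup₂_of_le (f := fun (r : ℚ≥0) (_ : (r : ℝ≥0) < t) => ‖w r‖ₑ)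
    r hr le_rfl)

end RationalSup

section Maximal

variable {Ω : Type*} [mΩ : MeasurableSpace Ω] {X : ℝ≥0 → Ω → ℝ} {P : Measure Ω} {a x q : ℝ}

lemma isOptional_exit (hX : IsRegularLevy X P) (c : ℝ≥0∞) :
    IsOptional X fun ω => firstTime fun t => c < ‖X t ω‖ₑ := fun t => by
  have hop : IsOpen {z : ℝ | c < ‖z‖ₑ} := isOpen_lt continuous_const continuous_enorm
  have : {ω | (firstTime fun t => c < ‖X t ω‖ₑ) < t} =
      ⋃ (r : ℚ≥0) (_ : (r : ℝ≥0) < t), X r ⁻¹' {z | c < ‖z‖ₑ} := by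
    ext ω
    simp only [mem_ofPred_eq, mem_iUnion, exists_prop, firstTime_lt_iff, mem_preimage]
    constructor
    · rintro ⟨u, hu, hut⟩
      obtain ⟨r, -, hr, h⟩ := (hX.cadlag ω).exists_rat_mem hop hu
        (by exact_mod_cast hut : u < t)
      exact ⟨r, hr, h⟩
    · rintro ⟨r, hr, h⟩
      exact ⟨r, h, by exact_mod_cast hr⟩
  rw [this]
  refine @MeasurableSet.iUnion _ _ (past X t) _ _ fun r =>
    @MeasurableSet.iUnion _ _ (past X t) _ _ fun h => ?_
  exact measurable_past h.le hop.measurableSet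

lemma measurable_supAbs (hX : IsRegularLevy X P) (t : ℝ≥0) :
    Measurable fun ω => supAbs (fun s => X s ω) t := by
  simp_rw [fun ω => supAbs_eq (hX.cadlag ω) t]
  exact (measurable_ratSupAbs t).comp hX.measurable_ratPath

lemma exists_half_le (hX : IsRegularLevy X P) (t : ℝ≥0) :
    ∃ b : ℝ≥0, 2⁻¹ ≤ P {ω | supAbs (fun s => X s ω) t ≤ b} := by
  have := hX.isProbabilityMeasure
  have hmono : Monotone fun n : ℕ => {ω | supAbs (fun s => X s ω) t ≤ n} := fun m n h ω hω =>
    le_trans (show _ ≤ (m : ℝ≥0∞) from hω) (by exact_mod_cast h)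
  have hU : ⋃ n : ℕ, {ω | supAbs (fun s => X s ω) t ≤ n} = univ := by
    refine eq_univ_of_forall fun ω => mem_iUnion.2 ?_
    obtain ⟨n, hn⟩ := ENNReal.exists_nat_gt ((hX.cadlag ω).supAbs_lt_top t).ne
    exact ⟨n, hn.le⟩
  have := tendsto_measure_iUnion_atTop (μ := P) hmono
  rw [hU, measure_univ] at this
  obtain ⟨n, hn⟩ := (this.eventually (lt_mem_nhds (show (2⁻¹ : ℝ≥0∞) < 1 by
    simp))).exists
  exact ⟨n, by simpa using hn.le⟩

lemma le_enorm_exit {w : ℝ≥0 → ℝ} (hw : IsCadlag w) {c : ℝ≥0∞} {T : ℝ≥0}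
    (hT : (firstTime fun t => c < ‖w t‖ₑ) = T) : c ≤ ‖w T‖ₑ := by
  by_contra! h
  obtain ⟨ε, hε, hεU⟩ := Metric.isOpen_iff.1
    (isOpen_lt continuous_enorm continuous_const : IsOpen {z : ℝ | ‖z‖ₑ < c}) _ h
  obtain ⟨v, hv, h1⟩ := hw.exists_right T hε
  have hlt : (firstTime fun t => c < ‖w t‖ₑ) < v := hT.trans_lt (by exact_mod_cast hv)
  obtain ⟨t, ht, htv⟩ := firstTime_lt_iff.1 hlt
  have hTt : T ≤ t := by
    have := hT.symm.trans_le (firstTime_le ht)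
    exact_mod_cast this
  exact lt_asymm ht (hεU (by simpa [Real.dist_eq] using h1 t hTt (by exact_mod_cast htv)))

lemma measure_supAbs_gt_le (hX : IsRegularLevy X P) {b : ℝ≥0}
    (hb : 2⁻¹ ≤ P {ω | supAbs (fun s => X s ω) 2 ≤ b}) (c : ℝ≥0∞) :
    P {ω | c < supAbs (fun s => X s ω) 1} ≤ 2 * P {ω | c ≤ ‖X 1 ω‖ₑ + b} := by
  have := hX.isProbabilityMeasure
  set T : Ω → ℝ≥0∞ := fun ω => firstTime fun t => c < ‖X t ω‖ₑ with hTdef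
  have hT : IsOptional X T := isOptional_exit hX c
  have hTm := hT.measurable hX
  have hset : {ω | c < supAbs (fun s => X s ω) 1} = {ω | T ω < 1} := by
    ext ω
    simp only [mem_ofPred_eq, hTdef, firstTime_lt_iff, supAbs, lt_iSup_iff]
    exact exists_congr fun t => by simp [and_comm]
  set Y : Ω → ℝ≥0∞ := fun ω => (Iio (1 : ℝ≥0∞)).indicator 1 (T ω) with hYdef
  have hgm : Measurable ((Iio (1 : ℝ≥0∞)).indicator (1 : ℝ≥0∞ → ℝ≥0∞)) :=
    measurable_one.indicator measurableSet_Iio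
  set A : Set (ℚ≥0 → ℝ) := {y | ratSupAbs 2 y ≤ b} with hA
  have hAm : MeasurableSet A := measurableSet_le (measurable_ratSupAbs 2) measurable_const
  have hsm := hX.strongMarkov hT (Y := Y) (G := A.indicator 1) (hT.measurable_indicator hgm)
    (hgm.comp hTm) (fun ω => by
      rw [hYdef]; simp only [indicator_apply]; split_ifs <;> simp) (measurable_one.indicator hAm)
  have hY : ∫⁻ ω in {ω | T ω < ∞}, Y ω ∂P = P {ω | T ω < 1} := by
    rw [← lintegral_indicator (measurableSet_lt hTm measurable_const),
      ← lintegral_indicator_one (measurableSet_lt hTm measurable_const)]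
    refine lintegral_congr fun ω => ?_
    simp only [indicator_apply, mem_ofPred_eq, hYdef, mem_Iio, Pi.one_apply]
    by_cases h : T ω < 1
    · simp [h, h.trans ENNReal.one_lt_top]
    · simp [h]
  have hG : ∫⁻ ω, A.indicator 1 (ratPath X ω) ∂P = P {ω | supAbs (fun s => X s ω) 2 ≤ b} := by
    rw [← lintegral_indicator_one (measurableSet_le (measurable_supAbs hX 2) measurable_const)]
    refine lintegral_congr fun ω => ?_
    simp only [indicator_apply, mem_ofPred_eq, hA, supAbs_eq (hX.cadlag ω)]
    rfl
  have hle : ∫⁻ ω in {ω | T ω < ∞}, Y ω * A.indicator 1 (future X (T ω).toNNReal ω) ∂P ≤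
      P {ω | c ≤ ‖X 1 ω‖ₑ + b} := by
    rw [← lintegral_indicator (measurableSet_lt hTm measurable_const),
      ← lintegral_indicator_one (measurableSet_le measurable_const
        ((hX.measurable 1).enorm.add_const _))]
    refine lintegral_mono fun ω => ?_
    simp only [indicator_apply, hYdef, mem_ofPred_eq, mem_Iio, Pi.one_apply]
    by_cases h1 : T ω < 1
    swap
    · simp [h1]
    by_cases h2 : future X (T ω).toNNReal ω ∈ A
    swap
    · simp [h2]
    have hfin : T ω ≠ ∞ := (h1.trans ENNReal.one_lt_top).ne
    have hcT := le_enorm_exit (hX.cadlag ω) (T := (T ω).toNNReal) (ENNReal.coe_toNNReal hfin).symm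
    have hT1 : (T ω).toNNReal ≤ 1 := by
      rw [← ENNReal.coe_le_coe, ENNReal.coe_toNNReal hfin]; simpa using h1.le
    obtain ⟨v, hv⟩ := exists_add_of_le hT1
    have hv1 : v < 2 := lt_of_le_of_lt (by rw [hv]; exact le_add_self) one_lt_two
    have hbd : ‖X ((T ω).toNNReal + v) ω - X (T ω).toNNReal ω‖ₑ ≤ b := by
      have e := supAbs_eq ((hX.shift (T ω).toNNReal).cadlag ω) 2
      exact (le_supAbs (w := fun s => X ((T ω).toNNReal + s) ω - X (T ω).toNNReal ω) hv1).trans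
        (e.trans_le h2)
    rw [← hv] at hbd
    have : c ≤ ‖X 1 ω‖ₑ + b := by
      calc c ≤ ‖X (T ω).toNNReal ω‖ₑ := hcT
        _ = ‖X 1 ω - (X 1 ω - X (T ω).toNNReal ω)‖ₑ := by congr 1; ring
        _ ≤ ‖X 1 ω‖ₑ + ‖X 1 ω - X (T ω).toNNReal ω‖ₑ := enorm_sub_le
        _ ≤ _ := by gcongr
    simp only [h1, if_true, h2, this, one_mul]
    split_ifs <;> simp
  rw [hsm, hY, hG] at hle
  rw [hset]
  calc P {ω | T ω < 1} = 2 * (P {ω | T ω < 1} * 2⁻¹) := by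
        rw [mul_comm, mul_assoc, ENNReal.inv_mul_cancel (by simp) (by simp), mul_one]
    _ ≤ _ := by gcongr; exact (mul_le_mul_right hb _).trans hle

lemma lintegral_supAbs_one (hX : IsRegularLevy X P) (hint : Integrable (X 1) P) :
    ∫⁻ ω, supAbs (fun s => X s ω) 1 ∂P < ∞ := by
  have := hX.isProbabilityMeasure
  obtain ⟨b, hb⟩ := exists_half_le hX 2
  have hfin : ∀ ω, supAbs (fun s => X s ω) 1 ≠ ∞ := fun ω => ((hX.cadlag ω).supAbs_lt_top 1).ne
  have e1 : ∫⁻ ω, supAbs (fun s => X s ω) 1 ∂P =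
      ∫⁻ t in Ioi (0 : ℝ), P {ω | t < (supAbs (fun s => X s ω) 1).toReal} := by
    rw [← lintegral_eq_lintegral_meas_lt P (Eventually.of_forall fun _ => ENNReal.toReal_nonneg)
      (measurable_supAbs hX 1).ennreal_toReal.aemeasurable]
    exact lintegral_congr fun ω => (ENNReal.ofReal_toReal (hfin ω)).symm
  have e2 : ∫⁻ ω, (‖X 1 ω‖ₑ + b) ∂P =
      ∫⁻ t in Ioi (0 : ℝ), P {ω | t ≤ |X 1 ω| + b} := by
    rw [← lintegral_eq_lintegral_meas_le P
      (Eventually.of_forall fun _ => add_nonneg (abs_nonneg _) b.coe_nonneg)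
      ((hX.measurable 1).abs.add_const _).aemeasurable]
    refine lintegral_congr fun ω => ?_
    rw [ENNReal.ofReal_add (abs_nonneg _) b.coe_nonneg, ENNReal.ofReal_coe_nnreal,
      Real.enorm_eq_ofReal_abs]
  have hlt : ∫⁻ ω, (‖X 1 ω‖ₑ + b) ∂P < ∞ := by
    rw [lintegral_add_right _ measurable_const, lintegral_const, measure_univ, mul_one]
    exact ENNReal.add_lt_top.2 ⟨hint.2, ENNReal.coe_lt_top⟩
  have : ∫⁻ ω, supAbs (fun s => X s ω) 1 ∂P ≤ 2 * ∫⁻ ω, (‖X 1 ω‖ₑ + b) ∂P := by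
    rw [e1, e2, ← lintegral_const_mul' _ _ (by simp)]
    refine setLIntegral_mono_ae' measurableSet_Ioi (Eventually.of_forall fun t ht => ?_)
    convert measure_supAbs_gt_le hX hb (ENNReal.ofReal t) using 4 with ω ω
    · exact (ENNReal.ofReal_lt_iff_lt_toReal (le_of_lt ht) (hfin ω)).symm
    · funext ω
      rw [Real.enorm_eq_ofReal_abs, ← ENNReal.ofReal_coe_nnreal,
        ← ENNReal.ofReal_add (abs_nonneg _) b.coe_nonneg,
        ENNReal.ofReal_le_ofReal_iff (add_nonneg (abs_nonneg _) b.coe_nonneg)]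
  exact this.trans_lt (ENNReal.mul_lt_top (by simp) hlt)

lemma lintegral_supAbs_shift (hX : IsRegularLevy X P) (u t : ℝ≥0) :
    ∫⁻ ω, supAbs (fun s => X (u + s) ω - X u ω) t ∂P = ∫⁻ ω, supAbs (fun s => X s ω) t ∂P := by
  simp_rw [fun ω => supAbs_eq (hX.cadlag ω) t, fun ω => supAbs_eq ((hX.shift u).cadlag ω) t]
  exact hX.lintegral_future u (measurable_ratSupAbs t)

lemma supAbs_natCast_le (hX : IsRegularLevy X P) (m : ℕ) (ω : Ω) :
    supAbs (fun s => X s ω) m ≤ ∑ k ∈ Finset.range m,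
      (supAbs (fun s => X (k + s) ω - X k ω) 1 + ‖X (k + 1) ω - X k ω‖ₑ) ∧
    ‖X m ω‖ₑ ≤ ∑ k ∈ Finset.range m,
      (supAbs (fun s => X (k + s) ω - X k ω) 1 + ‖X (k + 1) ω - X k ω‖ₑ) := by
  induction m with
  | zero => simp [supAbs, hX.zero]
  | succ m ih =>
    rw [Finset.sum_range_succ]
    have h2 : ∀ u, ‖X u ω‖ₑ ≤ ‖X m ω‖ₑ + ‖X u ω - X m ω‖ₑ := fun u => by
      calc ‖X u ω‖ₑ = ‖X m ω + (X u ω - X m ω)‖ₑ := by congr 1; ring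
        _ ≤ _ := enorm_add_le _ _
    constructor
    · refine iSup₂_le fun s hs => ?_
      rcases lt_or_ge s m with h | h
      · exact (le_supAbs (w := fun s => X s ω) h).trans (ih.1.trans le_self_add)
      · obtain ⟨v, rfl⟩ := exists_add_of_le h
        have hv : v < 1 := by simpa using hs
        exact (h2 _).trans (add_le_add ih.2 ((le_supAbs (w := fun s => X (m + s) ω - X m ω) hv).trans
          le_self_add))
    · push_cast
      exact (h2 _).trans (add_le_add ih.2 le_add_self)

lemma lintegral_enorm_shift (hX : IsRegularLevy X P) (u t : ℝ≥0) :
    ∫⁻ ω, ‖X (u + t) ω - X u ω‖ₑ ∂P = ∫⁻ ω, ‖X t ω‖ₑ ∂P :=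
  ((hX.stationary u t).comp measurable_enorm).lintegral_eq

/-- The mean fluctuation of the process over a unit of time. -/
def fluctuation (X : ℝ≥0 → Ω → ℝ) (P : Measure Ω) : ℝ≥0∞ :=
  ∫⁻ ω, supAbs (fun s => X s ω) 1 ∂P + ∫⁻ ω, ‖X 1 ω‖ₑ ∂P

lemma fluctuation_lt_top (hX : IsRegularLevy X P) (hint : Integrable (X 1) P) :
    fluctuation X P < ∞ := ENNReal.add_lt_top.2 ⟨lintegral_supAbs_one hX hint, hint.2⟩

lemma lintegral_supAbs_natCast_le (hX : IsRegularLevy X P) (m : ℕ) :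
    ∫⁻ ω, supAbs (fun s => X s ω) m ∂P ≤ m * fluctuation X P := by
  refine (lintegral_mono fun ω => (supAbs_natCast_le hX m ω).1).trans ?_
  rw [lintegral_finsetSum' _ fun k _ => ?_]
  · refine (Finset.sum_le_card_nsmul _ _ (fluctuation X P) fun k _ => ?_).trans (by simp)
    rw [lintegral_add_left (measurable_supAbs (hX.shift k) 1), lintegral_supAbs_shift hX,
      lintegral_enorm_shift hX]
    rfl
  · exact ((measurable_supAbs (hX.shift k) 1).add
      ((hX.measurable _).sub (hX.measurable _)).enorm).aemeasurable

/-- A bound for the discounted size of a path. -/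
def discSize (q : ℝ) (w : ℝ≥0 → ℝ) : ℝ≥0∞ :=
  ∑' m : ℕ, ENNReal.ofReal (Real.exp (-q * m)) * (2 * supAbs w (m + 1) + 1)

lemma supAbs_shifted_le (X : ℝ≥0 → Ω → ℝ) (x : ℝ) (ω : Ω) (t : ℝ≥0) :
    supAbs (shifted X x ω) t ≤ ‖x‖ₑ + supAbs (fun s => X s ω) t :=
  iSup₂_le fun s hs => (enorm_add_le _ _).trans (by
    gcongr; exact le_supAbs (w := fun s => X s ω) hs)

lemma tsum_exp_mul_lt_top (hq : 0 < q) {C : ℝ≥0∞} (hC : C < ∞) :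
    ∑' m : ℕ, ENNReal.ofReal (Real.exp (-q * m)) * (((m + 1 : ℕ) : ℝ≥0∞) * C) < ∞ := by
  have e : ∑' m : ℕ, ENNReal.ofReal (Real.exp (-q * m)) * (((m + 1 : ℕ) : ℝ≥0∞) * C) =
      (∑' m : ℕ, ENNReal.ofReal (((m + 1 : ℕ) : ℝ) * Real.exp (-q * m))) * C := by
    rw [← ENNReal.tsum_mul_right]
    refine tsum_congr fun m => ?_
    rw [ENNReal.ofReal_mul (by positivity), ENNReal.ofReal_natCast]
    ring
  rw [e]
  refine ENNReal.mul_lt_top (lt_top_iff_ne_top.2 (Summable.tsum_ofReal_ne_top ?_)) hC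
  refine ((Real.summable_pow_mul_exp_neg_nat_mul 1 hq).add
    (Real.summable_pow_mul_exp_neg_nat_mul 0 hq)).congr fun m => ?_
  push_cast; ring

lemma lintegral_discSize_lt_top (hX : IsRegularLevy X P) (hint : Integrable (X 1) P) (hq : 0 < q)
    (x : ℝ) : ∫⁻ ω, discSize q (shifted X x ω) ∂P < ∞ := by
  have := hX.isProbabilityMeasure
  set C : ℝ≥0∞ := 2 * (‖x‖ₑ + fluctuation X P) + 1 with hC
  have hCt : C < ∞ := by
    have := fluctuation_lt_top hX hint
    exact ENNReal.add_lt_top.2 ⟨ENNReal.mul_lt_top (by simp)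
      (ENNReal.add_lt_top.2 ⟨by simp, this⟩), by simp⟩
  have hle : ∀ m : ℕ, ∫⁻ ω, (2 * (‖x‖ₑ + supAbs (fun s => X s ω) (m + 1)) + 1) ∂P ≤
      ((m + 1 : ℕ) : ℝ≥0∞) * C := fun m => by
    have h1 : (1 : ℝ≥0∞) ≤ ((m + 1 : ℕ) : ℝ≥0∞) := by exact_mod_cast Nat.le_add_left _ _
    rw [lintegral_add_right _ measurable_const, lintegral_const_mul' _ _ (by simp),
      lintegral_add_left measurable_const, lintegral_const, lintegral_const, measure_univ,
      mul_one, mul_one, hC]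
    have h2 := lintegral_supAbs_natCast_le hX (m + 1)
    push_cast at h2 h1 ⊢
    calc _ ≤ 2 * (((m : ℝ≥0∞) + 1) * ‖x‖ₑ + ((m : ℝ≥0∞) + 1) * fluctuation X P) +
          ((m : ℝ≥0∞) + 1) := by
          gcongr
          exact le_mul_of_one_le_left' h1
      _ = _ := by ring
  calc ∫⁻ ω, discSize q (shifted X x ω) ∂P
      ≤ ∫⁻ ω, ∑' m : ℕ, ENNReal.ofReal (Real.exp (-q * m)) *
          (2 * (‖x‖ₑ + supAbs (fun s => X s ω) (m + 1)) + 1) ∂P := by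
        refine lintegral_mono fun ω => ENNReal.tsum_le_tsum fun m => ?_
        gcongr
        exact supAbs_shifted_le X x ω _
    _ = ∑' m : ℕ, ENNReal.ofReal (Real.exp (-q * m)) *
          ∫⁻ ω, (2 * (‖x‖ₑ + supAbs (fun s => X s ω) (m + 1)) + 1) ∂P := by
        rw [lintegral_tsum fun m => ?_]
        · exact tsum_congr fun m => lintegral_const_mul' _ _ (by simp)
        · exact ((((measurable_supAbs hX _).const_add _).const_mul _).add_const _).const_mul _
            |>.aemeasurable
    _ ≤ ∑' m : ℕ, ENNReal.ofReal (Real.exp (-q * m)) * (((m + 1 : ℕ) : ℝ≥0∞) * C) := by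
        gcongr with m
        exact hle m
    _ < ∞ := tsum_exp_mul_lt_top hq hCt

lemma lintegral_enorm_kill_le {w : ℝ≥0 → ℝ} (hq : 0 < q) :
    ∫⁻ s, ‖w s‖ₑ ∂kill q ≤ discSize q w := by
  calc ∫⁻ s, ‖w s‖ₑ ∂kill q
      ≤ ∫⁻ s, ∑' m : ℕ, {s : ℝ≥0 | ((m : ℝ≥0) : ℝ≥0∞) ≤ s}.indicator
          (fun _ => supAbs w (m + 1)) s ∂kill q := by
        refine lintegral_mono fun s => ?_
        refine le_trans ?_ (ENNReal.le_tsum ⌊s⌋₊)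
        rw [indicator_of_mem]
        · exact le_supAbs (Nat.lt_floor_add_one s)
        · have := Nat.floor_le (zero_le : 0 ≤ s)
          exact_mod_cast this
    _ = ∑' m : ℕ, ENNReal.ofReal (Real.exp (-q * m)) * supAbs w (m + 1) := by
        rw [lintegral_tsum fun m =>
          (measurable_const.indicator (measurableSet_ge _)).aemeasurable]
        refine tsum_congr fun m => ?_
        rw [lintegral_indicator_const (measurableSet_ge _), kill_ge hq, mul_comm]
        simp [discount]
    _ ≤ _ := by
        refine ENNReal.tsum_le_tsum fun m => ?_
        gcongr
        rw [two_mul, add_assoc]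
        exact le_self_add

end Maximal

/-! ### Values at positive barriers -/

section AdmissibleNpv

variable {w L R : ℝ≥0 → ℝ} {b q : ℝ}

lemma IsAdmissible.npv_injections_le (hq : 0 < q) (h : IsAdmissible w L R b) :
    npv q R ≤ npv q L + (discSize q w + ENNReal.ofReal b) := by
  have := isProbabilityMeasure_kill hq
  rw [npv_eq hq h.monoR h.nonnegR, npv_eq hq h.monoL h.nonnegL]
  calc ∫⁻ s, ENNReal.ofReal (R s) ∂kill q
      ≤ ∫⁻ s, (ENNReal.ofReal (L s) + (‖w s‖ₑ + ENNReal.ofReal b)) ∂kill q := by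
        refine lintegral_mono fun s => ?_
        rw [Real.enorm_eq_ofReal_abs]
        refine (ENNReal.ofReal_le_ofReal ?_).trans (ENNReal.ofReal_add_le.trans
          (add_le_add_right ENNReal.ofReal_add_le _))
        linarith [h.le s, neg_abs_le (w s)]
    _ = ∫⁻ s, ENNReal.ofReal (L s) ∂kill q + (∫⁻ s, ‖w s‖ₑ ∂kill q + ENNReal.ofReal b) := by
        rw [lintegral_add_left h.monoL.measurable.ennreal_ofReal,
          lintegral_add_right _ measurable_const, lintegral_const, measure_univ, mul_one]
    _ ≤ _ := by gcongr; exact lintegral_enorm_kill_le hq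

lemma IsAdmissible.npv_dividends_le (hq : 0 < q) (h : IsAdmissible w L R b) :
    npv q L ≤ npv q R + discSize q w := by
  rw [npv_eq hq h.monoR h.nonnegR, npv_eq hq h.monoL h.nonnegL]
  calc ∫⁻ s, ENNReal.ofReal (L s) ∂kill q
      ≤ ∫⁻ s, (ENNReal.ofReal (R s) + ‖w s‖ₑ) ∂kill q := by
        refine lintegral_mono fun s => ?_
        rw [Real.enorm_eq_ofReal_abs]
        refine (ENNReal.ofReal_le_ofReal ?_).trans ENNReal.ofReal_add_le
        linarith [h.nonneg s, le_abs_self (w s)]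
    _ = ∫⁻ s, ENNReal.ofReal (R s) ∂kill q + ∫⁻ s, ‖w s‖ₑ ∂kill q :=
        lintegral_add_left h.monoR.measurable.ennreal_ofReal _
    _ ≤ _ := by gcongr; exact lintegral_enorm_kill_le hq

end AdmissibleNpv

section PosValues

variable {Ω : Type*} [mΩ : MeasurableSpace Ω] {X : ℝ≥0 → Ω → ℝ} {P : Measure Ω} {a b x q : ℝ}

/-- The expected discounted number of top stages. -/
def meanTop (X : ℝ≥0 → Ω → ℝ) (P : Measure Ω) (q x a : ℝ) : ℝ≥0∞ :=
  ∫⁻ ω, discTop q a (shifted X x ω) ∂P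

/-- The value of the dividends at a positive barrier. -/
def posL (X : ℝ≥0 → Ω → ℝ) (P : Measure Ω) (q x a : ℝ) : ℝ≥0∞ :=
  ∫⁻ ω, npv q (dividendsPos (shifted X x ω) a) ∂P

/-- The value of the injections at a positive barrier. -/
def posR (X : ℝ≥0 → Ω → ℝ) (P : Measure Ω) (q x a : ℝ) : ℝ≥0∞ :=
  ∫⁻ ω, npv q (injectionsPos (shifted X x ω) a) ∂P

lemma IsRegularLevy.cadlag_shifted (hX : IsRegularLevy X P) (x : ℝ) (ω : Ω) :
    IsCadlag (shifted X x ω) := (hX.cadlag ω).const_add x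

lemma crossDisc_le_one (hX : IsRegularLevy X P) (hq : 0 < q) (a x : ℝ) (n : ℕ) :
    crossDisc X P q a x n ≤ 1 := by
  have := hX.isProbabilityMeasure
  calc crossDisc X P q a x n ≤ ∫⁻ _, 1 ∂P := lintegral_mono fun ω => by
        rw [← ENNReal.ofReal_one]; exact ENNReal.ofReal_le_ofReal (discount_le_one hq _)
    _ = 1 := by simp

lemma one_sub_nuE_inv_lt_top (hX : IsRegularLevy X P) (hq : 0 < q) (ha : 0 < a) :
    (1 - nuE X P q a)⁻¹ < ∞ :=
  ENNReal.inv_lt_top.2 (tsub_pos_of_lt (nuE_lt_one hX hq ha))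

lemma meanTop_lt_top (hX : IsRegularLevy X P) (hq : 0 < q) (x : ℝ) (ha : 0 < a) :
    meanTop X P q x a < ∞ :=
  (lintegral_discTop_le hX hq ha.le x).trans_lt (ENNReal.mul_lt_top
    ((crossDisc_le_one hX hq a x 0).trans_lt ENNReal.one_lt_top) (one_sub_nuE_inv_lt_top hX hq ha))

lemma posL_lt_top (hX : IsRegularLevy X P) (hint : Integrable (X 1) P) (hq : 0 < q) (x : ℝ)
    (ha : 0 < a) : posL X P q x a < ∞ := by
  have hk : ∀ k : ℕ, 0 < a + k := fun k => by positivity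
  calc posL X P q x a ≤ ∫⁻ ω, ∑' k : ℕ, discTop q (a + k) (shifted X x ω) ∂P :=
        lintegral_mono fun ω => npv_dividendsPos_le_tsum hq (hX.cadlag_shifted x ω) ha
    _ = ∑' k : ℕ, meanTop X P q x (a + k) :=
        lintegral_tsum fun k => (measurable_discTop hX (hk k).le q x).aemeasurable
    _ ≤ ∑' k : ℕ, crossDisc X P q (a + k) x 0 * (1 - nuE X P q a)⁻¹ := by
        refine ENNReal.tsum_le_tsum fun k => (lintegral_discTop_le hX hq (hk k).le x).trans ?_
        gcongr
        exact nuE_anti hq (by simp)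
    _ = (∫⁻ ω, ∑' k : ℕ, ENNReal.ofReal (discount q (crossTime (a + k) (shifted X x ω) 0)) ∂P) *
          (1 - nuE X P q a)⁻¹ := by
        rw [ENNReal.tsum_mul_right, lintegral_tsum fun k =>
          (measurable_discount_crossTime hX (hk k).le q x 0).aemeasurable]
        rfl
    _ ≤ (∫⁻ ω, discSize q (shifted X x ω) ∂P) * (1 - nuE X P q a)⁻¹ := by
        gcongr with ω
        exact tsum_discount_crossTime_le hq ha
    _ < ∞ := ENNReal.mul_lt_top (lintegral_discSize_lt_top hX hint hq x)
        (one_sub_nuE_inv_lt_top hX hq ha)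

lemma supAbs_shifted_eq (hX : IsRegularLevy X P) (x : ℝ) (t : ℝ≥0) :
    Measurable fun ω => supAbs (shifted X x ω) t := by
  have : (fun ω => supAbs (shifted X x ω) t) =
      fun ω => ratSupAbs t fun r : ℚ≥0 => x + ratPath X ω r := by
    ext ω
    exact supAbs_eq (hX.cadlag_shifted x ω) t
  rw [this]
  exact (measurable_ratSupAbs t).comp
    (measurable_pi_lambda _ fun r => (hX.measurable r).const_add x)

lemma measurable_discSize (hX : IsRegularLevy X P) (q x : ℝ) :
    Measurable fun ω => discSize q (shifted X x ω) :=
  Measurable.tsum fun _ => (((supAbs_shifted_eq hX x _).const_mul _).add_const _).const_mul _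

/-- A bound for the difference between the values of dividends and injections. -/
def sizeBound (X : ℝ≥0 → Ω → ℝ) (P : Measure Ω) (q x : ℝ) : ℝ≥0∞ :=
  ∫⁻ ω, discSize q (shifted X x ω) ∂P

lemma lintegral_injections_le (hX : IsRegularLevy X P) (hq : 0 < q) {L R : Ω → ℝ≥0 → ℝ}
    (h : ∀ᵐ ω ∂P, IsAdmissible (shifted X x ω) (L ω) (R ω) b) :
    ∫⁻ ω, npv q (R ω) ∂P ≤ ∫⁻ ω, npv q (L ω) ∂P + (sizeBound X P q x + ENNReal.ofReal b) := by
  have := hX.isProbabilityMeasure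
  refine (lintegral_mono_ae (h.mono fun ω hω => hω.npv_injections_le hq)).trans_eq ?_
  rw [lintegral_add_right _ ((measurable_discSize hX q x).add_const _),
    lintegral_add_right _ measurable_const, lintegral_const, measure_univ, mul_one]
  rfl

lemma lintegral_dividends_le (hX : IsRegularLevy X P) (hq : 0 < q) {L R : Ω → ℝ≥0 → ℝ}
    (h : ∀ᵐ ω ∂P, IsAdmissible (shifted X x ω) (L ω) (R ω) b) :
    ∫⁻ ω, npv q (L ω) ∂P ≤ ∫⁻ ω, npv q (R ω) ∂P + sizeBound X P q x := by
  refine (lintegral_mono_ae (h.mono fun ω hω => hω.npv_dividends_le hq)).trans_eq ?_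
  rw [lintegral_add_right _ (measurable_discSize hX q x)]
  rfl

lemma isAdmissible_pos_shifted (hX : IsRegularLevy X P) (x : ℝ) (ha : 0 < a) :
    ∀ᵐ ω ∂P, IsAdmissible (shifted X x ω) (dividendsPos (shifted X x ω) a)
      (injectionsPos (shifted X x ω) a) a :=
  Eventually.of_forall fun ω => isAdmissible_pos (hX.cadlag_shifted x ω) ha

lemma posR_lt_top (hX : IsRegularLevy X P) (hint : Integrable (X 1) P) (hq : 0 < q) (x : ℝ)
    (ha : 0 < a) : posR X P q x a < ∞ :=
  (lintegral_injections_le hX hq (isAdmissible_pos_shifted hX x ha)).trans_lt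
    (ENNReal.add_lt_top.2 ⟨posL_lt_top hX hint hq x ha, ENNReal.add_lt_top.2
      ⟨lintegral_discSize_lt_top hX hint hq x, ENNReal.ofReal_lt_top⟩⟩)

lemma toReal_le_add_sub_mul {u v n : ℝ≥0∞} (hu : u ≠ ∞) (hv : v ≠ ∞) (hn : n ≠ ∞)
    (h1 : a ≤ b → u ≤ v + ENNReal.ofReal (b - a) * n)
    (h2 : b ≤ a → u + ENNReal.ofReal (a - b) * n ≤ v) :
    u.toReal ≤ v.toReal + (b - a) * n.toReal := by
  rcases le_total a b with h | h
  · have h3 := h1 h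
    have h4 : ENNReal.ofReal (b - a) * n ≠ ∞ := ENNReal.mul_ne_top (by simp) hn
    rw [← ENNReal.toReal_le_toReal hu (ENNReal.add_ne_top.2 ⟨hv, h4⟩),
      ENNReal.toReal_add hv h4, ENNReal.toReal_mul, ENNReal.toReal_ofReal (sub_nonneg.2 h)] at h3
    exact h3
  · have h3 := h2 h
    have h4 : ENNReal.ofReal (a - b) * n ≠ ∞ := ENNReal.mul_ne_top (by simp) hn
    rw [← ENNReal.toReal_le_toReal (ENNReal.add_ne_top.2 ⟨hu, h4⟩) hv,
      ENNReal.toReal_add hu h4, ENNReal.toReal_mul, ENNReal.toReal_ofReal (sub_nonneg.2 h)] at h3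
    linarith

/-- Comparison of the value of the dividends at `a > 0` with that of a strategy that keeps the
controlled process in `[0, b]`. -/
theorem posL_le (hX : IsRegularLevy X P) (hint : Integrable (X 1) P) (hq : 0 < q) (ha : 0 < a)
    {L R : Ω → ℝ≥0 → ℝ} (h : ∀ᵐ ω ∂P, IsAdmissible (shifted X x ω) (L ω) (R ω) b)
    (hfin : ∫⁻ ω, npv q (L ω) ∂P < ∞) :
    (posL X P q x a).toReal ≤
      (∫⁻ ω, npv q (L ω) ∂P).toReal + (b - a) * (meanTop X P q x a).toReal := by
  have hm := measurable_discTop hX ha.le q x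
  refine toReal_le_add_sub_mul (posL_lt_top hX hint hq x ha).ne hfin.ne
    (meanTop_lt_top hX hq x ha).ne (fun hab => ?_) fun hba => ?_
  · rw [meanTop, ← lintegral_const_mul _ hm, ← lintegral_add_right _ (hm.const_mul _)]
    exact lintegral_mono_ae (h.mono fun ω hω =>
      (npv_pos_le hq (hX.cadlag_shifted x ω) ha hω hab).1)
  · rw [meanTop, posL, ← lintegral_const_mul _ hm, ← lintegral_add_right _ (hm.const_mul _)]
    exact lintegral_mono_ae (h.mono fun ω hω =>
      (npv_pos_add_le hq (hX.cadlag_shifted x ω) ha hω hba).1)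

/-- Comparison of the value of the injections at `a > 0` with that of a strategy that keeps the
controlled process in `[0, b]`. -/
theorem posR_le (hX : IsRegularLevy X P) (hint : Integrable (X 1) P) (hq : 0 < q) (ha : 0 < a)
    {L R : Ω → ℝ≥0 → ℝ} (h : ∀ᵐ ω ∂P, IsAdmissible (shifted X x ω) (L ω) (R ω) b)
    (hfin : ∫⁻ ω, npv q (R ω) ∂P < ∞) :
    (posR X P q x a).toReal ≤ (∫⁻ ω, npv q (R ω) ∂P).toReal +
      (b - a) * ((meanTop X P q x a).toReal * (nuE X P q a).toReal) := by
  have hm := measurable_discBottom hX ha.le q x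
  have e : ∫⁻ ω, discBottom q a (shifted X x ω) ∂P = meanTop X P q x a * nuE X P q a :=
    lintegral_discBottom hX hq ha.le x
  rw [← ENNReal.toReal_mul, ← e]
  refine toReal_le_add_sub_mul (posR_lt_top hX hint hq x ha).ne hfin.ne ?_ (fun hab => ?_)
    fun hba => ?_
  · rw [e]
    exact ENNReal.mul_ne_top (meanTop_lt_top hX hq x ha).ne
      ((nuE_lt_one hX hq ha).trans ENNReal.one_lt_top).ne
  · rw [← lintegral_const_mul _ hm, ← lintegral_add_right _ (hm.const_mul _)]
    exact lintegral_mono_ae (h.mono fun ω hω =>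
      (npv_pos_le hq (hX.cadlag_shifted x ω) ha hω hab).2)
  · rw [posR, ← lintegral_const_mul _ hm, ← lintegral_add_right _ (hm.const_mul _)]
    exact lintegral_mono_ae (h.mono fun ω hω =>
      (npv_pos_add_le hq (hX.cadlag_shifted x ω) ha hω hba).2)

end PosValues

/-! ### Optimization over the positive barriers -/

section RealFunctions

lemma le_of_sub_le_mul_sub {f g : ℝ → ℝ} {a b : ℝ} (hab : a ≤ b)
    (h : ∀ s t, a ≤ s → s ≤ t → t ≤ b → f t - f s ≤ (t - s) * (g t - g s)) : f b ≤ f a := by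
  have key : ∀ m : ℕ, f b - f a ≤ ((b - a) / (m + 1)) * (g b - g a) := fun m => by
    have hm : (0 : ℝ) < m + 1 := by positivity
    set d : ℝ := (b - a) / (m + 1) with hd
    have hd0 : 0 ≤ d := div_nonneg (sub_nonneg.2 hab) hm.le
    have hend : a + ((m + 1 : ℕ) : ℝ) * d = b := by
      rw [hd]; push_cast; field_simp; ring
    have hstep : ∀ i ∈ Finset.range (m + 1),
        f (a + ((i + 1 : ℕ) : ℝ) * d) - f (a + (i : ℝ) * d) ≤
          d * g (a + ((i + 1 : ℕ) : ℝ) * d) - d * g (a + (i : ℝ) * d) := fun i hi => by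
      have hi' : ((i + 1 : ℕ) : ℝ) ≤ ((m + 1 : ℕ) : ℝ) := by
        exact_mod_cast Finset.mem_range.1 hi
      have h1 := h (a + (i : ℝ) * d) (a + ((i + 1 : ℕ) : ℝ) * d)
        (by have : 0 ≤ (i : ℝ) * d := by positivity
            linarith)
        (by push_cast; linarith) (by rw [← hend]; gcongr)
      have e : a + ((i + 1 : ℕ) : ℝ) * d - (a + (i : ℝ) * d) = d := by push_cast; ring
      rw [e] at h1
      linarith
    have hsum := Finset.sum_le_sum hstep
    rw [Finset.sum_range_sub (fun i : ℕ => f (a + (i : ℝ) * d)),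
      Finset.sum_range_sub (fun i : ℕ => d * g (a + (i : ℝ) * d)), hend] at hsum
    simp only [Nat.cast_zero, zero_mul, add_zero] at hsum
    linarith
  have hlim : Tendsto (fun m : ℕ => ((b - a) / ((m : ℝ) + 1)) * (g b - g a)) atTop (𝓝 0) := by
    have h1 := (tendsto_one_div_add_atTop_nhds_zero_nat (𝕜 := ℝ)).const_mul ((b - a) * (g b - g a))
    rw [mul_zero] at h1
    refine h1.congr fun m => ?_
    ring
  linarith [ge_of_tendsto' hlim key]

variable {l r m n ν : ℝ → ℝ} {β : ℝ}

lemma slope_anti (h : ∀ a b, 0 < a → 0 < b → l a ≤ l b + (b - a) * m a) {a b : ℝ} (ha : 0 < a)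
    (hab : a ≤ b) : m b ≤ m a := by
  rcases hab.eq_or_lt with rfl | hlt
  · rfl
  · have h1 := h a b ha (ha.trans hlt)
    have h2 := h b a (ha.trans hlt) ha
    nlinarith

lemma continuousAt_of_slope (h : ∀ a b, 0 < a → 0 < b → l a ≤ l b + (b - a) * m a)
    (hm : ∀ a, 0 < a → 0 ≤ m a) {a : ℝ} (ha : 0 < a) : ContinuousAt l a := by
  have ha2 : 0 < a / 2 := by linarith
  rw [ContinuousAt, tendsto_iff_dist_tendsto_zero]
  have hlim : Tendsto (fun c => |c - a| * m (a / 2)) (𝓝 a) (𝓝 0) := by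
    have : Continuous fun c : ℝ => |c - a| * m (a / 2) := by fun_prop
    simpa using this.tendsto a
  refine squeeze_zero' (Eventually.of_forall fun _ => dist_nonneg) ?_ hlim
  filter_upwards [lt_mem_nhds (show a / 2 < a by linarith)] with c hc
  have hc0 : 0 < c := ha2.trans hc
  have h1 := h a c ha hc0
  have h2 := h c a hc0 ha
  have m1 := slope_anti h ha2 hc.le
  have m2 := slope_anti h ha2 (show a / 2 ≤ a by linarith)
  have m3 := hm c hc0
  have m4 := hm a ha
  rw [Real.dist_eq, abs_le]
  rcases abs_cases (c - a) with ⟨e, he⟩ | ⟨e, he⟩ <;> rw [e] <;> constructor <;> nlinarith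

lemma value_anti_of_le_one
    (hl : ∀ a b, 0 < a → 0 < b → l a ≤ l b + (b - a) * n a)
    (hr : ∀ a b, 0 < a → 0 < b → r a ≤ r b + (b - a) * (n a * ν a))
    (hn : ∀ a, 0 < a → 0 ≤ n a) (hβ : 0 ≤ β)
    {a b : ℝ} (ha : 0 < a) (hab : a ≤ b)
    (h : ∀ c, a ≤ c → c ≤ b → β * ν c ≤ 1) : l b - β * r b ≤ l a - β * r a := by
  refine le_of_sub_le_mul_sub (f := fun c => l c - β * r c) (g := fun c => -n c) hab
    fun s t hs hst ht => ?_
  have hs0 : 0 < s := ha.trans_le hs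
  have h1 := hl t s (hs0.trans_le hst) hs0
  have h2 := mul_le_mul_of_nonneg_left (hr s t hs0 (hs0.trans_le hst)) hβ
  have h3 := mul_le_mul_of_nonneg_right (h s hs (hst.trans ht))
    (mul_nonneg (sub_nonneg.2 hst) (hn s hs0))
  nlinarith

lemma value_mono_of_one_le
    (hl : ∀ a b, 0 < a → 0 < b → l a ≤ l b + (b - a) * n a)
    (hr : ∀ a b, 0 < a → 0 < b → r a ≤ r b + (b - a) * (n a * ν a))
    (hn : ∀ a, 0 < a → 0 ≤ n a) (hβ : 0 ≤ β)
    {a b : ℝ} (ha : 0 < a) (hab : a ≤ b)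
    (h : ∀ c, a ≤ c → c ≤ b → 1 ≤ β * ν c) : l a - β * r a ≤ l b - β * r b := by
  have := le_of_sub_le_mul_sub (f := fun c => -(l c - β * r c)) (g := fun c => -n c) hab
    fun s t hs hst ht => by
      have hs0 : 0 < s := ha.trans_le hs
      have ht0 : 0 < t := hs0.trans_le hst
      have h1 := hl s t hs0 ht0
      have h2 := mul_le_mul_of_nonneg_left (hr t s ht0 hs0) hβ
      have h3 := mul_le_mul_of_nonneg_right (h t (hs.trans hst) ht)
        (mul_nonneg (sub_nonneg.2 hst) (hn t ht0))
      nlinarith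
  linarith

lemma value_le_of_sInf
    (hl : ∀ a b, 0 < a → 0 < b → l a ≤ l b + (b - a) * n a)
    (hr : ∀ a b, 0 < a → 0 < b → r a ≤ r b + (b - a) * (n a * ν a))
    (hn : ∀ a, 0 < a → 0 ≤ n a) (hβ : 0 ≤ β)
    (hν0 : ∀ a, 0 < a → 0 ≤ ν a) (hν : ∀ a b, 0 < a → a ≤ b → ν b ≤ ν a)
    (hne : {a | 0 < a ∧ β * ν a ≤ 1}.Nonempty) (hpos : 0 < sInf {a | 0 < a ∧ β * ν a ≤ 1}) {a : ℝ}
    (ha : 0 < a) : l a - β * r a ≤ l (sInf {a | 0 < a ∧ β * ν a ≤ 1}) -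
      β * r (sInf {a | 0 < a ∧ β * ν a ≤ 1}) := by
  set A := sInf {a | 0 < a ∧ β * ν a ≤ 1} with hA
  have hbdd : BddBelow {a | 0 < a ∧ β * ν a ≤ 1} := ⟨0, fun c hc => hc.1.le⟩
  have hcont : ContinuousAt (fun c => l c - β * r c) A :=
    (continuousAt_of_slope hl hn hpos).sub (continuousAt_const.mul
      (continuousAt_of_slope hr (fun c hc => mul_nonneg (hn c hc) (hν0 c hc)) hpos))
  rcases lt_trichotomy a A with h | rfl | h
  · refine ge_of_tendsto (hcont.tendsto.mono_left (nhdsWithin_le_nhds (s := Iio A))) ?_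
    filter_upwards [Ioo_mem_nhdsLT h] with c hc
    refine value_mono_of_one_le hl hr hn hβ ha hc.1.le fun d hd hdc => ?_
    by_contra! hlt
    exact notMem_of_lt_csInf (hdc.trans_lt hc.2) hbdd ⟨ha.trans_le hd, hlt.le⟩
  · exact le_rfl
  · refine ge_of_tendsto (hcont.tendsto.mono_left (nhdsWithin_le_nhds (s := Ioi A))) ?_
    filter_upwards [Ioo_mem_nhdsGT h] with c hc
    refine value_anti_of_le_one hl hr hn hβ (hpos.trans hc.1) hc.2.le fun d hd _ => ?_
    obtain ⟨e, he, hed⟩ := exists_lt_of_csInf_lt hne (hc.1.trans_le hd)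
    exact (mul_le_mul_of_nonneg_left (hν e d he.1 hed.le) hβ).trans he.2

end RealFunctions

section Barriers

variable {Ω : Type*} [mΩ : MeasurableSpace Ω] {X : ℝ≥0 → Ω → ℝ} {P : Measure Ω} {a x q β : ℝ}

lemma tendsto_nuE (hX : IsRegularLevy X P) (hq : 0 < q) :
    Tendsto (fun n : ℕ => nuE X P q n) atTop (𝓝 0) := by
  have := hX.isProbabilityMeasure
  have h0 : ∫⁻ _, (0 : ℝ≥0∞) ∂P = 0 := by simp
  rw [← h0]
  refine tendsto_lintegral_of_dominated_convergence (fun _ => 1)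
    (fun n => (measurable_ofReal_discount q).comp (measurable_downTime_zero hX n.cast_nonneg))
    (fun n => Eventually.of_forall fun ω => ?_) (by simp) (Eventually.of_forall fun ω => ?_)
  · rw [← ENNReal.ofReal_one]
    exact ENNReal.ofReal_le_ofReal (discount_le_one hq _)
  · have hdisc : ∀ k : ℕ, ∀ᶠ n : ℕ in atTop, discount q (downTime n (fun t => X t ω) 0) ≤
        Real.exp (-q * k) := fun k => by
      obtain ⟨C, hC⟩ := (hX.cadlag ω).exists_bound 0 k
      obtain ⟨N, hN⟩ := exists_nat_gt (2 * C)
      filter_upwards [eventually_ge_atTop N] with n hn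
      have hT : ((k : ℝ≥0) : ℝ≥0∞) ≤ downTime n (fun t => X t ω) 0 := by
        refine le_firstTime_iff.2 fun t ⟨s, _, hst, h⟩ => ?_
        by_contra! hlt
        have htk : t ≤ k := by exact_mod_cast hlt.le
        have h1 := abs_le.1 (hC s ⟨zero_le, hst.trans htk⟩)
        have h2 := abs_le.1 (hC t ⟨zero_le, htk⟩)
        have h3 : (N : ℝ) ≤ n := by exact_mod_cast hn
        linarith
      refine (discount_anti hq hT).trans_eq ?_
      simp [discount]
    have hlim : Tendsto (fun k : ℕ => Real.exp (-q * k)) atTop (𝓝 0) := by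
      refine Real.tendsto_exp_atBot.comp ?_
      exact tendsto_natCast_atTop_atTop.const_mul_atTop_of_neg (by linarith)
    have : Tendsto (fun n : ℕ => discount q (downTime n (fun t => X t ω) 0)) atTop (𝓝 0) := by
      rw [Metric.tendsto_atTop']
      intro ε hε
      obtain ⟨k, hk⟩ := (hlim.eventually (gt_mem_nhds hε)).exists
      obtain ⟨N, hN⟩ := eventually_atTop.1 (hdisc k)
      refine ⟨N, fun n hn => ?_⟩
      rw [Real.dist_eq, sub_zero, abs_of_nonneg (discount_nonneg _ _)]
      exact (hN n hn.le).trans_lt hk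
    simpa using ENNReal.tendsto_ofReal this

lemma nuE_ne_top (hX : IsRegularLevy X P) (hq : 0 < q) (ha : 0 < a) : nuE X P q a ≠ ∞ :=
  ((nuE_lt_one hX hq ha).trans ENNReal.one_lt_top).ne

lemma barrierSet_eq (hX : IsRegularLevy X P) :
    barrierSet X P q β = {a | 0 < a ∧ β * (nuE X P q a).toReal ≤ 1} := by
  ext a
  simp only [barrierSet, mem_ofPred_eq]
  exact and_congr_right fun h => by rw [nu_eq hX h]

lemma barrierSet_nonempty (hX : IsRegularLevy X P) (hq : 0 < q) :
    (barrierSet X P q β).Nonempty := by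
  have h1 : Tendsto (fun n : ℕ => β * (nuE X P q n).toReal) atTop (𝓝 0) := by
    have := ((ENNReal.tendsto_toReal ENNReal.zero_ne_top).comp (tendsto_nuE hX hq)).const_mul β
    simpa using this
  obtain ⟨n, hn, h0⟩ := ((h1.eventually (gt_mem_nhds one_pos)).and (eventually_gt_atTop 0)).exists
  rw [barrierSet_eq hX]
  exact ⟨n, by exact_mod_cast h0, hn.le⟩

lemma posL_slope (hX : IsRegularLevy X P) (hint : Integrable (X 1) P) (hq : 0 < q) (x a b : ℝ)
    (ha : 0 < a) (hb : 0 < b) : (posL X P q x a).toReal ≤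
      (posL X P q x b).toReal + (b - a) * (meanTop X P q x a).toReal :=
  posL_le hX hint hq ha (isAdmissible_pos_shifted hX x hb) (posL_lt_top hX hint hq x hb)

lemma posR_slope (hX : IsRegularLevy X P) (hint : Integrable (X 1) P) (hq : 0 < q) (x a b : ℝ)
    (ha : 0 < a) (hb : 0 < b) : (posR X P q x a).toReal ≤ (posR X P q x b).toReal +
      (b - a) * ((meanTop X P q x a).toReal * (nuE X P q a).toReal) :=
  posR_le hX hint hq ha (isAdmissible_pos_shifted hX x hb) (posR_lt_top hX hint hq x hb)

/-- The value of the double barrier strategy at a positive barrier. -/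
def posValue (X : ℝ≥0 → Ω → ℝ) (P : Measure Ω) (q β x a : ℝ) : ℝ :=
  (posL X P q x a).toReal - β * (posR X P q x a).toReal

theorem posValue_le_aStar (hX : IsRegularLevy X P) (hint : Integrable (X 1) P) (hq : 0 < q)
    (hβ : 0 ≤ β) (hpos : 0 < aStar X P q β) (x : ℝ) (ha : 0 < a) :
    posValue X P q β x a ≤ posValue X P q β x (aStar X P q β) := by
  have hne := barrierSet_nonempty (β := β) hX hq
  rw [aStar, barrierSet_eq hX] at hpos
  rw [barrierSet_eq hX] at hne
  rw [aStar, barrierSet_eq hX]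
  exact value_le_of_sInf (posL_slope hX hint hq x) (posR_slope hX hint hq x)
    (fun _ _ => ENNReal.toReal_nonneg) hβ (fun _ _ => ENNReal.toReal_nonneg)
    (fun c d hc hcd => ENNReal.toReal_mono (nuE_ne_top hX hq hc) (nuE_anti hq hcd)) hne hpos ha

lemma mul_nuE_le_one (hX : IsRegularLevy X P) (hq : 0 < q) (hβ : 0 ≤ β)
    (h0 : aStar X P q β = 0) (ha : 0 < a) : β * (nuE X P q a).toReal ≤ 1 := by
  have hne := barrierSet_nonempty (β := β) hX hq
  obtain ⟨e, he, hea⟩ := exists_lt_of_csInf_lt hne (show sInf (barrierSet X P q β) < a by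
    rw [← aStar, h0]; exact ha)
  rw [barrierSet_eq hX] at he
  exact (mul_le_mul_of_nonneg_left (ENNReal.toReal_mono (nuE_ne_top hX hq he.1)
    (nuE_anti hq hea.le)) hβ).trans he.2

theorem posValue_anti (hX : IsRegularLevy X P) (hint : Integrable (X 1) P) (hq : 0 < q)
    (hβ : 0 ≤ β) (h0 : aStar X P q β = 0) (x : ℝ) {b : ℝ} (ha : 0 < a) (hab : a ≤ b) :
    posValue X P q β x b ≤ posValue X P q β x a :=
  value_anti_of_le_one (posL_slope hX hint hq x) (posR_slope hX hint hq x)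
    (fun _ _ => ENNReal.toReal_nonneg) hβ ha hab
    fun _ hc _ => mul_nuE_le_one hX hq hβ h0 (ha.trans_le hc)

lemma aStar_nonneg (X : ℝ≥0 → Ω → ℝ) (P : Measure Ω) (q β : ℝ) : 0 ≤ aStar X P q β :=
  Real.sInf_nonneg fun _ h => h.1.le

end Barriers

/-! ### Jumps of càdlàg paths -/

section Jumps

variable {w : ℝ≥0 → ℝ}

lemma neBot_nhdsLT {t : ℝ≥0} (ht : 0 < t) : (𝓝[<] t).NeBot :=
  nhdsLT_neBot_of_exists_lt ⟨0, ht⟩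

lemma IsCadlag.tendsto_leftLim (hw : IsCadlag w) (t : ℝ≥0) :
    Tendsto w (𝓝[<] t) (𝓝 (Function.leftLim w t)) := by
  rcases eq_or_ne (𝓝[<] t) ⊥ with h | h
  · rw [h]; exact tendsto_bot
  · have : (𝓝[<] t).NeBot := ⟨h⟩
    obtain ⟨l, hl⟩ := (hw t).2
    rwa [leftLim_eq_of_tendsto hl]

lemma IsCadlag.leftLim_neg (hw : IsCadlag w) (t : ℝ≥0) :
    Function.leftLim (fun s => -w s) t = -Function.leftLim w t := by
  rcases eq_or_ne (𝓝[<] t) ⊥ with h | h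
  · rw [leftLim_eq_of_eq_bot _ h, leftLim_eq_of_eq_bot _ h]
  · have : (𝓝[<] t).NeBot := ⟨h⟩
    exact leftLim_eq_of_tendsto (hw.tendsto_leftLim t).neg

lemma IsCadlag.jump_neg (hw : IsCadlag w) (t : ℝ≥0) : jump (fun s => -w s) t = -jump w t := by
  rw [jump, jump, hw.leftLim_neg]; ring

lemma IsCadlag.jump_const_add (hw : IsCadlag w) (x : ℝ) (t : ℝ≥0) :
    jump (fun s => x + w s) t = jump w t := by
  have : Function.leftLim (fun s => x + w s) t = x + Function.leftLim w t := by
    rcases eq_or_ne (𝓝[<] t) ⊥ with h | h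
    · rw [leftLim_eq_of_eq_bot _ h, leftLim_eq_of_eq_bot _ h]
    · have : (𝓝[<] t).NeBot := ⟨h⟩
      exact leftLim_eq_of_tendsto ((hw.tendsto_leftLim t).const_add x)
  rw [jump, jump, this]; ring

/-- If the increments of the monotone functions `L n` dominate those of approximations of `w`,
they eventually dominate any finite sum of upward jumps of `w`, up to an arbitrary error. -/
lemma eventually_sum_jump_le (hw : IsCadlag w) {L u : ℕ → ℝ≥0 → ℝ} (hL : ∀ n, Monotone (L n))
    (h : ∀ n s t, s ≤ t → u n t - u n s ≤ L n t - L n s)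
    (hu : ∀ t, Tendsto (fun n => u n t) atTop (𝓝 (w t))) {s : ℝ≥0} (F : Finset ℝ≥0) :
    ∀ {t : ℝ≥0}, s ≤ t → (∀ r ∈ F, s < r ∧ r ≤ t) → ∀ {η : ℝ}, 0 < η →
      ∀ᶠ n in atTop, ∑ r ∈ F, max (jump w r) 0 - η ≤ L n t - L n s := by
  induction F using Finset.induction_on_max with
  | empty =>
    intro t hst _ η hη
    exact Eventually.of_forall fun n => by
      have := hL n hst
      simp only [Finset.sum_empty]; linarith
  | insert m F hm ih =>
    intro t hst hF η hη
    have hms := hF m (Finset.mem_insert_self _ _)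
    have : (𝓝[<] m).NeBot := neBot_nhdsLT (bot_le.trans_lt hms.1)
    have hbelow : ∀ᶠ v in 𝓝[<] m, v < m ∧ s < v ∧ ∀ r ∈ F, r < v := by
      have h1 : ∀ᶠ v in 𝓝[<] m, ∀ r ∈ F, r < v :=
        (Finset.eventually_all F).2 fun r hr => nhdsWithin_le_nhds (lt_mem_nhds (hm r hr))
      have h2 : ∀ᶠ v in 𝓝[<] m, s < v := nhdsWithin_le_nhds (lt_mem_nhds hms.1)
      exact eventually_mem_nhdsWithin.and (h2.and h1)
    have hclose := (hw.tendsto_leftLim m).eventually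
      (gt_mem_nhds (show Function.leftLim w m < Function.leftLim w m + η / 4 by linarith))
    obtain ⟨v, ⟨hvm, hsv, hFv⟩, hv⟩ := (hbelow.and hclose).exists
    have h1 := ih hsv.le (fun r hr => ⟨(hF r (Finset.mem_insert_of_mem hr)).1, (hFv r hr).le⟩)
      (half_pos hη)
    have h2 := ((hu m).sub (hu v)).eventually
      (lt_mem_nhds (show w m - w v - η / 4 < w m - w v by linarith))
    filter_upwards [h1, h2] with n e1 e2
    rw [Finset.sum_insert fun hmF => lt_irrefl _ (hm m hmF)]
    have e3 := h n v m hvm.le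
    have e4 := hL n hms.2
    have e5 := hL n hvm.le
    have e6 : max (jump w m) 0 - η / 2 ≤ L n m - L n v := by
      rw [jump]
      rcases max_cases (w m - Function.leftLim w m) 0 with ⟨e, -⟩ | ⟨e, -⟩ <;> rw [e] <;> linarith
    linarith

lemma sum_jump_le (hw : IsCadlag w) {L : ℝ≥0 → ℝ} (hL : Monotone L)
    (h : ∀ s t, s ≤ t → w t - w s ≤ L t - L s) {s t : ℝ≥0} (hst : s ≤ t) {F : Finset ℝ≥0}
    (hF : ∀ r ∈ F, s < r ∧ r ≤ t) : ∑ r ∈ F, max (jump w r) 0 ≤ L t - L s := by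
  refine le_of_forall_pos_le_add fun η hη => ?_
  have := eventually_sum_jump_le (L := fun _ => L) (u := fun _ => w) hw (fun _ => hL) (fun _ => h)
    (fun _ => tendsto_const_nhds) F hst hF hη
  obtain ⟨_, h1⟩ := this.exists
  linarith

lemma exists_dominating (hbv : LocallyBoundedVariationOn w univ) :
    ∃ L : ℝ≥0 → ℝ, Monotone L ∧ ∀ s t, s ≤ t → |w t - w s| ≤ L t - L s := by
  obtain ⟨p, n, hp, hn, rfl⟩ := hbv.exists_monotoneOn_sub_monotoneOn
  rw [monotoneOn_univ] at hp hn
  refine ⟨p + n, hp.add hn, fun s t hst => ?_⟩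
  have h1 := hp hst
  have h2 := hn hst
  simp only [Pi.sub_apply, Pi.add_apply]
  rw [abs_le]; constructor <;> linarith

/-- The sum of `f` over the interval `(s, t]`. -/
def sumIoc (f : ℝ≥0 → ℝ) (s t : ℝ≥0) : ℝ := ∑' r, (Ioc s t).indicator f r

/-- `f` is summable over every bounded interval `(0, t]`. -/
def LocallySummable (f : ℝ≥0 → ℝ) : Prop := ∀ t, Summable ((Ioc 0 t).indicator f)

lemma sumIoc_zero (f : ℝ≥0 → ℝ) (t : ℝ≥0) : sumIoc f 0 t = ∑' s : Ioc (0 : ℝ≥0) t, f s :=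
  (tsum_subtype _ _).symm

lemma LocallySummable.ioc {f : ℝ≥0 → ℝ} (hf : LocallySummable f) (s t : ℝ≥0) :
    Summable ((Ioc s t).indicator f) := by
  have := (hf t).indicator (Ioc s t)
  rwa [indicator_indicator, inter_eq_left.2 (Ioc_subset_Ioc_left zero_le)] at this

lemma LocallySummable.of_abs_le {f g : ℝ≥0 → ℝ} (hg : LocallySummable g) (h : ∀ r, |f r| ≤ g r) :
    LocallySummable f := fun t => by
  refine Summable.of_norm_bounded (hg t) fun r => ?_
  rw [norm_indicator_eq_indicator_norm]
  exact indicator_le_indicator (h r)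

lemma LocallySummable.sumIoc_add {f : ℝ≥0 → ℝ} (hf : LocallySummable f) {s t u : ℝ≥0}
    (hst : s ≤ t) (htu : t ≤ u) : sumIoc f s t + sumIoc f t u = sumIoc f s u := by
  rw [sumIoc, sumIoc, sumIoc, ← (hf.ioc s t).tsum_add (hf.ioc t u), ← Ioc_union_Ioc_eq_Ioc hst htu]
  refine tsum_congr fun r => ?_
  rw [indicator_union_of_disjoint (Ioc_disjoint_Ioc_of_le le_rfl)]

lemma LocallySummable.sumIoc_nonneg {f : ℝ≥0 → ℝ} (h0 : ∀ r, 0 ≤ f r) (s t : ℝ≥0) :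
    0 ≤ sumIoc f s t := tsum_nonneg fun _ => indicator_nonneg (fun r _ => h0 r) _

lemma LocallySummable.sumIoc_sum {f : ℝ≥0 → ℝ} (hf : LocallySummable f) {τ : ℕ → ℝ≥0}
    (hτ : Monotone τ) (n : ℕ) :
    ∑ k ∈ Finset.range n, sumIoc f (τ k) (τ (k + 1)) = sumIoc f (τ 0) (τ n) := by
  induction n with
  | zero => simp [sumIoc]
  | succ n ih =>
    rw [Finset.sum_range_succ, ih, hf.sumIoc_add (hτ n.zero_le) (hτ n.le_succ)]

lemma locallySummable_jump (hw : IsCadlag w) (hbv : LocallyBoundedVariationOn w univ) :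
    LocallySummable fun r => |jump w r| := fun t => by
  obtain ⟨L, hL, h⟩ := exists_dominating hbv
  refine summable_of_sum_le (c := 2 * (L t - L 0))
    (fun r => indicator_nonneg (fun r _ => abs_nonneg _) r) fun F => ?_
  classical
  rw [Finset.sum_indicator_eq_sum_filter]
  have hF : ∀ r ∈ F.filter (fun r => r ∈ Ioc 0 t), 0 < r ∧ r ≤ t := fun r hr =>
    (Finset.mem_filter.1 hr).2
  have h1 := sum_jump_le hw hL (fun s t hst => (le_abs_self _).trans (h s t hst)) zero_le hF
  have h2 := sum_jump_le hw.neg hL (fun s t hst => by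
    have := (neg_le_abs _).trans (h s t hst); linarith) zero_le hF
  calc ∑ r ∈ F.filter (fun r => r ∈ Ioc 0 t), |jump w r|
      = ∑ r ∈ F.filter (fun r => r ∈ Ioc 0 t), max (jump w r) 0 +
        ∑ r ∈ F.filter (fun r => r ∈ Ioc 0 t), max (jump (fun s => -w s) r) 0 := by
        rw [← Finset.sum_add_distrib]
        refine Finset.sum_congr rfl fun r _ => ?_
        rw [hw.jump_neg]
        rcases le_total 0 (jump w r) with h | h
        · rw [abs_of_nonneg h, max_eq_left h, max_eq_right (by linarith), add_zero]
        · rw [abs_of_nonpos h, max_eq_right h, max_eq_left (by linarith), zero_add]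
    _ ≤ _ := by linarith

/-- The continuous part of a path. -/
def contPart (w : ℝ≥0 → ℝ) (t : ℝ≥0) : ℝ := w t - sumIoc (jump w) 0 t

lemma tendsto_sumIoc {f : ℝ≥0 → ℝ} (hf : LocallySummable fun r => |f r|) {t : ℝ≥0}
    {l : Filter ℝ≥0} (hl : l ≤ 𝓝 t) {S : Set ℝ≥0}
    (h : ∀ r, ∀ᶠ v in l, (r ∈ Ioc 0 v ↔ r ∈ S)) :
    Tendsto (fun v => sumIoc f 0 v) l (𝓝 (∑' r, S.indicator f r)) := by
  refine tendsto_tsum_of_dominated_convergence (hf (t + 1)) (fun r => ?_) ?_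
  · refine tendsto_const_nhds.congr' ((h r).mono fun v hv => ?_)
    by_cases hr : r ∈ S
    · simp only [indicator_of_mem hr, indicator_of_mem (hv.2 hr)]
    · simp only [indicator_of_notMem hr, indicator_of_notMem fun h' => hr (hv.1 h')]
  · filter_upwards [hl (gt_mem_nhds (show t < t + 1 by simp))] with v hv r
    rw [norm_indicator_eq_indicator_norm]
    exact indicator_le_indicator_of_subset (Ioc_subset_Ioc_right (le_of_lt hv))
      (fun _ => norm_nonneg _) r

lemma continuous_contPart (hw : IsCadlag w) (hs : LocallySummable fun r => |jump w r|) :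
    Continuous (contPart w) := by
  have hs' : LocallySummable (jump w) := hs.of_abs_le fun r => le_rfl
  refine continuous_iff_continuousAt.2 fun t => ?_
  rw [continuousAt_iff_continuous_left'_right']
  constructor
  · have h1 := tendsto_sumIoc (S := Ioo 0 t) hs (l := 𝓝[<] t) nhdsWithin_le_nhds fun r => by
      rcases lt_or_ge r t with h | h
      · filter_upwards [nhdsWithin_le_nhds (lt_mem_nhds h)] with v hv
        exact ⟨fun h' => ⟨h'.1, h⟩, fun h' => ⟨h'.1, le_of_lt hv⟩⟩
      · filter_upwards [self_mem_nhdsWithin] with v hv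
        exact ⟨fun h' => absurd (h'.2.trans_lt hv) h.not_gt, fun h' => absurd h'.2 h.not_gt⟩
    have h2 := (hw.tendsto_leftLim t).sub h1
    rcases eq_or_ne t 0 with rfl | ht
    · rw [ContinuousWithinAt, show Iio (0 : ℝ≥0) = ∅ from by ext; simp, nhdsWithin_empty]
      exact tendsto_bot
    have e : ∑' r, (Ioo 0 t).indicator (jump w) r = sumIoc (jump w) 0 t - jump w t := by
      have : (Ioc 0 t).indicator (jump w) =
          fun r => (Ioo 0 t).indicator (jump w) r + ({t} : Set ℝ≥0).indicator (jump w) r := by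
        rw [← Ioo_union_right (pos_iff_ne_zero.2 ht)]
        ext r
        rw [indicator_union_of_disjoint (by simp)]
      have h3 : Summable ((Ioo 0 t).indicator (jump w)) := by
        have := (hs' t).indicator (Ioo 0 t)
        rwa [indicator_indicator, inter_eq_left.2 Ioo_subset_Ioc_self] at this
      have h4 : HasSum (({t} : Set ℝ≥0).indicator (jump w)) (jump w t) := by
        have := hasSum_ite_eq t (jump w t)
        convert this using 2 with r
        by_cases hr : r = t <;> simp [hr]
      rw [sumIoc, this, h3.tsum_add h4.summable, h4.tsum_eq]; ring
    have e' : contPart w t = Function.leftLim w t - ∑' r, (Ioo 0 t).indicator (jump w) r := by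
      rw [contPart, e, jump]; ring
    rw [ContinuousWithinAt, e']
    exact h2
  · have h1 := tendsto_sumIoc (S := Ioc 0 t) hs (l := 𝓝[>] t) nhdsWithin_le_nhds fun r => by
      rcases le_or_gt r t with h | h
      · filter_upwards [self_mem_nhdsWithin] with v hv
        exact ⟨fun h' => ⟨h'.1, h⟩, fun h' => ⟨h'.1, h.trans (le_of_lt hv)⟩⟩
      · filter_upwards [nhdsWithin_le_nhds (gt_mem_nhds h)] with v hv
        exact ⟨fun h' => absurd (h'.2.trans_lt hv) (lt_irrefl _),
          fun h' => absurd h'.2 h.not_ge⟩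
    exact ((hw t).1.mono Ioi_subset_Ici_self).tendsto.sub h1

/-- Truncation of a real number to `[-ε, ε]`. -/
def clamp (ε x : ℝ) : ℝ := max (-ε) (min ε x)

lemma abs_clamp_add_sub_le {ε z j : ℝ} (hz : |z| ≤ ε) : |clamp ε (z + j) - z| ≤ min |j| (2 * ε) := by
  obtain ⟨h1, h2⟩ := abs_le.1 hz
  rw [le_min_iff, abs_le, abs_le, clamp]
  rcases le_total 0 j with h | h
  · rw [abs_of_nonneg h]
    rcases min_cases ε (z + j) with ⟨e, _⟩ | ⟨e, _⟩ <;> rw [e] <;>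
    [rcases max_cases (-ε) ε with ⟨e', _⟩ | ⟨e', _⟩;
      rcases max_cases (-ε) (z + j) with ⟨e', _⟩ | ⟨e', _⟩] <;>
      rw [e'] <;> refine ⟨⟨?_, ?_⟩, ?_, ?_⟩ <;> linarith
  · rw [abs_of_nonpos h]
    rcases min_cases ε (z + j) with ⟨e, _⟩ | ⟨e, _⟩ <;> rw [e] <;>
    [rcases max_cases (-ε) ε with ⟨e', _⟩ | ⟨e', _⟩;
      rcases max_cases (-ε) (z + j) with ⟨e', _⟩ | ⟨e', _⟩] <;>
      rw [e'] <;> refine ⟨⟨?_, ?_⟩, ?_, ?_⟩ <;> linarith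

lemma min_abs_sumIoc_le {f : ℝ≥0 → ℝ} (hf : LocallySummable fun r => |f r|) {c : ℝ} (hc : 0 ≤ c)
    (s t : ℝ≥0) : min |sumIoc f s t| c ≤ sumIoc (fun r => min |f r| c) s t := by
  have h0 : ∀ r, 0 ≤ min |f r| c := fun r => le_min (abs_nonneg _) hc
  have hmin : LocallySummable fun r => min |f r| c := hf.of_abs_le fun r => by
    rw [abs_of_nonneg (h0 r)]; exact min_le_left _ _
  by_cases h : ∃ r ∈ Ioc s t, c ≤ |f r|
  · obtain ⟨r, hr, hcr⟩ := h
    refine (min_le_right _ _).trans ?_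
    have := (hmin.ioc s t).le_tsum r fun r' _ => indicator_nonneg (fun r _ => h0 r) r'
    rwa [indicator_of_mem hr, min_eq_right hcr] at this
  · push Not at h
    refine (min_le_left _ _).trans ?_
    have e : (Ioc s t).indicator (fun r => min |f r| c) = fun r => |(Ioc s t).indicator f r| := by
      ext r
      by_cases hr : r ∈ Ioc s t
      · rw [indicator_of_mem hr, indicator_of_mem hr, min_eq_left (h r hr).le]
      · rw [indicator_of_notMem hr, indicator_of_notMem hr, abs_zero]
    rw [sumIoc, sumIoc, e]
    have : Summable fun r => ‖(Ioc s t).indicator f r‖ := by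
      have := hmin.ioc s t
      rwa [e] at this
    exact norm_tsum_le_tsum_norm this

/-- The points of the regular grid with `n` cells on `[u, u + t]`. -/
def grid (u t : ℝ≥0) (n k : ℕ) : ℝ≥0 := u + t * (k / n)

lemma grid_mono (u t : ℝ≥0) (n : ℕ) : Monotone (grid u t n) := fun k l h => by
  unfold grid; gcongr

lemma grid_zero (u t : ℝ≥0) (n : ℕ) : grid u t n 0 = u := by simp [grid]

lemma grid_self (u t : ℝ≥0) {n : ℕ} (hn : n ≠ 0) : grid u t n n = u + t := by
  have : (n : ℝ≥0) ≠ 0 := Nat.cast_ne_zero.2 hn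
  simp [grid, this]

lemma grid_succ (u t : ℝ≥0) (n k : ℕ) : grid u t n (k + 1) = grid u t n k + t / n := by
  unfold grid; push_cast; ring

/-- The sum of the truncated increments along a grid. -/
def clampSum (w : ℝ≥0 → ℝ) (ε : ℝ) (u t : ℝ≥0) (n : ℕ) : ℝ :=
  ∑ k ∈ Finset.range n, clamp ε (w (grid u t n (k + 1)) - w (grid u t n k))

lemma eventually_clampSum_sub_le (hw : IsCadlag w) (hs : LocallySummable fun r => |jump w r|)
    {ε : ℝ} (hε : 0 < ε) (u t : ℝ≥0) :
    ∀ᶠ n in atTop, |clampSum w ε u t n - (contPart w (u + t) - contPart w u)| ≤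
      sumIoc (fun r => min |jump w r| (2 * ε)) u (u + t) := by
  have hs' : LocallySummable (jump w) := hs.of_abs_le fun r => le_rfl
  have hmin : LocallySummable fun r => min |jump w r| (2 * ε) := hs.of_abs_le fun r => by
    rw [abs_of_nonneg (le_min (abs_nonneg _) (by linarith))]; exact min_le_left _ _
  have huc := isCompact_Icc.uniformContinuousOn_of_continuous (s := Icc u (u + t))
    (continuous_contPart hw hs).continuousOn
  obtain ⟨δ, hδ, hδ'⟩ := Metric.uniformContinuousOn_iff_le.1 huc ε hε
  have hlim : Tendsto (fun n : ℕ => (t : ℝ) / n) atTop (𝓝 0) :=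
    tendsto_const_div_atTop_nhds_zero_nat _
  filter_upwards [hlim.eventually (gt_mem_nhds hδ), eventually_ne_atTop 0] with n hn hn0
  have hmem : ∀ k ≤ n, grid u t n k ∈ Icc u (u + t) := fun k hk => by
    refine ⟨by rw [grid]; exact le_self_add, ?_⟩
    rw [← grid_self u t hn0]; exact grid_mono u t n hk
  have hcont : contPart w (u + t) - contPart w u = ∑ k ∈ Finset.range n,
      (contPart w (grid u t n (k + 1)) - contPart w (grid u t n k)) := by
    rw [Finset.sum_range_sub (fun k => contPart w (grid u t n k)), grid_zero, grid_self u t hn0]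
  rw [clampSum, hcont, ← Finset.sum_sub_distrib]
  have hsum := hmin.sumIoc_sum (grid_mono u t n) n
  rw [grid_zero, grid_self u t hn0] at hsum
  rw [← hsum]
  refine (Finset.abs_sum_le_sum_abs _ _).trans (Finset.sum_le_sum fun k hk => ?_)
  have hk' := Finset.mem_range.1 hk
  have hz : |contPart w (grid u t n (k + 1)) - contPart w (grid u t n k)| ≤ ε := by
    refine hδ' _ (hmem _ hk') _ (hmem _ hk'.le) ?_
    rw [grid_succ, NNReal.dist_eq]
    push_cast
    rw [add_sub_cancel_left, abs_of_nonneg (by positivity)]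
    exact hn.le
  have hadd := hs'.sumIoc_add (zero_le (a := grid u t n k)) (grid_mono u t n k.le_succ)
  have he : w (grid u t n (k + 1)) - w (grid u t n k) =
      (contPart w (grid u t n (k + 1)) - contPart w (grid u t n k)) +
        sumIoc (jump w) (grid u t n k) (grid u t n (k + 1)) := by
    simp only [contPart]; linarith
  rw [he]
  exact (abs_clamp_add_sub_le hz).trans (min_abs_sumIoc_le hs (by linarith) _ _)

lemma tendsto_sumIoc_min (hs : LocallySummable fun r => |jump w r|) {ε : ℕ → ℝ}
    (hε : ∀ m, 0 ≤ ε m) (hlim : Tendsto ε atTop (𝓝 0)) (u t : ℝ≥0) :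
    Tendsto (fun m => sumIoc (fun r => min |jump w r| (2 * ε m)) u t) atTop (𝓝 0) := by
  have h0 : ∑' r, (Ioc u t).indicator (0 : ℝ≥0 → ℝ) r = 0 := by simp
  rw [← h0]
  refine tendsto_tsum_of_dominated_convergence (hs.ioc u t) (fun r => ?_)
    (Eventually.of_forall fun m r => ?_)
  · by_cases hr : r ∈ Ioc u t
    · simp only [indicator_of_mem hr, Pi.zero_apply]
      have h1 : Tendsto (fun m => 2 * ε m) atTop (𝓝 0) := by simpa using hlim.const_mul 2
      refine squeeze_zero (fun m => le_min (abs_nonneg _) (by linarith [hε m]))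
        (fun m => min_le_right _ _) h1
    · simp [indicator_of_notMem hr]
  · rw [norm_indicator_eq_indicator_norm]
    refine indicator_le_indicator ?_
    rw [Real.norm_of_nonneg (le_min (abs_nonneg _) (by linarith [hε m]))]
    exact min_le_left _ _

end Jumps

/-! ### The drift of a Lévy process of bounded variation -/

section Increments

variable {Ω : Type*} [mΩ : MeasurableSpace Ω] {X : ℝ≥0 → Ω → ℝ} {P : Measure Ω}

/-- The increment of the process over a cell of the grid. -/
def cellIncr (X : ℝ≥0 → Ω → ℝ) (u t : ℝ≥0) (n k : ℕ) (ω : Ω) : ℝ :=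
  X (grid u t n (k + 1)) ω - X (grid u t n k) ω

lemma measurable_cellIncr (hX : IsRegularLevy X P) (u t : ℝ≥0) (n k : ℕ) :
    Measurable (cellIncr X u t n k) := hX.measurable_sub _ _

lemma identDistrib_cellIncr (hX : IsRegularLevy X P) (u t : ℝ≥0) (n k : ℕ) :
    IdentDistrib (cellIncr X u t n k) (X (t / n)) P P := by
  have := hX.stationary (grid u t n k) (t / n)
  rwa [← grid_succ] at this

lemma iIndepFun_cellIncr (hX : IsRegularLevy X P) (u t : ℝ≥0) (n : ℕ) :
    iIndepFun (cellIncr X u t n) P := hX.indep.nat (grid_mono u t n)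

lemma half_min_le_one_sub_exp {y : ℝ} (hy : 0 ≤ y) : min y 1 ≤ 2 * (1 - Real.exp (-y)) := by
  have h1 : Real.exp (-y) ≤ (1 + y)⁻¹ := by
    rw [Real.exp_neg]
    exact inv_anti₀ (by linarith) (by linarith [Real.add_one_le_exp y])
  have h2 : min y 1 ≤ 2 * (1 - (1 + y)⁻¹) := by
    have e : 1 - (1 + y)⁻¹ = y / (1 + y) := by field_simp; ring
    rw [e, ← mul_div_assoc, le_div_iff₀ (by linarith)]
    rcases le_total y 1 with h | h
    · rw [min_eq_left h]; nlinarith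
    · rw [min_eq_right h]; linarith
  linarith

lemma integrable_of_mem_Icc [IsFiniteMeasure P] {f : Ω → ℝ} (hf : Measurable f) {C : ℝ}
    (h : ∀ ω, |f ω| ≤ C) : Integrable f P :=
  Integrable.of_bound hf.aestronglyMeasurable C (Eventually.of_forall h)

/-- For a process with bounded variation paths the truncated absolute moments of the increments
are of the order of the length of the time interval. -/
lemma exists_mul_integral_min_le (hX : IsRegularLevy X P) (hbv : HasBVPaths X P) (t : ℝ≥0) :
    ∃ C : ℝ, 0 ≤ C ∧ ∀ n : ℕ, n * ∫ ω, min |X (t / n) ω| 1 ∂P ≤ C := by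
  have := hX.isProbabilityMeasure
  set V : ℕ → Ω → ℝ := fun n ω => ∑ k ∈ Finset.range n, |cellIncr X 0 t n k ω| with hV
  set S : Ω → ℝ≥0∞ := fun ω => ⨆ n, ENNReal.ofReal (V n ω) with hS
  have hVm : ∀ n, Measurable (V n) := fun n =>
    Finset.measurable_fun_sum _ fun k _ => (measurable_cellIncr hX 0 t n k).abs
  have hSm : Measurable S := Measurable.iSup fun n => (hVm n).ennreal_ofReal
  have hSfin : ∀ᵐ ω ∂P, S ω ≠ ∞ := by
    filter_upwards [hbv] with ω hω
    obtain ⟨L, hL, h⟩ := exists_dominating hω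
    refine ne_top_of_le_ne_top (ENNReal.ofReal_ne_top (r := L t - L 0))
      (iSup_le fun n => ENNReal.ofReal_le_ofReal ?_)
    rcases Nat.eq_zero_or_pos n with rfl | hn
    · simpa [hV] using hL zero_le
    · calc V n ω ≤ ∑ k ∈ Finset.range n, (L (grid 0 t n (k + 1)) - L (grid 0 t n k)) :=
            Finset.sum_le_sum fun k _ => h _ _ (grid_mono 0 t n k.le_succ)
        _ = _ := by
            rw [Finset.sum_range_sub (fun k => L (grid 0 t n k)), grid_zero, grid_self 0 t hn.ne',
              zero_add]
  set ρ : ℝ := ∫ ω, discount 1 (S ω) ∂P with hρ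
  have hdm : Measurable fun ω => discount 1 (S ω) := (measurable_discount 1).comp hSm
  have hdi : Integrable (fun ω => discount 1 (S ω)) P := integrable_of_mem_Icc hdm fun ω => by
    rw [abs_of_nonneg (discount_nonneg _ _)]; exact discount_le_one one_pos _
  have hρ0 : 0 < ρ := by
    refine (integral_nonneg fun ω => discount_nonneg _ _).lt_of_ne fun h => ?_
    have h1 := (integral_eq_zero_iff_of_nonneg (fun ω => discount_nonneg _ _) hdi).1 h.symm
    obtain ⟨ω, h2, h3⟩ := (h1.and hSfin).exists
    simp [discount, h3, (Real.exp_pos _).ne'] at h2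
  refine ⟨2 * max (-Real.log ρ) 0, by positivity, fun n => ?_⟩
  have hi1 : Integrable (fun ω => Real.exp (-|X (t / n) ω|)) P :=
    integrable_of_mem_Icc (hX.measurable _).abs.neg.exp (C := 1) fun ω => by
      rw [abs_of_pos (Real.exp_pos _), Real.exp_le_one_iff]; simp
  set p : ℝ := ∫ ω, Real.exp (-|X (t / n) ω|) ∂P with hp
  have hpn : ρ ≤ p ^ n := by
    have h1 := ((iIndepFun_cellIncr hX 0 t n).comp (fun _ => fun y : ℝ => |y|)
      (fun _ => measurable_norm)).mgf_sum (t := -1)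
      (fun k => (measurable_cellIncr hX 0 t n k).abs) (Finset.range n)
    have h2 : ∀ k ∈ Finset.range n,
        mgf ((fun y : ℝ => |y|) ∘ cellIncr X 0 t n k) P (-1) = p := fun k _ => by
      have := ((identDistrib_cellIncr hX 0 t n k).comp
        (u := fun y : ℝ => Real.exp (-|y|)) (by fun_prop)).integral_eq
      simp only [mgf, Function.comp_apply, neg_one_mul]
      exact this
    rw [Finset.prod_congr rfl h2, Finset.prod_const, Finset.card_range] at h1
    rw [← h1, mgf, hρ]
    refine integral_mono hdi ?_ fun ω => ?_
    · refine integrable_of_mem_Icc (C := 1) ?_ fun ω => ?_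
      · refine (Measurable.const_mul ?_ _).exp
        rw [Finset.sum_fn]
        exact Finset.measurable_sum _ fun k _ => (measurable_cellIncr hX 0 t n k).abs
      · rw [abs_of_pos (Real.exp_pos _), Real.exp_le_one_iff, neg_one_mul, neg_nonpos,
          Finset.sum_apply]
        exact Finset.sum_nonneg fun _ _ => abs_nonneg _
    · have h3 : ENNReal.ofReal (V n ω) ≤ S ω :=
        le_iSup (fun n => ENNReal.ofReal (V n ω)) n
      refine (discount_anti one_pos h3).trans_eq ?_
      rw [discount, if_neg ENNReal.ofReal_ne_top,
        ENNReal.toReal_ofReal (Finset.sum_nonneg fun _ _ => abs_nonneg _), Finset.sum_apply]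
      rfl
  have hp0 : 0 ≤ p := integral_nonneg fun ω => (Real.exp_pos _).le
  have hlog : n * (1 - p) ≤ -Real.log ρ := by
    have h1 : p ≤ Real.exp (p - 1) := by linarith [Real.add_one_le_exp (p - 1)]
    have h2 : ρ ≤ Real.exp (n * (p - 1)) := by
      rw [Real.exp_nat_mul]
      exact hpn.trans (pow_le_pow_left₀ hp0 h1 n)
    have h3 := (Real.log_le_log hρ0 h2).trans_eq (Real.log_exp _)
    linarith
  have hmin : ∫ ω, min |X (t / n) ω| 1 ∂P ≤ 2 * (1 - p) := by
    calc ∫ ω, min |X (t / n) ω| 1 ∂P ≤ ∫ ω, 2 * (1 - Real.exp (-|X (t / n) ω|)) ∂P := by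
          refine integral_mono (integrable_of_mem_Icc (C := 1)
            ((hX.measurable _).abs.min measurable_const) fun ω => ?_)
            (((integrable_const _).sub hi1).const_mul _)
            fun ω => half_min_le_one_sub_exp (abs_nonneg _)
          rw [abs_of_nonneg (le_min (abs_nonneg _) zero_le_one)]
          exact min_le_right _ _
      _ = _ := by
          rw [integral_const_mul, integral_sub (integrable_const _) hi1, integral_const]
          simp [hp]
  calc n * ∫ ω, min |X (t / n) ω| 1 ∂P ≤ n * (2 * (1 - p)) := by gcongr
    _ = 2 * (n * (1 - p)) := by ring
    _ ≤ _ := by gcongr; exact hlog.trans (le_max_left _ _)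

lemma measurable_clamp (ε : ℝ) : Measurable (clamp ε) := by unfold clamp; fun_prop

lemma abs_clamp_le {ε : ℝ} (hε : 0 ≤ ε) (y : ℝ) : |clamp ε y| ≤ min ε |y| := by
  rw [clamp, le_min_iff, abs_le, abs_le]
  have h1 := le_abs_self y
  have h2 := neg_abs_le y
  refine ⟨⟨le_max_left _ _, max_le (by linarith) (min_le_left _ _)⟩, ?_, ?_⟩
  · rcases le_total ε y with h | h
    · rw [min_eq_left h]
      exact le_max_of_le_right (by linarith [abs_nonneg y])
    · rw [min_eq_right h]
      exact le_max_of_le_right h2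
  · exact max_le (by linarith [abs_nonneg y]) ((min_le_right _ _).trans h1)

lemma clampSum_eq (X : ℝ≥0 → Ω → ℝ) (ε : ℝ) (u t : ℝ≥0) (n : ℕ) :
    (fun ω => clampSum (fun s => X s ω) ε u t n) =
      ∑ k ∈ Finset.range n, clamp ε ∘ cellIncr X u t n k := by
  ext ω; simp only [clampSum, Finset.sum_apply, Function.comp_apply, cellIncr]

lemma measurable_clampSum (hX : IsRegularLevy X P) (ε : ℝ) (u t : ℝ≥0) (n : ℕ) :
    Measurable fun ω => clampSum (fun s => X s ω) ε u t n := by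
  rw [clampSum_eq, Finset.sum_fn]
  exact Finset.measurable_sum _ fun k _ => (measurable_clamp ε).comp (measurable_cellIncr hX u t n k)

lemma memLp_clamp (hX : IsRegularLevy X P) {ε : ℝ} (hε : 0 ≤ ε) (u t : ℝ≥0) (n k : ℕ) :
    MemLp (clamp ε ∘ cellIncr X u t n k) 2 P := by
  have := hX.isProbabilityMeasure
  refine MemLp.of_bound ((measurable_clamp ε).comp
    (measurable_cellIncr hX u t n k)).aestronglyMeasurable ε (Eventually.of_forall fun ω => ?_)
  exact (abs_clamp_le hε _).trans (min_le_left _ _)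

lemma integral_clampSum (hX : IsRegularLevy X P) {ε : ℝ} (hε : 0 ≤ ε) (u t : ℝ≥0) (n : ℕ) :
    ∫ ω, clampSum (fun s => X s ω) ε u t n ∂P = n * ∫ ω, clamp ε (X (t / n) ω) ∂P := by
  have := hX.isProbabilityMeasure
  rw [clampSum_eq, Finset.sum_fn, integral_finsetSum _ fun k _ => (memLp_clamp hX hε u t n k).integrable one_le_two]
  have : ∀ k ∈ Finset.range n, ∫ ω, (clamp ε ∘ cellIncr X u t n k) ω ∂P =
      ∫ ω, clamp ε (X (t / n) ω) ∂P := fun k _ =>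
    ((identDistrib_cellIncr hX u t n k).comp (measurable_clamp ε)).integral_eq
  rw [Finset.sum_congr rfl this]
  simp

lemma variance_clampSum_le (hX : IsRegularLevy X P) {t : ℝ≥0} {C : ℝ}
    (hC : ∀ n : ℕ, n * ∫ ω, min |X (t / n) ω| 1 ∂P ≤ C) {ε : ℝ} (hε : 0 ≤ ε) (hε1 : ε ≤ 1)
    (u : ℝ≥0) (n : ℕ) :
    variance (fun ω => clampSum (fun s => X s ω) ε u t n) P ≤ ε * C := by
  have := hX.isProbabilityMeasure
  have hind := (iIndepFun_cellIncr hX u t n).comp (fun _ => clamp ε) fun _ => measurable_clamp ε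
  rw [clampSum_eq, IndepFun.variance_sum (fun k _ => memLp_clamp hX hε u t n k)
    fun i _ j _ hij => hind.indepFun hij]
  have h1 : ∀ k ∈ Finset.range n, variance (clamp ε ∘ cellIncr X u t n k) P =
      variance (clamp ε ∘ X (t / n)) P := fun k _ =>
    ((identDistrib_cellIncr hX u t n k).comp (measurable_clamp ε)).variance_eq
  have hm : Measurable (clamp ε ∘ X (t / n)) := (measurable_clamp ε).comp (hX.measurable _)
  have hi : Integrable (fun ω => min |X (t / n) ω| 1) P :=
    integrable_of_mem_Icc (C := 1) ((hX.measurable _).abs.min measurable_const) fun ω => by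
      rw [abs_of_nonneg (le_min (abs_nonneg _) zero_le_one)]
      exact min_le_right _ _
  have h2 : variance (clamp ε ∘ X (t / n)) P ≤ ε * ∫ ω, min |X (t / n) ω| 1 ∂P := by
    refine (variance_le_expectation_sq hm.aestronglyMeasurable).trans ?_
    rw [← integral_const_mul]
    have hb : ∀ ω, (clamp ε ∘ X (t / n)) ω ^ 2 ≤ ε * min |X (t / n) ω| 1 := fun ω => by
      have h3 := abs_clamp_le hε (X (t / n) ω)
      have h4 := h3.trans (min_le_left _ _)
      have h5 : |clamp ε (X (t / n) ω)| ≤ min |X (t / n) ω| 1 :=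
        le_min (h3.trans (min_le_right _ _)) (h4.trans hε1)
      rw [Function.comp_apply, ← sq_abs, sq]
      exact mul_le_mul h4 h5 (abs_nonneg _) hε
    refine integral_mono ?_ (hi.const_mul _) hb
    refine integrable_of_mem_Icc (C := ε) (hm.pow_const 2) fun ω => ?_
    rw [Pi.pow_apply, abs_of_nonneg (sq_nonneg _)]
    exact (hb ω).trans (mul_le_of_le_one_right hε (min_le_right _ _))
  rw [Finset.sum_congr rfl h1, Finset.sum_const, Finset.card_range, nsmul_eq_mul]
  calc (n : ℝ) * variance (clamp ε ∘ X (t / n)) P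
      ≤ n * (ε * ∫ ω, min |X (t / n) ω| 1 ∂P) := by gcongr
    _ = ε * (n * ∫ ω, min |X (t / n) ω| 1 ∂P) := by ring
    _ ≤ _ := by gcongr; exact hC n

lemma enorm_sub_sq_le (a b m : ℝ) : ‖a - b‖ₑ ^ 2 ≤ 2 * (‖a - m‖ₑ ^ 2 + ‖b - m‖ₑ ^ 2) := by
  simp only [Real.enorm_eq_ofReal_abs, ← ENNReal.ofReal_pow (abs_nonneg _), sq_abs]
  rw [← ENNReal.ofReal_add (sq_nonneg _) (sq_nonneg _),
    show (2 : ℝ≥0∞) = ENNReal.ofReal 2 by simp, ← ENNReal.ofReal_mul (by norm_num)]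
  exact ENNReal.ofReal_le_ofReal (by nlinarith [sq_nonneg (a - m + (b - m))])

lemma lintegral_clampSum_sub_sq_le (hX : IsRegularLevy X P) {t : ℝ≥0} {C : ℝ}
    (hC : ∀ n : ℕ, n * ∫ ω, min |X (t / n) ω| 1 ∂P ≤ C) {ε : ℝ} (hε : 0 ≤ ε) (hε1 : ε ≤ 1)
    (u : ℝ≥0) (n : ℕ) :
    ∫⁻ z : Ω × Ω, ‖clampSum (fun s => X s z.1) ε u t n -
      clampSum (fun s => X s z.2) ε 0 t n‖ₑ ^ 2 ∂(P.prod P) ≤ 4 * ENNReal.ofReal (ε * C) := by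
  have := hX.isProbabilityMeasure
  set m : ℝ := n * ∫ ω, clamp ε (X (t / n) ω) ∂P with hm
  have hev : ∀ v, ∫⁻ ω, ‖clampSum (fun s => X s ω) ε v t n - m‖ₑ ^ 2 ∂P ≤
      ENNReal.ofReal (ε * C) := fun v => by
    rw [hm, ← integral_clampSum hX hε v t n]
    have h1 : MemLp (fun ω => clampSum (fun s => X s ω) ε v t n) 2 P := by
      rw [clampSum_eq]
      exact memLp_finsetSum' _ fun k _ => memLp_clamp hX hε v t n k
    have h2 := ofReal_variance h1
    rw [evariance] at h2
    rw [← h2]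
    exact ENNReal.ofReal_le_ofReal (variance_clampSum_le hX hC hε hε1 v n)
  have hmeas : ∀ v, Measurable fun ω => ‖clampSum (fun s => X s ω) ε v t n - m‖ₑ ^ 2 := fun v =>
    ((measurable_clampSum hX ε v t n).sub_const m).enorm.pow_const 2
  calc _ ≤ ∫⁻ z : Ω × Ω, 2 * (‖clampSum (fun s => X s z.1) ε u t n - m‖ₑ ^ 2 +
        ‖clampSum (fun s => X s z.2) ε 0 t n - m‖ₑ ^ 2) ∂(P.prod P) :=
        lintegral_mono fun z => enorm_sub_sq_le _ _ m
    _ = 2 * (∫⁻ ω, ‖clampSum (fun s => X s ω) ε u t n - m‖ₑ ^ 2 ∂P +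
        ∫⁻ ω, ‖clampSum (fun s => X s ω) ε 0 t n - m‖ₑ ^ 2 ∂P) := by
        rw [lintegral_const_mul' _ _ (by simp), lintegral_add_left (f := fun z : Ω × Ω => ‖clampSum (fun s => X s z.1) ε u t n - m‖ₑ ^ 2)
            ((hmeas u).comp measurable_fst),
          measurePreserving_fst.lintegral_comp (hmeas u),
          measurePreserving_snd.lintegral_comp (hmeas 0)]
    _ ≤ 2 * (ENNReal.ofReal (ε * C) + ENNReal.ofReal (ε * C)) := by
        gcongr
        · exact hev u
        · exact hev 0
    _ = _ := by ring

end Increments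

section Drift

variable {Ω : Type*} [mΩ : MeasurableSpace Ω] {X : ℝ≥0 → Ω → ℝ} {P : Measure Ω}

lemma sub_sq_le_of_abs_le {z a e e' : ℝ} (h : |a - z| ≤ e + e') :
    z ^ 2 ≤ 2 * a ^ 2 + 2 * (e + e') ^ 2 := by
  have h1 : (a - z) ^ 2 ≤ (e + e') ^ 2 := by
    rw [← sq_abs (a - z)]
    exact pow_le_pow_left₀ (abs_nonneg _) h 2
  nlinarith [sq_nonneg (2 * a - z)]

lemma contPart_increment_ae_eq (hX : IsRegularLevy X P) (hbv : HasBVPaths X P) (u t : ℝ≥0) :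
    ∀ᵐ z ∂(P.prod P), contPart (fun s => X s z.1) (u + t) - contPart (fun s => X s z.1) u =
      contPart (fun s => X s z.2) (0 + t) - contPart (fun s => X s z.2) 0 := by
  have := hX.isProbabilityMeasure
  obtain ⟨C, hC0, hC⟩ := exists_mul_integral_min_le hX hbv t
  set ε : ℕ → ℝ := fun m => (1 / 2) ^ m with hεdef
  have hε0 : ∀ m, 0 < ε m := fun m => by positivity
  have hε1 : ∀ m, ε m ≤ 1 := fun m => pow_le_one₀ (by norm_num) (by norm_num)
  have hεlim : Tendsto ε atTop (𝓝 0) :=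
    tendsto_pow_atTop_nhds_zero_of_lt_one (by norm_num) (by norm_num)
  set D : ℕ → ℕ → Ω × Ω → ℝ≥0∞ := fun m n z =>
    ‖clampSum (fun s => X s z.1) (ε m) u t n - clampSum (fun s => X s z.2) (ε m) 0 t n‖ₑ ^ 2
    with hD
  have hDm : ∀ m n, Measurable (D m n) := fun m n =>
    (((measurable_clampSum hX (ε m) u t n).comp measurable_fst).sub
      ((measurable_clampSum hX (ε m) 0 t n).comp measurable_snd)).enorm.pow_const 2
  set B : ℕ → Ω × Ω → ℝ≥0∞ := fun m z => liminf (fun n => D m n z) atTop with hB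
  have hBm : ∀ m, Measurable (B m) := fun m => Measurable.liminf (hDm m)
  have hBint : ∀ m, ∫⁻ z, B m z ∂(P.prod P) ≤ 4 * ENNReal.ofReal (ε m * C) := fun m => by
    refine (lintegral_liminf_le (hDm m)).trans ?_
    refine (liminf_le_liminf (Eventually.of_forall fun n =>
      lintegral_clampSum_sub_sq_le hX hC (hε0 m).le (hε1 m) u n)).trans_eq ?_
    exact liminf_const _
  have hsum : ∫⁻ z, ∑' m, B m z ∂(P.prod P) ≠ ∞ := by
    rw [lintegral_tsum fun m => (hBm m).aemeasurable]
    refine ne_top_of_le_ne_top ?_ (ENNReal.tsum_le_tsum hBint)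
    rw [ENNReal.tsum_mul_left]
    refine ENNReal.mul_ne_top (by simp) (Summable.tsum_ofReal_ne_top ?_)
    exact (summable_geometric_of_lt_one (by norm_num) (by norm_num)).mul_right C
  have hae := ae_lt_top (Measurable.tsum fun m => hBm m) hsum
  have hbv1 : ∀ᵐ z ∂(P.prod P), LocallyBoundedVariationOn (fun s => X s z.1) univ :=
    measurePreserving_fst.quasiMeasurePreserving.ae hbv
  have hbv2 : ∀ᵐ z ∂(P.prod P), LocallyBoundedVariationOn (fun s => X s z.2) univ :=
    measurePreserving_snd.quasiMeasurePreserving.ae hbv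
  filter_upwards [hae, hbv1, hbv2] with z hz h1 h2
  have hs1 := locallySummable_jump (hX.cadlag z.1) h1
  have hs2 := locallySummable_jump (hX.cadlag z.2) h2
  have hBlim : Tendsto (fun m => B m z) atTop (𝓝 0) :=
    ENNReal.tendsto_atTop_zero_of_tsum_ne_top hz.ne
  set Z1 := contPart (fun s => X s z.1) (u + t) - contPart (fun s => X s z.1) u
  set Z2 := contPart (fun s => X s z.2) (0 + t) - contPart (fun s => X s z.2) 0
  set e1 : ℕ → ℝ := fun m =>
    sumIoc (fun r => min |jump (fun s => X s z.1) r| (2 * ε m)) u (u + t) with he1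
  set e2 : ℕ → ℝ := fun m =>
    sumIoc (fun r => min |jump (fun s => X s z.2) r| (2 * ε m)) 0 (0 + t) with he2
  have hl1 : Tendsto e1 atTop (𝓝 0) := tendsto_sumIoc_min hs1 (fun m => (hε0 m).le) hεlim _ _
  have hl2 : Tendsto e2 atTop (𝓝 0) := tendsto_sumIoc_min hs2 (fun m => (hε0 m).le) hεlim _ _
  have hkey : ∀ m, ENNReal.ofReal ((Z1 - Z2) ^ 2) ≤
      2 * B m z + ENNReal.ofReal (2 * (e1 m + e2 m) ^ 2) := fun m => by
    have hev := (eventually_clampSum_sub_le (hX.cadlag z.1) hs1 (hε0 m) u t).and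
      (eventually_clampSum_sub_le (hX.cadlag z.2) hs2 (hε0 m) 0 t)
    have h3 : ∀ᶠ n in atTop, ENNReal.ofReal ((Z1 - Z2) ^ 2) ≤
        2 * D m n z + ENNReal.ofReal (2 * (e1 m + e2 m) ^ 2) := by
      filter_upwards [hev] with n hn
      rw [hD]
      simp only [Real.enorm_eq_ofReal_abs, ← ENNReal.ofReal_pow (abs_nonneg _), sq_abs]
      rw [show (2 : ℝ≥0∞) = ENNReal.ofReal 2 by simp, ← ENNReal.ofReal_mul (by norm_num),
        ← ENNReal.ofReal_add (by positivity) (by positivity)]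
      refine ENNReal.ofReal_le_ofReal (sub_sq_le_of_abs_le ?_)
      have := abs_sub (clampSum (fun s => X s z.1) (ε m) u t n - Z1)
        (clampSum (fun s => X s z.2) (ε m) 0 t n - Z2)
      rw [show clampSum (fun s => X s z.1) (ε m) u t n - clampSum (fun s => X s z.2) (ε m) 0 t n -
        (Z1 - Z2) = (clampSum (fun s => X s z.1) (ε m) u t n - Z1) -
        (clampSum (fun s => X s z.2) (ε m) 0 t n - Z2) by ring]
      exact this.trans (add_le_add hn.1 hn.2)
    have hfin : ENNReal.ofReal (2 * (e1 m + e2 m) ^ 2) ≠ ∞ := ENNReal.ofReal_ne_top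
    have h4 : ∀ᶠ n in atTop, (ENNReal.ofReal ((Z1 - Z2) ^ 2) -
        ENNReal.ofReal (2 * (e1 m + e2 m) ^ 2)) / 2 ≤ D m n z := h3.mono fun n hn => by
      refine ENNReal.div_le_of_le_mul ?_
      rw [mul_comm (D m n z)]
      exact tsub_le_iff_right.2 hn
    have h5 : (ENNReal.ofReal ((Z1 - Z2) ^ 2) -
        ENNReal.ofReal (2 * (e1 m + e2 m) ^ 2)) / 2 ≤ B m z := le_liminf_of_le (by isBoundedDefault) h4
    rw [← tsub_le_iff_right]
    calc _ = 2 * ((ENNReal.ofReal ((Z1 - Z2) ^ 2) -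
        ENNReal.ofReal (2 * (e1 m + e2 m) ^ 2)) / 2) :=
          (ENNReal.mul_div_cancel (by simp) (by simp)).symm
      _ ≤ _ := by gcongr
  have hlim : Tendsto (fun m => 2 * B m z + ENNReal.ofReal (2 * (e1 m + e2 m) ^ 2)) atTop
      (𝓝 0) := by
    have h3 : Tendsto (fun m => 2 * (e1 m + e2 m) ^ 2) atTop (𝓝 0) := by
      simpa using ((hl1.add hl2).pow 2).const_mul 2
    have h4 := ENNReal.Tendsto.const_mul (a := 2) hBlim (Or.inr (by simp))
    simpa using h4.add (ENNReal.tendsto_ofReal h3)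
  have h0 : ENNReal.ofReal ((Z1 - Z2) ^ 2) ≤ 0 := ge_of_tendsto' hlim hkey
  have h6 : (Z1 - Z2) ^ 2 ≤ 0 := ENNReal.ofReal_eq_zero.1 (le_antisymm h0 zero_le)
  have h7 : Z1 - Z2 = 0 := by
    have := sq_nonneg (Z1 - Z2)
    exact pow_eq_zero_iff (two_ne_zero) |>.1 (le_antisymm h6 this)
  linarith

lemma contPart_zero (hX : IsRegularLevy X P) (ω : Ω) : contPart (fun s => X s ω) 0 = 0 := by
  simp [contPart, sumIoc, hX.zero]

lemma exists_contPart_increment (hX : IsRegularLevy X P) (hbv : HasBVPaths X P) :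
    ∃ c : ℝ≥0 → ℝ, ∀ u t, ∀ᵐ ω ∂P,
      contPart (fun s => X s ω) (u + t) - contPart (fun s => X s ω) u = c t := by
  have := hX.isProbabilityMeasure
  have h1 : ∀ t, ∃ c : ℝ, ∀ᵐ ω ∂P, contPart (fun s => X s ω) t = c := fun t => by
    obtain ⟨ω₀, h⟩ := (Measure.ae_ae_of_ae_prod (contPart_increment_ae_eq hX hbv 0 t)).exists
    refine ⟨contPart (fun s => X s ω₀) t, h.mono fun ω hω => ?_⟩
    simp only [zero_add, contPart_zero hX, sub_zero] at hω
    exact hω.symm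
  choose c hc using h1
  refine ⟨c, fun u t => ?_⟩
  filter_upwards [Measure.ae_ae_of_ae_prod (contPart_increment_ae_eq hX hbv u t)] with ω hω
  obtain ⟨ω', h1, h2⟩ := (hω.and (hc t)).exists
  simp only [zero_add, contPart_zero hX, sub_zero] at h1
  rw [h1, h2]

lemma denseRange_nnratCast : DenseRange ((↑) : ℚ≥0 → ℝ≥0) := by
  refine dense_of_exists_between fun s t h => ?_
  obtain ⟨r, h1, h2⟩ := exists_rat_between h
  exact ⟨r, ⟨r, rfl⟩, h1, h2⟩

lemma eq_mul_of_additive {f : ℝ≥0 → ℝ} (hf : Continuous f)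
    (h : ∀ r s : ℚ≥0, f (r + s) = f r + f s) (t : ℝ≥0) : f t = t * f 1 := by
  let g : ℚ≥0 →+ ℝ := ⟨⟨fun r => f r, by simpa using h 0 0⟩, fun r s => by
    simpa using h r s⟩
  have h1 : ∀ r : ℚ≥0, f r = (r : ℝ≥0) * f 1 := fun r => by
    have := map_nnrat_smul g r 1
    have e : ((r : ℝ≥0) : ℝ) = (r : ℝ) := rfl
    rw [e]
    simpa [g, NNRat.smul_def] using this
  have h2 : f = fun t : ℝ≥0 => t * f 1 :=
    denseRange_nnratCast.equalizer hf (by fun_prop) (funext h1)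
  exact congrFun h2 t

/-- The continuous part of a Lévy process with bounded variation paths is linear. -/
theorem contPart_eq_drift_mul (hX : IsRegularLevy X P) (hbv : HasBVPaths X P) :
    ∀ᵐ ω ∂P, ∀ t : ℝ≥0, contPart (fun s => X s ω) t = drift X P * t := by
  have := hX.isProbabilityMeasure
  obtain ⟨c, hc⟩ := exists_contPart_increment hX hbv
  have hall : ∀ᵐ ω ∂P, ∀ t : ℝ≥0, contPart (fun s => X s ω) t = t * c 1 := by
    have hrat : ∀ᵐ ω ∂P, ∀ r s : ℚ≥0,
        contPart (fun s => X s ω) (r + s) - contPart (fun s => X s ω) r = c s :=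
      ae_all_iff.2 fun r => ae_all_iff.2 fun s => hc r s
    filter_upwards [hrat, hbv] with ω h hω t
    have h0 : ∀ s : ℚ≥0, contPart (fun s => X s ω) s = c s := fun s => by
      have := h 0 s
      simpa [contPart_zero hX] using this
    have h1 := eq_mul_of_additive (continuous_contPart (hX.cadlag ω)
      (locallySummable_jump (hX.cadlag ω) hω)) (fun r s => by rw [h0 s, ← h r s]; ring) t
    have h2 := h0 1
    rw [NNRat.cast_one] at h2
    rw [h1, h2]
  have hd : drift X P = c 1 := by
    rw [drift]
    have : ∀ᵐ ω ∂P, X 1 ω - X 0 ω - ∑' s : Ioc (0 : ℝ≥0) 1, jump (fun t => X t ω) s = c 1 := by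
      filter_upwards [hall] with ω hω
      have := hω 1
      rw [contPart, sumIoc_zero] at this
      rw [hX.zero, sub_zero, this]
      simp
    rw [integral_congr_ae this]
    simp
  rw [hd]
  exact hall.mono fun ω h t => by rw [h t, mul_comm]

end Drift

/-! ### The strategy at the barrier zero -/

section Dyadic

variable {w : ℝ≥0 → ℝ} {q : ℝ}

/-- A sequence of positive barriers that tends to `0`. -/
def dyadic (k : ℕ) : ℝ := (1 / 2) ^ k

lemma dyadic_pos (k : ℕ) : 0 < dyadic k := by unfold dyadic; positivity

lemma dyadic_sub_succ (k : ℕ) : dyadic k - dyadic (k + 1) = dyadic (k + 1) := by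
  unfold dyadic; ring

lemma dyadic_zero : dyadic 0 = 1 := by simp [dyadic]

lemma dyadic_anti : Antitone dyadic := fun _ _ h =>
  pow_le_pow_of_le_one (by norm_num) (by norm_num) h

lemma tendsto_dyadic : Tendsto dyadic atTop (𝓝 0) :=
  tendsto_pow_atTop_nhds_zero_of_lt_one (by norm_num) (by norm_num)

lemma dividendsPos_dyadic_succ_le (hw : IsCadlag w) (k : ℕ) (t : ℝ≥0) :
    dividendsPos w (dyadic (k + 1)) t ≤
      dividendsPos w (dyadic k) t + dyadic (k + 1) * numTop (dyadic (k + 1)) w t := by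
  have := (pos_le_of_isAdmissible hw (dyadic_pos (k + 1)) (isAdmissible_pos hw (dyadic_pos k)) t).1
  rwa [dyadic_sub_succ, mul_comm] at this

lemma injectionsPos_dyadic_succ_le (hw : IsCadlag w) (k : ℕ) (t : ℝ≥0) :
    injectionsPos w (dyadic (k + 1)) t ≤
      injectionsPos w (dyadic k) t + dyadic (k + 1) * numBottom (dyadic (k + 1)) w t := by
  have := (pos_le_of_isAdmissible hw (dyadic_pos (k + 1)) (isAdmissible_pos hw (dyadic_pos k)) t).2
  rwa [dyadic_sub_succ, mul_comm] at this

lemma ofReal_le_add_tsum {F : ℕ → ℝ} {N : ℕ → ℕ}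
    (h : ∀ k, F (k + 1) ≤ F k + dyadic (k + 1) * N (k + 1)) (K j : ℕ) :
    ENNReal.ofReal (F (K + j)) ≤ ENNReal.ofReal (F K) +
      ∑' i, ENNReal.ofReal (dyadic (K + i + 1)) * (N (K + i + 1) : ℝ≥0∞) := by
  have h1 : ∀ j, ENNReal.ofReal (F (K + j)) ≤ ENNReal.ofReal (F K) +
      ∑ i ∈ Finset.range j, ENNReal.ofReal (dyadic (K + i + 1)) * (N (K + i + 1) : ℝ≥0∞) :=
    fun j => by
      induction j with
      | zero => simp
      | succ j ih =>
        rw [Finset.sum_range_succ, ← add_assoc]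
        refine (ENNReal.ofReal_le_ofReal (h (K + j))).trans (ENNReal.ofReal_add_le.trans ?_)
        rw [ENNReal.ofReal_mul (dyadic_pos _).le, ENNReal.ofReal_natCast]
        rw [← add_assoc]
        exact add_le_add_left ih _
  exact (h1 j).trans (by gcongr; exact ENNReal.sum_le_tsum _)

lemma lintegral_numBottom (hq : 0 < q) (hw : IsCadlag w) {a : ℝ} (ha : 0 < a) :
    ∫⁻ t, (numBottom a w t : ℝ≥0∞) ∂kill q = discBottom q a w := by
  rw [discBottom, ← lintegral_tsum_kill hq]
  exact lintegral_congr fun t => ncard_eq_tsum (finite_bottom hw ha t)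

lemma measurable_numBottom (hw : IsCadlag w) {a : ℝ} (ha : 0 < a) :
    Measurable fun t => (numBottom a w t : ℝ≥0∞) := by
  have : (fun t => (numBottom a w t : ℝ≥0∞)) =
      fun t => ∑' j, {s : ℝ≥0 | crossTime a w (2 * j + 1) ≤ s}.indicator 1 t :=
    funext fun t => ncard_eq_tsum (finite_bottom hw ha t)
  rw [this]
  exact measurable_tsum_indicator _

lemma npv_le_add_tsum (hq : 0 < q) {F G : ℝ≥0 → ℝ} (hF : Monotone F) (hG : Monotone G)
    (hF0 : ∀ t, 0 ≤ F t) (hG0 : ∀ t, 0 ≤ G t) {N : ℕ → ℝ≥0 → ℝ≥0∞} {c : ℕ → ℝ≥0∞}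
    (hN : ∀ i, Measurable (N i))
    (h : ∀ t, ENNReal.ofReal (F t) ≤ ENNReal.ofReal (G t) + ∑' i, c i * N i t) :
    npv q F ≤ npv q G + ∑' i, c i * ∫⁻ t, N i t ∂kill q := by
  rw [npv_eq hq hF hF0, npv_eq hq hG hG0]
  refine (lintegral_mono h).trans_eq ?_
  rw [lintegral_add_left hG.measurable.ennreal_ofReal,
    lintegral_tsum fun i => ((hN i).const_mul _).aemeasurable]
  congr 1
  exact tsum_congr fun i => lintegral_const_mul _ (hN i)

lemma mul_kill_le_lintegral (hq : 0 < q) {F : ℝ≥0 → ℝ≥0∞} (hF : Monotone F) (t : ℝ≥0) :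
    F t * ENNReal.ofReal (Real.exp (-q * t)) ≤ ∫⁻ s, F s ∂kill q := by
  rw [← kill_Ici hq, ← setLIntegral_const]
  exact (setLIntegral_mono' measurableSet_Ici fun s hs => hF hs).trans (setLIntegral_le_lintegral _ _)

end Dyadic

/-- A càdlàg path whose continuous part is linear with slope `δ` and whose jumps are locally
summable. -/
structure IsJumpDriftPath (δ : ℝ) (w : ℝ≥0 → ℝ) : Prop where
  cadlag : IsCadlag w
  summable : LocallySummable fun r => |jump w r|
  eq : ∀ t : ℝ≥0, w t = w 0 + δ * t + sumIoc (jump w) 0 t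

section ZeroPath

variable {w : ℝ≥0 → ℝ} {δ q : ℝ}

lemma IsJumpDriftPath.summable_pos (h : IsJumpDriftPath δ w) :
    LocallySummable fun r => max (jump w r) 0 := h.summable.of_abs_le fun r => by
  rw [abs_of_nonneg (le_max_right _ _)]
  exact max_le (le_abs_self _) (abs_nonneg _)

lemma IsJumpDriftPath.summable_neg (h : IsJumpDriftPath δ w) :
    LocallySummable fun r => max (-jump w r) 0 := h.summable.of_abs_le fun r => by
  rw [abs_of_nonneg (le_max_right _ _)]
  exact max_le (neg_le_abs _) (abs_nonneg _)

lemma dividendsZero_eq (δ : ℝ) (w : ℝ≥0 → ℝ) (t : ℝ≥0) : dividendsZero δ w t =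
    max (w 0) 0 + max δ 0 * t + sumIoc (fun r => max (jump w r) 0) 0 t := by
  rw [dividendsZero, sumIoc_zero]

lemma injectionsZero_eq (δ : ℝ) (w : ℝ≥0 → ℝ) (t : ℝ≥0) : injectionsZero δ w t =
    max (-w 0) 0 + max (-δ) 0 * t + sumIoc (fun r => max (-jump w r) 0) 0 t := by
  rw [injectionsZero, sumIoc_zero]

lemma LocallySummable.monotone_sumIoc {f : ℝ≥0 → ℝ} (hf : LocallySummable f) (h0 : ∀ r, 0 ≤ f r) :
    Monotone (sumIoc f 0) := fun s t hst => by
  rw [← hf.sumIoc_add zero_le hst]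
  linarith [LocallySummable.sumIoc_nonneg h0 s t]

lemma dividendsZero_sub_injectionsZero (h : IsJumpDriftPath δ w) (t : ℝ≥0) :
    dividendsZero δ w t - injectionsZero δ w t = w t := by
  have h1 : sumIoc (jump w) 0 t = sumIoc (fun r => max (jump w r) 0) 0 t -
      sumIoc (fun r => max (-jump w r) 0) 0 t := by
    rw [sumIoc, sumIoc, sumIoc, ← (h.summable_pos t).tsum_sub (h.summable_neg t)]
    refine tsum_congr fun r => ?_
    by_cases hr : r ∈ Ioc 0 t
    · simp only [indicator_of_mem hr]
      exact (max_zero_sub_eq_self _).symm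
    · simp [indicator_of_notMem hr]
  have h2 := max_zero_sub_eq_self (w 0)
  have h3 := max_zero_sub_eq_self δ
  rw [dividendsZero_eq, injectionsZero_eq, h.eq t, h1]
  nlinarith

lemma isAdmissible_zero (h : IsJumpDriftPath δ w) :
    IsAdmissible w (dividendsZero δ w) (injectionsZero δ w) 0 := by
  have p1 : ∀ r, 0 ≤ max (jump w r) 0 := fun r => le_max_right _ _
  have p2 : ∀ r, 0 ≤ max (-jump w r) 0 := fun r => le_max_right _ _
  refine ⟨fun s t hst => ?_, fun s t hst => ?_, fun t => ?_, fun t => ?_, fun t => ?_, fun t => ?_⟩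
  · rw [dividendsZero_eq, dividendsZero_eq]
    have := h.summable_pos.monotone_sumIoc p1 hst
    gcongr
  · rw [injectionsZero_eq, injectionsZero_eq]
    have := h.summable_neg.monotone_sumIoc p2 hst
    gcongr
  · rw [dividendsZero_eq]
    have := LocallySummable.sumIoc_nonneg p1 0 t
    positivity
  · rw [injectionsZero_eq]
    have := LocallySummable.sumIoc_nonneg p2 0 t
    positivity
  · linarith [dividendsZero_sub_injectionsZero h t]
  · linarith [dividendsZero_sub_injectionsZero h t]

lemma eventually_pureJump_le (hw : IsCadlag w) (hs : LocallySummable fun r => max (jump w r) 0)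
    {L u : ℕ → ℝ≥0 → ℝ} (hL : ∀ n, Monotone (L n))
    (h : ∀ n s t, s ≤ t → u n t - u n s ≤ L n t - L n s)
    (hu : ∀ t, Tendsto (fun n => u n t) atTop (𝓝 (w t))) (h0 : ∀ n, max (u n 0) 0 ≤ L n 0)
    (t : ℝ≥0) {η : ℝ} (hη : 0 < η) : ∀ᶠ n in atTop,
      max (w 0) 0 + sumIoc (fun r => max (jump w r) 0) 0 t - η ≤ L n t := by
  have h1 := (hs t).hasSum.eventually
    (lt_mem_nhds (show sumIoc (fun r => max (jump w r) 0) 0 t - η / 3 <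
      ∑' r, (Ioc 0 t).indicator (fun r => max (jump w r) 0) r by rw [← sumIoc]; linarith))
  obtain ⟨F, hF⟩ := h1.exists
  classical
  rw [Finset.sum_indicator_eq_sum_filter] at hF
  have h2 := eventually_sum_jump_le hw hL h hu (F.filter fun r => r ∈ Ioc 0 t) (zero_le (a := t))
    (fun r hr => (Finset.mem_filter.1 hr).2) (show 0 < η / 3 by linarith)
  have h3 := ((hu 0).max (tendsto_const_nhds (x := (0 : ℝ)))).eventually
    (lt_mem_nhds (show max (w 0) 0 - η / 3 < max (w 0) 0 by linarith))
  filter_upwards [h2, h3] with n e2 e3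
  linarith [h0 n]

/-- The strategy at the barrier `0` is the limit of the strategies at positive barriers. -/
lemma eventually_zero_le (h : IsJumpDriftPath δ w) (t : ℝ≥0) {η : ℝ} (hη : 0 < η) :
    ∀ᶠ k in atTop, dividendsZero δ w t - η ≤ dividendsPos w (dyadic k) t ∧
      injectionsZero δ w t - η ≤ injectionsPos w (dyadic k) t := by
  have hA := fun k => isAdmissible_pos h.cadlag (dyadic_pos k)
  have hlim : ∀ t, Tendsto (fun k => dividendsPos w (dyadic k) t - injectionsPos w (dyadic k) t)
      atTop (𝓝 (w t)) := fun t => by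
    have h1 : Tendsto (fun k => w t - dyadic k) atTop (𝓝 (w t)) := by
      simpa using tendsto_dyadic.const_sub (w t)
    refine tendsto_of_tendsto_of_tendsto_of_le_of_le h1 tendsto_const_nhds (fun k => ?_) fun k => ?_
    · simp only; linarith [(hA k).le t]
    · simp only; linarith [(hA k).nonneg t]
  have hid := dividendsZero_sub_injectionsZero h t
  have hη2 : 0 < η / 2 := half_pos hη
  rcases le_total δ 0 with hδ | hδ
  · have h1 := eventually_pureJump_le h.cadlag h.summable_pos (fun k => (hA k).monoL)
      (u := fun k t => dividendsPos w (dyadic k) t - injectionsPos w (dyadic k) t)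
      (fun k s t hst => by linarith [(hA k).monoR hst]) hlim
      (fun k => max_le (by linarith [(hA k).nonnegR 0]) ((hA k).nonnegL 0)) t hη
    filter_upwards [h1] with k hk
    have h2 : dividendsZero δ w t - η ≤ dividendsPos w (dyadic k) t := by
      rw [dividendsZero_eq, max_eq_right hδ]; linarith
    exact ⟨h2, by linarith [(hA k).nonneg t]⟩
  · have hs' : LocallySummable fun r => max (jump (fun s => -w s) r) 0 := by
      simp_rw [h.cadlag.jump_neg]; exact h.summable_neg
    have h1 := eventually_pureJump_le h.cadlag.neg hs' (fun k => (hA k).monoR)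
      (u := fun k t => injectionsPos w (dyadic k) t - dividendsPos w (dyadic k) t)
      (fun k s t hst => by linarith [(hA k).monoL hst])
      (fun t => by simpa using (hlim t).neg)
      (fun k => max_le (by linarith [(hA k).nonnegL 0]) ((hA k).nonnegR 0)) t hη2
    filter_upwards [h1, tendsto_dyadic.eventually (gt_mem_nhds hη2)] with k hk hk'
    simp_rw [h.cadlag.jump_neg] at hk
    have h2 : injectionsZero δ w t - η / 2 ≤ injectionsPos w (dyadic k) t := by
      rw [injectionsZero_eq, max_eq_right (by linarith : -δ ≤ 0)]; linarith
    exact ⟨by linarith [(hA k).le t], by linarith⟩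

lemma ofReal_le_of_eventually {z : ℝ} {F : ℕ → ℝ} {M : ℝ≥0∞} {K : ℕ}
    (h : ∀ η > 0, ∀ᶠ k in atTop, z - η ≤ F k) (hF : ∀ j, ENNReal.ofReal (F (K + j)) ≤ M) :
    ENNReal.ofReal z ≤ M := by
  refine ENNReal.le_of_forall_pos_le_add fun η hη _ => ?_
  obtain ⟨k, hk, hKk⟩ := ((h η hη).and (eventually_ge_atTop K)).exists
  obtain ⟨j, rfl⟩ := exists_add_of_le hKk
  calc ENNReal.ofReal z ≤ ENNReal.ofReal (F (K + j) + η) := ENNReal.ofReal_le_ofReal (by linarith)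
    _ ≤ ENNReal.ofReal (F (K + j)) + ENNReal.ofReal η := ENNReal.ofReal_add_le
    _ ≤ M + η := by rw [ENNReal.ofReal_coe_nnreal]; gcongr; exact hF j

theorem npv_dividendsZero_le (hq : 0 < q) (h : IsJumpDriftPath δ w) (K : ℕ) :
    npv q (dividendsZero δ w) ≤ npv q (dividendsPos w (dyadic K)) +
      ∑' i, ENNReal.ofReal (dyadic (K + i + 1)) * discTop q (dyadic (K + i + 1)) w := by
  have hA := isAdmissible_pos h.cadlag (dyadic_pos K)
  have h0 := isAdmissible_zero h
  simp_rw [← lintegral_numTop hq h.cadlag (dyadic_pos _)]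
  exact npv_le_add_tsum hq h0.monoL hA.monoL h0.nonnegL hA.nonnegL
    (fun i => measurable_numTop h.cadlag (dyadic_pos _)) fun t =>
      ofReal_le_of_eventually (fun η hη => (eventually_zero_le h t hη).mono fun k hk => hk.1)
        fun j => ofReal_le_add_tsum (F := fun k => dividendsPos w (dyadic k) t)
          (N := fun k => numTop (dyadic k) w t)
          (fun k => dividendsPos_dyadic_succ_le h.cadlag k t) K j

theorem npv_injectionsZero_le (hq : 0 < q) (h : IsJumpDriftPath δ w) (K : ℕ) :
    npv q (injectionsZero δ w) ≤ npv q (injectionsPos w (dyadic K)) +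
      ∑' i, ENNReal.ofReal (dyadic (K + i + 1)) * discBottom q (dyadic (K + i + 1)) w := by
  have hA := isAdmissible_pos h.cadlag (dyadic_pos K)
  have h0 := isAdmissible_zero h
  simp_rw [← lintegral_numBottom hq h.cadlag (dyadic_pos _)]
  exact npv_le_add_tsum hq h0.monoR hA.monoR h0.nonnegR hA.nonnegR
    (fun i => measurable_numBottom h.cadlag (dyadic_pos _)) fun t =>
      ofReal_le_of_eventually (fun η hη => (eventually_zero_le h t hη).mono fun k hk => hk.2)
        fun j => ofReal_le_add_tsum (F := fun k => injectionsPos w (dyadic k) t)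
          (N := fun k => numBottom (dyadic k) w t)
          (fun k => injectionsPos_dyadic_succ_le h.cadlag k t) K j

lemma locallyBoundedVariationOn_of_abs_sub_le {L : ℝ≥0 → ℝ} (hL : Monotone L)
    (h : ∀ s t, s ≤ t → |w t - w s| ≤ L t - L s) : LocallyBoundedVariationOn w univ := by
  intro a b ha hb
  refine ne_top_of_le_ne_top (hL.monotoneOn univ |>.locallyBoundedVariationOn a b ha hb)
    (iSup_mono fun p => Finset.sum_le_sum fun i _ => ?_)
  have hle := p.2.2.1 (Nat.le_succ i)
  rw [edist_dist, edist_dist, Real.dist_eq, Real.dist_eq, abs_of_nonneg (sub_nonneg.2 (hL hle))]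
  exact ENNReal.ofReal_le_ofReal (h _ _ hle)

/-- A path along which the strategies at the barriers `dyadic k` have bounded dividends is of
bounded variation. -/
lemma locallyBoundedVariationOn_of_tsum_lt_top (hq : 0 < q) (hw : IsCadlag w)
    (h : ∑' i, ENNReal.ofReal (dyadic (i + 1)) * discTop q (dyadic (i + 1)) w < ∞) :
    LocallyBoundedVariationOn w univ := by
  have hA := fun k => isAdmissible_pos hw (dyadic_pos k)
  set S : ℝ≥0 → ℝ≥0∞ := fun t =>
    ∑' i, ENNReal.ofReal (dyadic (i + 1)) * (numTop (dyadic (i + 1)) w t : ℝ≥0∞) with hS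
  have hSmono : Monotone S := fun s t hst => ENNReal.tsum_le_tsum fun i => by
    gcongr
    exact ncard_le_ncard (fun j (hj : _ ≤ (s : ℝ≥0∞)) => hj.trans (ENNReal.coe_le_coe.2 hst))
      (finite_top hw (dyadic_pos _) t)
  have hSint : ∫⁻ t, S t ∂kill q < ∞ := by
    rw [lintegral_tsum fun i => ((measurable_numTop hw (dyadic_pos _)).const_mul _).aemeasurable]
    convert h using 3 with i
    rw [lintegral_const_mul _ (measurable_numTop hw (dyadic_pos _)),
      lintegral_numTop hq hw (dyadic_pos _)]
  have hSfin : ∀ t, S t ≠ ∞ := fun t ht => by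
    have := (mul_kill_le_lintegral hq hSmono t).trans_lt hSint
    rw [ht, ENNReal.top_mul (by simp [Real.exp_pos])] at this
    exact lt_irrefl _ this
  have hbd : ∀ t k, dividendsPos w (dyadic k) t ≤
      (ENNReal.ofReal (dividendsPos w (dyadic 0) t) + S t).toReal := fun t k => by
    rw [← ENNReal.ofReal_le_iff_le_toReal (ENNReal.add_ne_top.2 ⟨ENNReal.ofReal_ne_top, hSfin t⟩)]
    have := ofReal_le_add_tsum (F := fun k => dividendsPos w (dyadic k) t)
      (N := fun k => numTop (dyadic k) w t)
      (fun k => dividendsPos_dyadic_succ_le hw k t) 0 k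
    simpa [hS] using this
  have hbdL : ∀ t, BddAbove (range fun k => dividendsPos w (dyadic k) t) := fun t =>
    ⟨_, by rintro _ ⟨k, rfl⟩; exact hbd t k⟩
  have hbdR : ∀ t, BddAbove (range fun k => injectionsPos w (dyadic k) t) := fun t => by
    obtain ⟨C, hC⟩ := hbdL t
    refine ⟨C - w t + 1, ?_⟩
    rintro _ ⟨k, rfl⟩
    have h1 := hC ⟨k, rfl⟩
    have h2 := (hA k).le t
    have h3 := (dyadic_anti k.zero_le).trans_eq dyadic_zero
    simp only at h1 ⊢
    linarith
  have hmonoL : ∀ t, Monotone fun k => dividendsPos w (dyadic k) t := fun t k l hkl => by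
    have := (pos_le_of_isAdmissible hw (dyadic_pos k) (hA l) t).1
    have h2 : (numTop (dyadic k) w t : ℝ) * (dyadic l - dyadic k) ≤ 0 :=
      mul_nonpos_of_nonneg_of_nonpos (Nat.cast_nonneg _) (sub_nonpos.2 (dyadic_anti hkl))
    simp only
    linarith
  have hmonoR : ∀ t, Monotone fun k => injectionsPos w (dyadic k) t := fun t k l hkl => by
    have := (pos_le_of_isAdmissible hw (dyadic_pos k) (hA l) t).2
    have h2 : (numBottom (dyadic k) w t : ℝ) * (dyadic l - dyadic k) ≤ 0 :=
      mul_nonpos_of_nonneg_of_nonpos (Nat.cast_nonneg _) (sub_nonpos.2 (dyadic_anti hkl))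
    simp only
    linarith
  have hL := fun t => tendsto_atTop_ciSup (hmonoL t) (hbdL t)
  have hR := fun t => tendsto_atTop_ciSup (hmonoR t) (hbdR t)
  have hlim : ∀ t, w t = (⨆ k, dividendsPos w (dyadic k) t) -
      ⨆ k, injectionsPos w (dyadic k) t := fun t => by
    refine tendsto_nhds_unique ?_ ((hL t).sub (hR t))
    have h1 : Tendsto (fun k => w t - dyadic k) atTop (𝓝 (w t)) := by
      simpa using tendsto_dyadic.const_sub (w t)
    refine tendsto_of_tendsto_of_tendsto_of_le_of_le h1 tendsto_const_nhds (fun k => ?_) fun k => ?_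
    · simp only; linarith [(hA k).le t]
    · simp only; linarith [(hA k).nonneg t]
  have m1 : Monotone fun t => ⨆ k, dividendsPos w (dyadic k) t := fun s t hst =>
    ciSup_mono (hbdL t) fun k => (hA k).monoL hst
  have m2 : Monotone fun t => ⨆ k, injectionsPos w (dyadic k) t := fun s t hst =>
    ciSup_mono (hbdR t) fun k => (hA k).monoR hst
  refine locallyBoundedVariationOn_of_abs_sub_le (m1.add m2) fun s t hst => ?_
  have e1 := m1 hst
  have e2 := m2 hst
  simp only at e1 e2 ⊢
  rw [hlim s, hlim t, abs_le]
  constructor <;> linarith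

end ZeroPath

section PathSums

variable {w : ℝ≥0 → ℝ} {q : ℝ}

lemma lintegral_kill_le_tsum (hq : 0 < q) {F : ℝ≥0 → ℝ≥0∞} (hF : Monotone F) :
    ∫⁻ s, F s ∂kill q ≤ ∑' m : ℕ, ENNReal.ofReal (Real.exp (-q * m)) * F (m + 1) := by
  calc ∫⁻ s, F s ∂kill q
      ≤ ∫⁻ s, ∑' m : ℕ, {s : ℝ≥0 | ((m : ℝ≥0) : ℝ≥0∞) ≤ s}.indicator
          (fun _ => F (m + 1)) s ∂kill q := by
        refine lintegral_mono fun s => ?_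
        refine le_trans ?_ (ENNReal.le_tsum ⌊s⌋₊)
        rw [indicator_of_mem]
        · exact hF (Nat.lt_floor_add_one s).le
        · have := Nat.floor_le (zero_le : 0 ≤ s)
          exact_mod_cast this
    _ = _ := by
        rw [lintegral_tsum fun m =>
          (measurable_const.indicator (measurableSet_ge _)).aemeasurable]
        refine tsum_congr fun m => ?_
        rw [lintegral_indicator_const (measurableSet_ge _), kill_ge hq, mul_comm]
        simp [discount]

lemma grid_one (n k : ℕ) : grid 0 1 n k = k / n := by simp [grid]

lemma tendsto_grid_ceil (s : ℝ≥0) :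
    Tendsto (fun n : ℕ => grid 0 1 (n + 1) ⌈s * (n + 1 : ℕ)⌉₊) atTop (𝓝[≥] s) := by
  have hpos : ∀ n : ℕ, (0 : ℝ≥0) < (n + 1 : ℕ) := fun n => by positivity
  have hge : ∀ n : ℕ, s ≤ grid 0 1 (n + 1) ⌈s * (n + 1 : ℕ)⌉₊ := fun n => by
    rw [grid_one, le_div_iff₀ (hpos n)]
    exact Nat.le_ceil _
  have hle : ∀ n : ℕ, grid 0 1 (n + 1) ⌈s * (n + 1 : ℕ)⌉₊ ≤ s + 1 / ((n : ℝ≥0) + 1) := fun n => by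
    have e : s + 1 / ((n : ℝ≥0) + 1) = (s * (n + 1 : ℕ) + 1) / (n + 1 : ℕ) := by
      push_cast; field_simp
    rw [grid_one, e]
    gcongr
    exact (Nat.ceil_lt_add_one zero_le).le
  have hlim : Tendsto (fun n : ℕ => s + 1 / ((n : ℝ≥0) + 1)) atTop (𝓝 s) := by
    have h1 : Tendsto (fun n : ℕ => 1 / ((n : ℝ≥0) + 1)) atTop (𝓝 0) := by
      rw [← NNReal.tendsto_coe]
      push_cast
      exact tendsto_one_div_add_atTop_nhds_zero_nat
    simpa using h1.const_add s
  exact tendsto_nhdsWithin_iff.2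
    ⟨tendsto_of_tendsto_of_tendsto_of_le_of_le tendsto_const_nhds hlim hge hle,
      Eventually.of_forall hge⟩

end PathSums

section ZeroValues

variable {Ω : Type*} [mΩ : MeasurableSpace Ω] {X : ℝ≥0 → Ω → ℝ} {P : Measure Ω} {x q β : ℝ}

lemma jump_shifted (hX : IsRegularLevy X P) (x : ℝ) (ω : Ω) :
    jump (shifted X x ω) = jump fun s => X s ω :=
  funext fun t => (hX.cadlag ω).jump_const_add x t

lemma isJumpDriftPath_shifted (hX : IsRegularLevy X P) (hbv : HasBVPaths X P) (x : ℝ) :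
    ∀ᵐ ω ∂P, IsJumpDriftPath (drift X P) (shifted X x ω) := by
  filter_upwards [contPart_eq_drift_mul hX hbv, hbv] with ω h1 h2
  refine ⟨hX.cadlag_shifted x ω, ?_, fun t => ?_⟩
  · rw [jump_shifted hX]
    exact locallySummable_jump (hX.cadlag ω) h2
  · have := h1 t
    rw [contPart] at this
    rw [jump_shifted hX, shifted, shifted, hX.zero]
    linarith

lemma lintegral_dividendsPos_one_lt_top (hX : IsRegularLevy X P) (hint : Integrable (X 1) P) :
    ∫⁻ ω, ENNReal.ofReal (dividendsPos (shifted X 0 ω) 1 1) ∂P < ∞ := by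
  have h0 : ENNReal.ofReal (Real.exp (-1 * ((1 : ℝ≥0) : ℝ))) ≠ 0 := by simp [Real.exp_pos]
  have h1 : (∫⁻ ω, ENNReal.ofReal (dividendsPos (shifted X 0 ω) 1 1) ∂P) *
      ENNReal.ofReal (Real.exp (-1 * ((1 : ℝ≥0) : ℝ))) ≤ posL X P 1 0 1 := by
    rw [← lintegral_mul_const' _ _ ENNReal.ofReal_ne_top]
    refine lintegral_mono fun ω => ?_
    have hA := isAdmissible_pos (hX.cadlag_shifted 0 ω) one_pos
    rw [npv_eq one_pos hA.monoL hA.nonnegL]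
    exact mul_kill_le_lintegral one_pos
      (F := fun s => ENNReal.ofReal (dividendsPos (shifted X 0 ω) 1 s))
      (fun s t hst => ENNReal.ofReal_le_ofReal (hA.monoL hst)) 1
  by_contra h
  rw [not_lt, top_le_iff] at h
  rw [h, ENNReal.top_mul h0, top_le_iff] at h1
  exact (posL_lt_top hX hint one_pos 0 one_pos).ne h1

lemma nat_mul_lintegral_eq (hX : IsRegularLevy X P) {g : ℝ → ℝ≥0∞} (hg : Measurable g)
    (n : ℕ) (N : ℕ) : N * ∫⁻ ω, g (X (1 / n) ω) ∂P =
      ∫⁻ ω, ∑ k ∈ Finset.range N, g (cellIncr X 0 1 n k ω) ∂P := by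
  rw [lintegral_finsetSum' (f := fun k ω => g (cellIncr X 0 1 n k ω)) _
    fun k _ => (hg.comp (measurable_cellIncr hX 0 1 n k)).aemeasurable]
  have : ∀ k ∈ Finset.range N, ∫⁻ ω, g (cellIncr X 0 1 n k ω) ∂P = ∫⁻ ω, g (X (1 / n) ω) ∂P :=
    fun k _ => ((identDistrib_cellIncr hX 0 1 n k).comp hg).lintegral_eq
  rw [Finset.sum_congr rfl this]
  simp

lemma sum_ofReal_cellIncr_sub_one_le (hX : IsRegularLevy X P) (n : ℕ) (hn : n ≠ 0) (ω : Ω) :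
    ∑ k ∈ Finset.range n, ENNReal.ofReal (cellIncr X 0 1 n k ω - 1) ≤
      ENNReal.ofReal (dividendsPos (shifted X 0 ω) 1 1) := by
  have hA := isAdmissible_pos (hX.cadlag_shifted 0 ω) one_pos
  set L := dividendsPos (shifted X 0 ω) 1 with hL
  have h1 : ∀ k ∈ Finset.range n, ENNReal.ofReal (cellIncr X 0 1 n k ω - 1) ≤
      ENNReal.ofReal (L (grid 0 1 n (k + 1)) - L (grid 0 1 n k)) := fun k _ => by
    refine ENNReal.ofReal_le_ofReal ?_
    have e1 := hA.le (grid 0 1 n (k + 1))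
    have e2 := hA.nonneg (grid 0 1 n k)
    have e3 := hA.monoR (grid_mono 0 1 n (Nat.le_add_right k 1))
    simp only [shifted, cellIncr] at *
    linarith
  refine (Finset.sum_le_sum h1).trans ?_
  rw [← ENNReal.ofReal_sum_of_nonneg fun k _ =>
      sub_nonneg.2 (hA.monoL (grid_mono 0 1 n k.le_succ)),
    Finset.sum_range_sub (fun k => L (grid 0 1 n k)), grid_self 0 1 hn, zero_add]
  refine ENNReal.ofReal_le_ofReal ?_
  linarith [hA.nonnegL (grid 0 1 n 0)]

lemma exists_mul_lintegral_pos_le (hX : IsRegularLevy X P) (hint : Integrable (X 1) P)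
    (hbv : HasBVPaths X P) :
    ∃ K : ℝ≥0∞, K < ∞ ∧ ∀ n : ℕ, n ≠ 0 → n * ∫⁻ ω, ENNReal.ofReal (X (1 / n) ω) ∂P ≤ K := by
  have := hX.isProbabilityMeasure
  obtain ⟨C, hC0, hC⟩ := exists_mul_integral_min_le hX hbv 1
  refine ⟨ENNReal.ofReal C + ∫⁻ ω, ENNReal.ofReal (dividendsPos (shifted X 0 ω) 1 1) ∂P,
    ENNReal.add_lt_top.2 ⟨ENNReal.ofReal_lt_top, lintegral_dividendsPos_one_lt_top hX hint⟩,
    fun n hn => ?_⟩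
  have hm : Measurable fun ω => ENNReal.ofReal (min |X (1 / n) ω| 1) :=
    ((hX.measurable _).abs.min measurable_const).ennreal_ofReal
  have h1 : ∫⁻ ω, ENNReal.ofReal (X (1 / n) ω) ∂P ≤
      ∫⁻ ω, ENNReal.ofReal (min |X (1 / n) ω| 1) ∂P +
        ∫⁻ ω, ENNReal.ofReal (X (1 / n) ω - 1) ∂P := by
    rw [← lintegral_add_left hm]
    refine lintegral_mono fun ω => ?_
    rcases le_total (X (1 / n) ω) 1 with h | h
    · refine le_trans (ENNReal.ofReal_le_ofReal ?_) le_self_add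
      exact le_min (le_abs_self _) h
    · rw [← ENNReal.ofReal_add (le_min (abs_nonneg _) zero_le_one) (by linarith),
        min_eq_right (h.trans (le_abs_self _))]
      exact ENNReal.ofReal_le_ofReal (by linarith)
  refine (mul_le_mul_right h1 _).trans ?_
  rw [mul_add]
  refine add_le_add ?_ ?_
  · have hi : Integrable (fun ω => min |X (1 / n) ω| 1) P :=
      integrable_of_mem_Icc (C := 1) ((hX.measurable _).abs.min measurable_const) fun ω => by
        rw [abs_of_nonneg (le_min (abs_nonneg _) zero_le_one)]
        exact min_le_right _ _
    rw [← ofReal_integral_eq_lintegral_ofReal hi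
      (Eventually.of_forall fun ω => le_min (abs_nonneg _) zero_le_one), ← ENNReal.ofReal_natCast,
      ← ENNReal.ofReal_mul (Nat.cast_nonneg _)]
    exact ENNReal.ofReal_le_ofReal (hC n)
  · rw [nat_mul_lintegral_eq hX (g := fun y => ENNReal.ofReal (y - 1)) (by fun_prop)]
    exact lintegral_mono fun ω => sum_ofReal_cellIncr_sub_one_le hX n hn ω

/-- The sum of the positive increments over `[0, m]` along the grid with mesh `1 / n`. -/
def posIncr (X : ℝ≥0 → Ω → ℝ) (m n : ℕ) (ω : Ω) : ℝ≥0∞ :=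
  ∑ k ∈ Finset.range (m * n), ENNReal.ofReal (cellIncr X 0 1 n k ω)

lemma measurable_posIncr (hX : IsRegularLevy X P) (m n : ℕ) : Measurable (posIncr X m n) :=
  Finset.measurable_sum _ fun k _ => (measurable_cellIncr hX 0 1 n k).ennreal_ofReal

lemma lintegral_posIncr_le (hX : IsRegularLevy X P) {K : ℝ≥0∞}
    (hK : ∀ n : ℕ, n ≠ 0 → n * ∫⁻ ω, ENNReal.ofReal (X (1 / n) ω) ∂P ≤ K) (m : ℕ) {n : ℕ}
    (hn : n ≠ 0) : ∫⁻ ω, posIncr X m n ω ∂P ≤ m * K := by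
  have := nat_mul_lintegral_eq hX ENNReal.measurable_ofReal n (m * n)
  simp only [posIncr]
  rw [← this]
  push_cast
  rw [mul_assoc]
  gcongr
  exact hK n hn

lemma ofReal_sumIoc_le_liminf (hX : IsRegularLevy X P) {ω : Ω}
    (hω : LocallySummable fun r => |jump (fun s => X s ω) r|) (m : ℕ) :
    ENNReal.ofReal (sumIoc (fun r => max (jump (fun s => X s ω) r) 0) 0 m) ≤
      liminf (fun n => posIncr X m (n + 1) ω) atTop := by
  have hs : LocallySummable fun r => max (jump (fun s => X s ω) r) 0 := hω.of_abs_le fun r => by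
    rw [abs_of_nonneg (le_max_right _ _)]
    exact max_le (le_abs_self _) (abs_nonneg _)
  set κ : ℕ → ℝ≥0 → ℕ := fun n s => ⌈s * (n + 1 : ℕ)⌉₊ with hκ
  have hκm : ∀ n, Monotone (κ n) := fun n s t hst => Nat.ceil_mono (by gcongr)
  set L : ℕ → ℝ≥0 → ℝ := fun n s =>
    ∑ k ∈ Finset.range (κ n s), max (cellIncr X 0 1 (n + 1) k ω) 0 with hL
  have hLm : ∀ n, Monotone (L n) := fun n s t hst =>
    Finset.sum_le_sum_of_subset_of_nonneg (Finset.range_mono (hκm n hst))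
      fun _ _ _ => le_max_right _ _
  have hu : ∀ n s, X (grid 0 1 (n + 1) (κ n s)) ω =
      ∑ k ∈ Finset.range (κ n s), cellIncr X 0 1 (n + 1) k ω := fun n s => by
    simp only [cellIncr]
    rw [Finset.sum_range_sub (fun k => X (grid 0 1 (n + 1) k) ω), grid_zero, hX.zero, sub_zero]
  have hev := fun η (hη : (0 : ℝ) < η) => eventually_pureJump_le (hX.cadlag ω) hs hLm
    (u := fun n s => X (grid 0 1 (n + 1) (κ n s)) ω)
    (fun n s t hst => by
      simp only [hu, hL]
      rw [← Finset.sum_Ico_eq_sub _ (hκm n hst), ← Finset.sum_Ico_eq_sub _ (hκm n hst)]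
      exact Finset.sum_le_sum fun k _ => le_max_left _ _)
    (fun t => ((hX.cadlag ω t).1.tendsto).comp (tendsto_grid_ceil t))
    (fun n => by
      have : κ n 0 = 0 := by simp [hκ]
      simp [hL, this, grid_zero, hX.zero]) m hη
  refine ENNReal.le_of_forall_pos_le_add fun η hη _ => ?_
  rw [← tsub_le_iff_right]
  refine le_liminf_of_le (by isBoundedDefault) ((hev η hη).mono fun n hn => ?_)
  rw [tsub_le_iff_right, hX.zero, max_self, zero_add] at *
  have e : posIncr X m (n + 1) ω = ENNReal.ofReal (L n m) := by
    have h1 : κ n m = m * (n + 1) := by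
      simp only [hκ]
      rw [← Nat.cast_mul, Nat.ceil_natCast]
    rw [hL, posIncr, ENNReal.ofReal_sum_of_nonneg fun _ _ => le_max_right _ _]
    simp only [h1]
    refine Finset.sum_congr rfl fun k _ => ?_
    rw [ENNReal.ofReal_max]
    simp
  rw [e, ← ENNReal.ofReal_coe_nnreal]
  refine (ENNReal.ofReal_le_ofReal ?_).trans ENNReal.ofReal_add_le
  linarith

/-- The value of the dividends at the barrier `0`. -/
def zeroL (X : ℝ≥0 → Ω → ℝ) (P : Measure Ω) (q x : ℝ) : ℝ≥0∞ :=
  ∫⁻ ω, npv q (dividendsZero (drift X P) (shifted X x ω)) ∂P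

/-- The value of the injections at the barrier `0`. -/
def zeroR (X : ℝ≥0 → Ω → ℝ) (P : Measure Ω) (q x : ℝ) : ℝ≥0∞ :=
  ∫⁻ ω, npv q (injectionsZero (drift X P) (shifted X x ω)) ∂P

lemma isAdmissible_zero_shifted (hX : IsRegularLevy X P) (hbv : HasBVPaths X P) (x : ℝ) :
    ∀ᵐ ω ∂P, IsAdmissible (shifted X x ω) (dividendsZero (drift X P) (shifted X x ω))
      (injectionsZero (drift X P) (shifted X x ω)) 0 :=
  (isJumpDriftPath_shifted hX hbv x).mono fun _ h => isAdmissible_zero h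

theorem zeroL_lt_top (hX : IsRegularLevy X P) (hint : Integrable (X 1) P) (hq : 0 < q)
    (hbv : HasBVPaths X P) (x : ℝ) : zeroL X P q x < ∞ := by
  have := hX.isProbabilityMeasure
  obtain ⟨K, hK, hKn⟩ := exists_mul_lintegral_pos_le hX hint hbv
  set δ := drift X P with hδ
  set A : ℝ≥0∞ := ENNReal.ofReal (max x 0) + ENNReal.ofReal (max δ 0) + K with hA
  have hAfin : A < ∞ := by simp [hA, hK]
  set H : ℕ → Ω → ℝ≥0∞ := fun m ω =>
    ENNReal.ofReal (max x 0 + max δ 0 * (m + 1 : ℕ)) +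
      liminf (fun n => posIncr X (m + 1) (n + 1) ω) atTop with hH
  have hHm : ∀ m, Measurable (H m) := fun m =>
    (Measurable.liminf fun n => measurable_posIncr hX (m + 1) (n + 1)).const_add _
  have hHint : ∀ m, ∫⁻ ω, H m ω ∂P ≤ ((m + 1 : ℕ) : ℝ≥0∞) * A := fun m => by
    have h1 : ∫⁻ ω, liminf (fun n => posIncr X (m + 1) (n + 1) ω) atTop ∂P ≤
        ((m + 1 : ℕ) : ℝ≥0∞) * K := by
      refine (lintegral_liminf_le fun n => measurable_posIncr hX (m + 1) (n + 1)).trans ?_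
      refine (liminf_le_liminf (Eventually.of_forall fun n =>
        lintegral_posIncr_le hX hKn (m + 1) n.succ_ne_zero)).trans_eq ?_
      exact liminf_const _
    have h2 : (1 : ℝ≥0∞) ≤ ((m + 1 : ℕ) : ℝ≥0∞) := by exact_mod_cast Nat.le_add_left _ _
    simp only [hH]
    rw [lintegral_add_left measurable_const, lintegral_const, measure_univ, mul_one, hA, mul_add]
    refine add_le_add (ENNReal.ofReal_add_le.trans ?_) h1
    rw [mul_add, ENNReal.ofReal_mul (le_max_right _ _), ENNReal.ofReal_natCast,
      mul_comm (ENNReal.ofReal (max δ 0))]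
    gcongr
    exact le_mul_of_one_le_left' h2
  calc zeroL X P q x
      ≤ ∫⁻ ω, ∑' m : ℕ, ENNReal.ofReal (Real.exp (-q * m)) * H m ω ∂P := by
        refine lintegral_mono_ae ?_
        filter_upwards [isJumpDriftPath_shifted hX hbv x] with ω hω
        have hAd := isAdmissible_zero hω
        rw [npv_eq hq hAd.monoL hAd.nonnegL]
        refine (lintegral_kill_le_tsum hq
          (F := fun s => ENNReal.ofReal (dividendsZero δ (shifted X x ω) s))
          fun s t hst => ENNReal.ofReal_le_ofReal (hAd.monoL hst)).trans
          (ENNReal.tsum_le_tsum fun m => ?_)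
        have hs := hω.summable
        rw [jump_shifted hX] at hs
        have h1 := ofReal_sumIoc_le_liminf hX hs (m + 1)
        rw [dividendsZero_eq, jump_shifted hX, shifted, hX.zero, add_zero]
        gcongr
        refine ENNReal.ofReal_add_le.trans ?_
        simp only [hH]
        push_cast at h1 ⊢
        gcongr
    _ = ∑' m : ℕ, ENNReal.ofReal (Real.exp (-q * m)) * ∫⁻ ω, H m ω ∂P := by
        rw [lintegral_tsum fun m => ((hHm m).const_mul _).aemeasurable]
        exact tsum_congr fun m => lintegral_const_mul' _ _ (by simp)
    _ ≤ ∑' m : ℕ, ENNReal.ofReal (Real.exp (-q * m)) * (((m + 1 : ℕ) : ℝ≥0∞) * A) := by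
        gcongr with m
        exact hHint m
    _ < ∞ := tsum_exp_mul_lt_top hq hAfin

theorem zeroR_lt_top (hX : IsRegularLevy X P) (hint : Integrable (X 1) P) (hq : 0 < q)
    (hbv : HasBVPaths X P) (x : ℝ) : zeroR X P q x < ∞ :=
  (lintegral_injections_le hX hq (isAdmissible_zero_shifted hX hbv x)).trans_lt
    (ENNReal.add_lt_top.2 ⟨zeroL_lt_top hX hint hq hbv x, ENNReal.add_lt_top.2
      ⟨lintegral_discSize_lt_top hX hint hq x, ENNReal.ofReal_lt_top⟩⟩)

/-- The expected contribution of the top stages in the passage to finer barriers. -/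
def tailSum (X : ℝ≥0 → Ω → ℝ) (P : Measure Ω) (q x : ℝ) (K : ℕ) : ℝ≥0∞ :=
  ∑' i, ENNReal.ofReal (dyadic (K + i + 1)) * meanTop X P q x (dyadic (K + i + 1))

lemma tailSum_zero_lt_top (hX : IsRegularLevy X P) (hint : Integrable (X 1) P) (hq : 0 < q)
    {C : ℝ} (hC : ∀ k, (posL X P q x (dyadic k)).toReal ≤ C) : tailSum X P q x 0 < ∞ := by
  have hterm : ∀ i, ENNReal.ofReal (dyadic (0 + i + 1)) * meanTop X P q x (dyadic (0 + i + 1)) =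
      ENNReal.ofReal (dyadic (i + 1) * (meanTop X P q x (dyadic (i + 1))).toReal) := fun i => by
    rw [zero_add, ENNReal.ofReal_mul (dyadic_pos _).le,
      ENNReal.ofReal_toReal (meanTop_lt_top hX hq x (dyadic_pos _)).ne]
  rw [tailSum, tsum_congr hterm]
  refine lt_top_iff_ne_top.2 (Summable.tsum_ofReal_ne_top ?_)
  have hle : ∀ i, dyadic (i + 1) * (meanTop X P q x (dyadic (i + 1))).toReal ≤
      2 * (posL X P q x (dyadic (i + 1 + 1))).toReal - 2 * (posL X P q x (dyadic (i + 1))).toReal :=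
    fun i => by
      have h1 := posL_slope hX hint hq x _ _ (dyadic_pos (i + 1)) (dyadic_pos (i + 1 + 1))
      have h2 := dyadic_sub_succ (i + 1)
      have h3 : dyadic (i + 1 + 1) = dyadic (i + 1) / 2 := by linarith
      rw [h3] at h1 ⊢
      nlinarith
  refine summable_of_sum_range_le (c := 2 * C)
    (fun i => mul_nonneg (dyadic_pos _).le ENNReal.toReal_nonneg) fun n => ?_
  refine (Finset.sum_le_sum fun i _ => hle i).trans ?_
  rw [Finset.sum_range_sub (fun i => 2 * (posL X P q x (dyadic (i + 1))).toReal)]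
  have h1 := hC (n + 1)
  have h2 : 0 ≤ (posL X P q x (dyadic (0 + 1))).toReal := ENNReal.toReal_nonneg
  linarith

lemma tendsto_tailSum (h : tailSum X P q x 0 < ∞) :
    Tendsto (tailSum X P q x) atTop (𝓝 0) := by
  have h0 : ∑' i, ENNReal.ofReal (dyadic (i + 1)) * meanTop X P q x (dyadic (i + 1)) ≠ ∞ := by
    simpa [tailSum] using h.ne
  refine (ENNReal.tendsto_sum_nat_add _ h0).congr fun K => tsum_congr fun i => ?_
  rw [add_comm i K]

lemma lintegral_tsum_discTop (hX : IsRegularLevy X P) (q x : ℝ) (K : ℕ) :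
    ∫⁻ ω, ∑' i, ENNReal.ofReal (dyadic (K + i + 1)) *
      discTop q (dyadic (K + i + 1)) (shifted X x ω) ∂P = tailSum X P q x K := by
  have hm : ∀ i, Measurable fun ω => ENNReal.ofReal (dyadic (K + i + 1)) *
      discTop q (dyadic (K + i + 1)) (shifted X x ω) := fun i =>
    (measurable_discTop hX (dyadic_pos _).le q x).const_mul _
  rw [lintegral_tsum fun i => (hm i).aemeasurable]
  exact tsum_congr fun i => lintegral_const_mul _ (measurable_discTop hX (dyadic_pos _).le q x)

lemma lintegral_tsum_discBottom_le (hX : IsRegularLevy X P) (hq : 0 < q) (x : ℝ) (K : ℕ) :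
    ∫⁻ ω, ∑' i, ENNReal.ofReal (dyadic (K + i + 1)) *
      discBottom q (dyadic (K + i + 1)) (shifted X x ω) ∂P ≤ tailSum X P q x K := by
  rw [← lintegral_tsum_discTop hX]
  refine lintegral_mono fun ω => ENNReal.tsum_le_tsum fun i => ?_
  gcongr
  exact ENNReal.tsum_le_tsum fun j =>
    ENNReal.ofReal_le_ofReal (discount_anti hq (crossTime_mono (by lia)))

lemma zeroL_le (hX : IsRegularLevy X P) (hq : 0 < q) (hbv : HasBVPaths X P) (x : ℝ) (K : ℕ) :
    zeroL X P q x ≤ posL X P q x (dyadic K) + tailSum X P q x K := by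
  rw [← lintegral_tsum_discTop hX, posL, ← lintegral_add_right _ (Measurable.tsum fun i =>
    (measurable_discTop hX (dyadic_pos _).le q x).const_mul _)]
  exact lintegral_mono_ae ((isJumpDriftPath_shifted hX hbv x).mono fun ω h =>
    npv_dividendsZero_le hq h K)

lemma zeroR_le (hX : IsRegularLevy X P) (hq : 0 < q) (hbv : HasBVPaths X P) (x : ℝ) (K : ℕ) :
    zeroR X P q x ≤ posR X P q x (dyadic K) + tailSum X P q x K := by
  refine le_trans ?_ (add_le_add_right (lintegral_tsum_discBottom_le hX hq x K) _)
  rw [posR, ← lintegral_add_right _ (Measurable.tsum fun i =>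
    (measurable_discBottom hX (dyadic_pos _).le q x).const_mul _)]
  exact lintegral_mono_ae ((isJumpDriftPath_shifted hX hbv x).mono fun ω h =>
    npv_injectionsZero_le hq h K)

lemma posL_le_zeroL (hX : IsRegularLevy X P) (hint : Integrable (X 1) P) (hq : 0 < q)
    (hbv : HasBVPaths X P) (x : ℝ) {a : ℝ} (ha : 0 < a) :
    (posL X P q x a).toReal ≤ (zeroL X P q x).toReal := by
  have h1 : (posL X P q x a).toReal ≤
      (zeroL X P q x).toReal + (0 - a) * (meanTop X P q x a).toReal :=
    posL_le hX hint hq ha (isAdmissible_zero_shifted hX hbv x) (zeroL_lt_top hX hint hq hbv x)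
  have h2 : 0 ≤ a * (meanTop X P q x a).toReal := by positivity
  linarith

lemma posR_le_zeroR (hX : IsRegularLevy X P) (hint : Integrable (X 1) P) (hq : 0 < q)
    (hbv : HasBVPaths X P) (x : ℝ) {a : ℝ} (ha : 0 < a) :
    (posR X P q x a).toReal ≤ (zeroR X P q x).toReal := by
  have h1 : (posR X P q x a).toReal ≤ (zeroR X P q x).toReal +
      (0 - a) * ((meanTop X P q x a).toReal * (nuE X P q a).toReal) :=
    posR_le hX hint hq ha (isAdmissible_zero_shifted hX hbv x) (zeroR_lt_top hX hint hq hbv x)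
  have h2 : 0 ≤ a * ((meanTop X P q x a).toReal * (nuE X P q a).toReal) := by positivity
  linarith

/-- The value of the double barrier strategy at the barrier `0`. -/
def zeroValue (X : ℝ≥0 → Ω → ℝ) (P : Measure Ω) (q β x : ℝ) : ℝ :=
  (zeroL X P q x).toReal - β * (zeroR X P q x).toReal

lemma tendsto_toReal_tailSum (hX : IsRegularLevy X P) (hint : Integrable (X 1) P) (hq : 0 < q)
    (hbv : HasBVPaths X P) (x : ℝ) :
    tailSum X P q x 0 < ∞ ∧ Tendsto (fun K => (tailSum X P q x K).toReal) atTop (𝓝 0) := by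
  have h1 := tailSum_zero_lt_top (x := x) hX hint hq
    fun k => posL_le_zeroL hX hint hq hbv x (dyadic_pos k)
  refine ⟨h1, ?_⟩
  exact (ENNReal.tendsto_toReal ENNReal.zero_ne_top).comp (tendsto_tailSum h1)

lemma tailSum_le (X : ℝ≥0 → Ω → ℝ) (P : Measure Ω) (q x : ℝ) (K : ℕ) :
    tailSum X P q x K ≤ tailSum X P q x 0 := by
  have h := ENNReal.tsum_comp_le_tsum_of_injective (f := fun i : ℕ => K + i) (add_right_injective K)
    fun i => ENNReal.ofReal (dyadic (0 + i + 1)) * meanTop X P q x (dyadic (0 + i + 1))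
  simpa [tailSum] using h

theorem zeroValue_le (hX : IsRegularLevy X P) (hint : Integrable (X 1) P) (hq : 0 < q)
    (hβ : 0 ≤ β) (hbv : HasBVPaths X P) (x : ℝ) {v : ℝ}
    (hv : ∀ a, 0 < a → posValue X P q β x a ≤ v) : zeroValue X P q β x ≤ v := by
  obtain ⟨h0, hlim⟩ := tendsto_toReal_tailSum hX hint hq hbv x
  have hlim' : Tendsto (fun K => v + (tailSum X P q x K).toReal) atTop (𝓝 v) := by
    simpa using hlim.const_add v
  refine ge_of_tendsto' hlim' fun K => ?_
  have hT : tailSum X P q x K ≠ ∞ := ((tailSum_le X P q x K).trans_lt h0).ne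
  have hL := (posL_lt_top hX hint hq x (dyadic_pos K)).ne
  have h1 := ENNReal.toReal_mono (ENNReal.add_ne_top.2 ⟨hL, hT⟩) (zeroL_le hX hq hbv x K)
  rw [ENNReal.toReal_add hL hT] at h1
  have h2 := mul_le_mul_of_nonneg_left (posR_le_zeroR hX hint hq hbv x (dyadic_pos K)) hβ
  have h3 := hv _ (dyadic_pos K)
  rw [posValue] at h3
  rw [zeroValue]
  linarith

theorem posValue_le_zeroValue (hX : IsRegularLevy X P) (hint : Integrable (X 1) P) (hq : 0 < q)
    (hβ : 0 ≤ β) (hbv : HasBVPaths X P) (h0 : aStar X P q β = 0) (x : ℝ) {a : ℝ} (ha : 0 < a) :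
    posValue X P q β x a ≤ zeroValue X P q β x := by
  obtain ⟨hT0, hlim⟩ := tendsto_toReal_tailSum hX hint hq hbv x
  have hlim' : Tendsto (fun K => zeroValue X P q β x + β * (tailSum X P q x K).toReal) atTop
      (𝓝 (zeroValue X P q β x)) := by
    simpa using (hlim.const_mul β).const_add (zeroValue X P q β x)
  refine ge_of_tendsto hlim' ?_
  filter_upwards [tendsto_dyadic.eventually (gt_mem_nhds ha)] with K hK
  have hT : tailSum X P q x K ≠ ∞ := ((tailSum_le X P q x K).trans_lt hT0).ne
  have hR := (posR_lt_top hX hint hq x (dyadic_pos K)).ne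
  have h1 := ENNReal.toReal_mono (ENNReal.add_ne_top.2 ⟨hR, hT⟩) (zeroR_le hX hq hbv x K)
  rw [ENNReal.toReal_add hR hT] at h1
  have h2 := mul_le_mul_of_nonneg_left h1 hβ
  have h3 := posL_le_zeroL hX hint hq hbv x (dyadic_pos K)
  have h4 := posValue_anti hX hint hq hβ h0 x (dyadic_pos K) hK.le
  rw [posValue, posValue] at h4
  rw [zeroValue, posValue]
  linarith

/-- The candidate barrier vanishes only for processes with bounded variation paths. -/
theorem hasBVPaths_of_aStar_eq_zero (hX : IsRegularLevy X P) (hint : Integrable (X 1) P)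
    (hq : 0 < q) (hβ : 1 < β) (h0 : aStar X P q β = 0) : HasBVPaths X P := by
  have hβ0 : 0 ≤ β := by linarith
  set C := (sizeBound X P q 0).toReal with hC
  have hCfin : sizeBound X P q 0 ≠ ∞ := (lintegral_discSize_lt_top hX hint hq 0).ne
  set v := posValue X P q β 0 1 with hv
  have hbd : ∀ k, (posL X P q 0 (dyadic k)).toReal ≤ (C - v) / (β - 1) + C := fun k => by
    have hR := (posR_lt_top hX hint hq 0 (dyadic_pos k)).ne
    have h1 : posL X P q 0 (dyadic k) ≤ posR X P q 0 (dyadic k) + sizeBound X P q 0 :=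
      lintegral_dividends_le hX hq (isAdmissible_pos_shifted hX 0 (dyadic_pos k))
    have h2 := ENNReal.toReal_mono (ENNReal.add_ne_top.2 ⟨hR, hCfin⟩) h1
    rw [ENNReal.toReal_add hR hCfin] at h2
    have h3 : v ≤ posValue X P q β 0 (dyadic k) := posValue_anti hX hint hq hβ0 h0 0 (dyadic_pos k)
      ((dyadic_anti k.zero_le).trans_eq dyadic_zero)
    rw [posValue] at h3
    have h4 : (posR X P q 0 (dyadic k)).toReal ≤ (C - v) / (β - 1) := by
      rw [le_div_iff₀ (by linarith)]
      linarith
    linarith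
  have hT := tailSum_zero_lt_top hX hint hq hbd
  rw [← lintegral_tsum_discTop hX] at hT
  have hae := ae_lt_top (Measurable.tsum fun i =>
    (measurable_discTop hX (dyadic_pos _).le q 0).const_mul _) hT.ne
  filter_upwards [hae] with ω hω
  have hω' : ∑' i, ENNReal.ofReal (dyadic (i + 1)) *
      discTop q (dyadic (i + 1)) (shifted X 0 ω) < ∞ := by simpa using hω
  have := locallyBoundedVariationOn_of_tsum_lt_top hq (hX.cadlag_shifted 0 ω) hω'
  have e : shifted X 0 ω = fun t => X t ω := funext fun t => zero_add _
  rwa [e] at this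

end ZeroValues

/-! ### Conclusion -/

section Conclusion

variable {Ω : Type*} [mΩ : MeasurableSpace Ω] {X Z : ℝ≥0 → Ω → ℝ} {P : Measure Ω} {a x q β : ℝ}

/-- Every Lévy process is indistinguishable from one all of whose paths are càdlàg. -/
lemma exists_isRegularLevy (hX : IsLevyProcess X P) :
    ∃ Z, IsRegularLevy Z P ∧ ∀ᵐ ω ∂P, ∀ t, Z t ω = X t ω := by
  obtain ⟨S, hSsub, hS, hSP⟩ := (hX.start_zero.and hX.cadlag).exists_measurable_mem
  have hae : ∀ᵐ ω ∂P, ∀ t, S.indicator (X t) ω = X t ω := by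
    filter_upwards [hSsub] with ω hω t
    exact indicator_of_mem hω _
  refine ⟨fun t => S.indicator (X t), ⟨fun t => (hX.measurable t).indicator hS, fun ω => ?_,
    fun ω => ?_, fun n t ht => ?_, fun s t => ?_⟩, hae⟩
  · by_cases h : ω ∈ S
    · simp only [indicator_of_mem h]
      exact (hSP ω h).1
    · simp only [indicator_of_notMem h]
  · by_cases h : ω ∈ S
    · simp only [indicator_of_mem h]
      exact (hSP ω h).2
    · simp only [indicator_of_notMem h]
      exact fun t => ⟨continuousWithinAt_const, 0, tendsto_const_nhds⟩
  · refine (hX.indep_increments n t ht).congr fun i => ?_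
    filter_upwards [hae] with ω hω
    rw [hω, hω]
  · refine (IdentDistrib.of_ae_eq ?_ ?_).trans ((hX.stationary s t).trans
      (IdentDistrib.of_ae_eq (hX.measurable t).aemeasurable ?_))
    · exact (((hX.measurable _).indicator hS).sub ((hX.measurable _).indicator hS)).aemeasurable
    · filter_upwards [hae] with ω hω
      rw [hω, hω]
    · filter_upwards [hae] with ω hω
      exact (hω t).symm

lemma ae_path_eq (h : ∀ᵐ ω ∂P, ∀ t, Z t ω = X t ω) :
    ∀ᵐ ω ∂P, (fun t => Z t ω) = fun t => X t ω := h.mono fun _ h => funext h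

lemma ae_shifted_eq (h : ∀ᵐ ω ∂P, ∀ t, Z t ω = X t ω) (x : ℝ) :
    ∀ᵐ ω ∂P, shifted Z x ω = shifted X x ω :=
  h.mono fun ω h => funext fun t => by rw [shifted, shifted, h]

lemma drift_congr (h : ∀ᵐ ω ∂P, ∀ t, Z t ω = X t ω) : drift Z P = drift X P :=
  integral_congr_ae (by
    filter_upwards [h, ae_path_eq h] with ω h1 h2
    rw [h1, h1, h2])

lemma valueL_congr (h : ∀ᵐ ω ∂P, ∀ t, Z t ω = X t ω) (q a x : ℝ) :
    valueL Z P q a x = valueL X P q a x := by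
  rw [valueL, valueL, drift_congr h]
  exact lintegral_congr_ae ((ae_shifted_eq h x).mono fun ω h => by simp only [h])

lemma valueR_congr (h : ∀ᵐ ω ∂P, ∀ t, Z t ω = X t ω) (q a x : ℝ) :
    valueR Z P q a x = valueR X P q a x := by
  rw [valueR, valueR, drift_congr h]
  exact lintegral_congr_ae ((ae_shifted_eq h x).mono fun ω h => by simp only [h])

lemma nu_congr (h : ∀ᵐ ω ∂P, ∀ t, Z t ω = X t ω) (q a : ℝ) : nu Z P q a = nu X P q a :=
  integral_congr_ae ((ae_shifted_eq h a).mono fun ω h => by simp only [h])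

lemma barrierSet_congr (h : ∀ᵐ ω ∂P, ∀ t, Z t ω = X t ω) (q β : ℝ) :
    barrierSet Z P q β = barrierSet X P q β := by
  simp only [barrierSet, nu_congr h]

lemma hasBVPaths_congr (h : ∀ᵐ ω ∂P, ∀ t, Z t ω = X t ω) : HasBVPaths Z P ↔ HasBVPaths X P :=
  eventually_congr ((ae_path_eq h).mono fun ω h => by rw [h])

lemma dividends_of_pos (ha : 0 < a) (δ : ℝ) (w : ℝ≥0 → ℝ) :
    dividends δ a w = dividendsPos w a := funext fun _ => if_neg ha.ne'

lemma injections_of_pos (ha : 0 < a) (δ : ℝ) (w : ℝ≥0 → ℝ) :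
    injections δ a w = injectionsPos w a := funext fun _ => if_neg ha.ne'

lemma dividends_zero (δ : ℝ) (w : ℝ≥0 → ℝ) : dividends δ 0 w = dividendsZero δ w :=
  funext fun _ => if_pos rfl

lemma injections_zero (δ : ℝ) (w : ℝ≥0 → ℝ) : injections δ 0 w = injectionsZero δ w :=
  funext fun _ => if_pos rfl

lemma valueL_pos (ha : 0 < a) : valueL X P q a x = posL X P q x a := by
  simp only [valueL, posL, dividends_of_pos ha]

lemma valueR_pos (ha : 0 < a) : valueR X P q a x = posR X P q x a := by
  simp only [valueR, posR, injections_of_pos ha]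

lemma valueL_zero : valueL X P q 0 x = zeroL X P q x := by
  simp only [valueL, zeroL, dividends_zero]

lemma valueR_zero : valueR X P q 0 x = zeroR X P q x := by
  simp only [valueR, zeroR, injections_zero]

lemma value_pos (ha : 0 < a) : value X P q β a x = posValue X P q β x a := by
  rw [value, posValue, valueL_pos ha, valueR_pos ha]

lemma value_zero : value X P q β 0 x = zeroValue X P q β x := by
  rw [value, zeroValue, valueL_zero, valueR_zero]

theorem value_le_aStar (hX : IsRegularLevy X P) (hint : Integrable (X 1) P) (hq : 0 < q)
    (hβ : 1 < β) (ha : 0 ≤ a) (hbv : a = 0 → HasBVPaths X P) :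
    valueL X P q a x < ∞ ∧ valueR X P q a x < ∞ ∧
      value X P q β a x ≤ value X P q β (aStar X P q β) x := by
  have hβ0 : 0 ≤ β := by linarith
  have hpos : 0 < aStar X P q β → ∀ b, 0 < b →
      posValue X P q β x b ≤ value X P q β (aStar X P q β) x := fun h b hb => by
    rw [value_pos h]
    exact posValue_le_aStar hX hint hq hβ0 h x hb
  rcases ha.eq_or_lt with rfl | ha
  · have hbv := hbv rfl
    refine ⟨valueL_zero.trans_lt (zeroL_lt_top hX hint hq hbv x),
      valueR_zero.trans_lt (zeroR_lt_top hX hint hq hbv x), ?_⟩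
    rcases (aStar_nonneg X P q β).eq_or_lt with h | h
    · rw [← h]
    · rw [value_zero]
      exact zeroValue_le hX hint hq hβ0 hbv x (hpos h)
  · refine ⟨(valueL_pos ha).trans_lt (posL_lt_top hX hint hq x ha),
      (valueR_pos ha).trans_lt (posR_lt_top hX hint hq x ha), ?_⟩
    rw [value_pos ha]
    rcases (aStar_nonneg X P q β).eq_or_lt with h | h
    · rw [← h, value_zero]
      exact posValue_le_zeroValue hX hint hq hβ0
        (hasBVPaths_of_aStar_eq_zero hX hint hq hβ h.symm) h.symm x ha
    · exact hpos h a ha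

end Conclusion

end DoubleBarrier

end

theorem lemma4p1 {Ω : Type*} [MeasurableSpace Ω] (P : Measure Ω) [IsProbabilityMeasure P]
    (X : ℝ≥0 → Ω → ℝ) (hX : DoubleBarrier.IsLevyProcess X P)
    (hmono : ¬ ∀ᵐ ω ∂P, Monotone fun t => X t ω)
    (hanti : ¬ ∀ᵐ ω ∂P, Antitone fun t => X t ω)
    (hint : Integrable (X 1) P)
    (q β : ℝ) (hq : 0 < q) (hβ : 1 < β) :
    (DoubleBarrier.barrierSet X P q β).Nonempty ∧
    (¬ DoubleBarrier.HasBVPaths X P → 0 < DoubleBarrier.aStar X P q β) ∧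
    ∀ a x : ℝ, 0 ≤ a → 0 ≤ x → (a = 0 → DoubleBarrier.HasBVPaths X P) →
      DoubleBarrier.valueL X P q a x < ∞ ∧ DoubleBarrier.valueR X P q a x < ∞ ∧
      DoubleBarrier.value X P q β a x ≤
        DoubleBarrier.value X P q β (DoubleBarrier.aStar X P q β) x := by
  obtain ⟨Z, hZ, hZX⟩ := DoubleBarrier.exists_isRegularLevy hX
  have hZint : Integrable (Z 1) P := hint.congr (hZX.mono fun ω h => (h 1).symm)
  rw [← DoubleBarrier.hasBVPaths_congr hZX]
  simp only [DoubleBarrier.value, DoubleBarrier.aStar, ← DoubleBarrier.valueL_congr hZX,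
    ← DoubleBarrier.valueR_congr hZX, ← DoubleBarrier.barrierSet_congr hZX]
  refine ⟨DoubleBarrier.barrierSet_nonempty hZ hq, fun h => ?_, fun a x ha _ hbv =>
    DoubleBarrier.value_le_aStar hZ hZint hq hβ ha hbv⟩
  exact (DoubleBarrier.aStar_nonneg Z P q β).lt_of_ne fun h0 =>
    h (DoubleBarrier.hasBVPaths_of_aStar_eq_zero hZ hZint hq hβ h0.symm)
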